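/- Let $n\ge 2$, let $\Omega\subset\mathbb{R}^n$ be a bounded domain with $C^3$ boundary and outward unit normal $\vec{\mathbf n}$, let $q>0$, $\alpha\in(0,1)$, $\phi\in C^3(\overline\Omega)$, $u_0\in C^{2,\alpha}(\overline\Omega)$, and let $c=c(x,z)$, $f=f(x,z)$ be functions in $C^{1,\alpha}(\overline\Omega\times\mathbb{R})$ such that, for some constant $C$ and all $(x,z)\in\overline\Omega\times\mathbb{R}$, $$|c|\le C,\quad |D_xc|\le C,\quad c_z\le 0,\qquad |f|\le C,\quad |D_xf|\le C,\quad f_z\ge 0.$$ For $y\in\partial\Omega$ let $C_0(y)$ be the largest eigenvalue of $-\kappa$, where $\kappa$ is the curvature matrix of $\partial\Omega$ at $y$ (the Hessian at $y$ of $\partial\Omega$ written as a graph over its tangent space at $y$ in the direction $-\vec{\mathbf n}(y)$, so that $\kappa\ge0$ if $\Omega$ is convex), and let $K_0(y)=\sup\{r>0: B(y-r\vec{\mathbf n}(y),r)\subseteq\Omega\}$. Put $C_0=\sup_{y\in\partial\Omega}C_0(y)$ and $K_0=\inf_{y\in\partial\Omega}K_0(y)$. Suppose that there is $\delta>0$ such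 that for all $(x,z)\in\overline\Omega\times\mathbb{R}$ $$\frac{1}{n-1}c(x,z)^2-|D_xc(x,z)|-\delta>\max\left\{0,\ C_0|c(x,z)|+\frac{(n-1)C_0}{K_0}+(1+q)\,\mathrm{sgn}(C_0)\,C_0^2\right\}.$$ Then there is a constant $R>1$, depending only on $\Omega,c,f,\phi,q,u_0$, with the following property. Let $T\in(0,\infty)$, $\eta\in(0,1]$, $\sigma\in(0,1)$, and let $u^\eta\in C^{2,\sigma}(\overline\Omega\times[0,T])\cap C^{3,\sigma}(\Omega\times(0,T])$ (parabolic Hölder classes: the derivatives $D_t^rD_x^su$ with $2r+s\le k$ exist and are locally $\sigma$-Hölder continuous for the parabolic distance $|x-x'|+|t-t'|^{1/2}$, with $k=2$ and $k=3$ respectively) be a solution of $$\begin{cases}u_t=v\,\mathrm{div}\left(\dfrac{Du}{v}\right)+c(x,u)\,v-f(x,u)&\text{in }\Omega\times(0,T),\\[1mm]\dfrac{\partial u}{\partial\vec{\mathbf n}}=\phi(x)\,v^{1-q}&\text{on }\partial\Omega\times[0,T),\\[1mm]u(x,0)=u_0(x)&\text{on }\overline\Omega,\end{cases}\qquad v=\sqrt{\eta^2+|Du|^2}.$$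 Then $$\|Du^\eta\|_{L^\infty(\overline\Omega\times[0,T])}\le R.$$ In particular $R$ does not depend on $T$ or on $\eta\in(0,1]$. -/

import Mathlib

open Set Filter Topology

noncomputable section

/-! ### Domains with `C³` boundary, and the curvature of the boundary -/

/-- Near `y`, the set `Ω` is the strict epigraph, in the direction `-ν`, of a `C³` function `g`
on the hyperplane `ν^⊥`, with `g 0 = 0` and `Dg 0 = 0`: a point `y + x' - s • ν`
(`x' ⊥ ν`, `(x', s)` close to `0`) lies in `Ω` if and only if `g x' < s`. Consequently `ν` is the
outward unit normal of `∂Ω` at `y`, the hyperplane `ν^⊥` is the tangent space, and near `y` the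
boundary is the graph `s = g x'`. -/
structure IsBoundaryGraph {n : ℕ} (Ω : Set (EuclideanSpace ℝ (Fin n)))
    (y ν : EuclideanSpace ℝ (Fin n))
    (g : (Submodule.span ℝ {ν})ᗮ → ℝ) : Prop where
  norm_eq_one : ‖ν‖ = 1
  contDiffAt : ContDiffAt ℝ 3 g 0
  map_zero : g 0 = 0
  fderiv_zero : fderiv ℝ g 0 = 0
  mem_iff : ∀ᶠ p : (Submodule.span ℝ {ν})ᗮ × ℝ in 𝓝 0,
    (y + (p.1 : EuclideanSpace ℝ (Fin n)) - p.2 • ν ∈ Ω ↔ g p.1 < p.2)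

/-- `ν` is the outward unit normal vector of `∂Ω` at `y`. -/
def IsOutwardNormal {n : ℕ} (Ω : Set (EuclideanSpace ℝ (Fin n)))
    (y ν : EuclideanSpace ℝ (Fin n)) : Prop :=
  ∃ g : (Submodule.span ℝ {ν})ᗮ → ℝ, IsBoundaryGraph Ω y ν g

/-- A bounded domain (open connected set) whose boundary is of class `C³`. -/
structure IsBoundedC3Domain {n : ℕ} (Ω : Set (EuclideanSpace ℝ (Fin n))) : Prop where
  isOpen : IsOpen Ω
  isConnected : IsConnected Ω
  isBounded : Bornology.IsBounded Ω
  boundary : ∀ y ∈ frontier Ω, ∃ ν, IsOutwardNormal Ω y ν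

/-- `k` is a principal curvature of `∂Ω` at `y`: an eigenvalue of the Hessian `κ = D²g(0)` on the
tangent space, where `g` is the graph representation of `∂Ω` over the tangent space in the
direction of the inward normal (so the curvatures are nonnegative if `Ω` is convex). -/
def IsPrincipalCurvature {n : ℕ} (Ω : Set (EuclideanSpace ℝ (Fin n)))
    (y : EuclideanSpace ℝ (Fin n)) (k : ℝ) : Prop :=
  ∃ (ν : EuclideanSpace ℝ (Fin n)) (g : (Submodule.span ℝ {ν})ᗮ → ℝ),
    IsBoundaryGraph Ω y ν g ∧
      ∃ τ : (Submodule.span ℝ {ν})ᗮ, τ ≠ 0 ∧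
        ∀ ξ : (Submodule.span ℝ {ν})ᗮ, fderiv ℝ (fderiv ℝ g) 0 τ ξ = k * inner ℝ τ ξ

/-- `C₀(y)`, the largest eigenvalue of `-κ` at the boundary point `y`. -/
def curvatureAt {n : ℕ} (Ω : Set (EuclideanSpace ℝ (Fin n)))
    (y : EuclideanSpace ℝ (Fin n)) : ℝ :=
  sSup {l : ℝ | IsPrincipalCurvature Ω y (-l)}

/-- `C₀ = sup {C₀(y) : y ∈ ∂Ω}`. -/
def curvatureConst {n : ℕ} (Ω : Set (EuclideanSpace ℝ (Fin n))) : ℝ :=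
  sSup (curvatureAt Ω '' frontier Ω)

/-- `K₀(y)`, the supremum of the radii of the balls in `Ω` that touch `∂Ω` at `y`. -/
def interiorRadiusAt {n : ℕ} (Ω : Set (EuclideanSpace ℝ (Fin n)))
    (y : EuclideanSpace ℝ (Fin n)) : ℝ :=
  sSup {r : ℝ | 0 < r ∧ ∃ ν, IsOutwardNormal Ω y ν ∧ Metric.ball (y - r • ν) r ⊆ Ω}

/-- `K₀ = inf {K₀(y) : y ∈ ∂Ω}`. -/
def interiorRadiusConst {n : ℕ} (Ω : Set (EuclideanSpace ℝ (Fin n))) : ℝ :=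
  sInf (interiorRadiusAt Ω '' frontier Ω)

/-! ### Hölder classes -/

/-- `F` is `α`-Hölder continuous on every compact subset of `S` (on `S` itself, if `S` is
compact). -/
def HolderOnCompacts {X Y : Type*} [NormedAddCommGroup X] [NormedAddCommGroup Y]
    (α : ℝ) (F : X → Y) (S : Set X) : Prop :=
  ∀ K ⊆ S, IsCompact K → ∃ C : ℝ, ∀ p ∈ K, ∀ p' ∈ K, ‖F p - F p'‖ ≤ C * ‖p - p'‖ ^ α

/-- The class `C^{k,α}(S)`. -/
def IsCkHolder {X : Type*} [NormedAddCommGroup X] [NormedSpace ℝ X]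
    (k : ℕ) (α : ℝ) (F : X → ℝ) (S : Set X) : Prop :=
  ContDiffOn ℝ k F S ∧ HolderOnCompacts α (iteratedFDerivWithin ℝ k F S) S

/-- `F = F(x,t)` is Hölder continuous with exponent `σ` for the parabolic distance
`|x - x'| + |t - t'|^{1/2}`, on every compact subset of `S`. -/
def ParabolicHolderOnCompacts {X Y : Type*} [NormedAddCommGroup X] [NormedAddCommGroup Y]
    (σ : ℝ) (F : X → ℝ → Y) (S : Set (X × ℝ)) : Prop :=
  ∀ K ⊆ S, IsCompact K → ∃ C : ℝ, ∀ p ∈ K, ∀ p' ∈ K,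
    ‖F p.1 p.2 - F p'.1 p'.2‖ ≤ C * (‖p.1 - p'.1‖ ^ σ + |p.2 - p'.2| ^ (σ / 2))

/-- The parabolic class `C^{k,σ}(S × I)`, for `k = 2` and `k = 3`: all the derivatives
`D_t^r D_x^s u` with `2 r + s ≤ k` (so `r ≤ 1`) exist and are parabolically `σ`-Hölder continuous
on the compact subsets of `S × I`. -/
structure IsParabolicCkHolder {n : ℕ} (k : ℕ) (σ : ℝ) (S : Set (EuclideanSpace ℝ (Fin n)))
    (I : Set ℝ) (u : EuclideanSpace ℝ (Fin n) → ℝ → ℝ) : Prop where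
  contDiffOn_space : ∀ t ∈ I, ContDiffOn ℝ k (fun x => u x t) S
  differentiableOn_time : ∀ x ∈ S, DifferentiableOn ℝ (u x) I
  contDiffOn_time_space : ∀ j : ℕ, 2 + j ≤ k → ∀ t ∈ I,
    ContDiffOn ℝ j (fun x => derivWithin (u x) I t) S
  holder_space : ∀ j : ℕ, j ≤ k →
    ParabolicHolderOnCompacts σ
      (fun x t => iteratedFDerivWithin ℝ j (fun y => u y t) S x) (S ×ˢ I)
  holder_time_space : ∀ j : ℕ, 2 + j ≤ k →
    ParabolicHolderOnCompacts σ
      (fun x t => iteratedFDerivWithin ℝ j (fun y => derivWithin (u y) I t) S x) (S ×ˢ I)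

/-! ### The regularized equation -/

/-- The gradient of `F = F(x,s)` with respect to `x`, for `x` in the closure of `Ω`. -/
def spaceGrad {n : ℕ} (Ω : Set (EuclideanSpace ℝ (Fin n)))
    (F : EuclideanSpace ℝ (Fin n) → ℝ → ℝ) (x : EuclideanSpace ℝ (Fin n)) (s : ℝ) :
    EuclideanSpace ℝ (Fin n) :=
  gradientWithin (fun y => F y s) (closure Ω) x

/-- The divergence of a vector field. -/
def divergence {n : ℕ} (X : EuclideanSpace ℝ (Fin n) → EuclideanSpace ℝ (Fin n))
    (x : EuclideanSpace ℝ (Fin n)) : ℝ :=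
  ∑ i : Fin n, (fderiv ℝ X x (EuclideanSpace.single i 1)) i

/-- `v = √(η² + |Du|²)`. -/
def areaFactor {n : ℕ} (Ω : Set (EuclideanSpace ℝ (Fin n))) (η : ℝ)
    (u : EuclideanSpace ℝ (Fin n) → ℝ → ℝ) (x : EuclideanSpace ℝ (Fin n)) (t : ℝ) : ℝ :=
  Real.sqrt (η ^ 2 + ‖spaceGrad Ω u x t‖ ^ 2)

/-- `u` solves
`u_t = v div (Du / v) + c(x,u) v - f(x,u)` in `Ω × (0,T)`,
`∂u/∂n = φ(x) v^{1-q}` on `∂Ω × [0,T)`, and `u(·,0) = u₀` on the closure of `Ω`. -/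
structure IsRegularizedSolution {n : ℕ} (Ω : Set (EuclideanSpace ℝ (Fin n))) (T η q : ℝ)
    (c f : EuclideanSpace ℝ (Fin n) → ℝ → ℝ) (φ u₀ : EuclideanSpace ℝ (Fin n) → ℝ)
    (u : EuclideanSpace ℝ (Fin n) → ℝ → ℝ) : Prop where
  equation : ∀ x ∈ Ω, ∀ t ∈ Ioo 0 T,
    deriv (u x) t =
      areaFactor Ω η u x t *
          divergence (fun y => (areaFactor Ω η u y t)⁻¹ • spaceGrad Ω u y t) x
        + c x (u x t) * areaFactor Ω η u x t - f x (u x t)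
  boundary : ∀ x ∈ frontier Ω, ∀ ν, IsOutwardNormal Ω x ν → ∀ t ∈ Ico 0 T,
    inner ℝ (spaceGrad Ω u x t) ν = φ x * areaFactor Ω η u x t ^ (1 - q)
  initial : ∀ x ∈ closure Ω, u x 0 = u₀ x

/-- The coercivity condition on the forcing term `c`. -/
def IsCoerciveForce {n : ℕ} (Ω : Set (EuclideanSpace ℝ (Fin n))) (q : ℝ)
    (c : EuclideanSpace ℝ (Fin n) → ℝ → ℝ) : Prop :=
  ∃ δ : ℝ, 0 < δ ∧ ∀ x ∈ closure Ω, ∀ z : ℝ,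
    max 0 (curvatureConst Ω * |c x z|
        + ((n : ℝ) - 1) * curvatureConst Ω / interiorRadiusConst Ω
        + (1 + q) * Real.sign (curvatureConst Ω) * curvatureConst Ω ^ 2)
      < 1 / ((n : ℝ) - 1) * c x z ^ 2 - ‖spaceGrad Ω c x z‖ - δ

end

noncomputable section

set_option linter.unusedSectionVars false

/-! The maximum principle is applied to w = v^{q+1}/(q+1) - ⟨φN, Du⟩ (`gradQuantity`), where N is a
C² field extending the outward normal. For large v this quantity dominates v. Its derivative in the
gradient variable is ξ = v^{q-1}Du - φN, and the boundary condition says exactly that ξ is tangent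
to ∂Ω at boundary points.

Boundary. At a boundary maximum the normal derivative of w is therefore, to leading order, v^q times
a mixed tangential-normal second derivative of u. Differentiating the boundary condition along ∂Ω
expresses that entry through the curvature, and for any C above the positive part of C₀ and all
large v the normal derivative of w is less than (1+q)Cw (`boundary_max_normal_derivative_lt`). On a
ball of radius r < K₀ touching ∂Ω at the point, w is multiplied by the concave function ρ = 1 + Br²
- B|x - x_c|² with 2Br = (1+q)C. Since ρ = 1 on the sphere and ρw increases inwards, the maximum of
ρw lies inside the ball (`exists_interior_max_of_boundary_max`).

Interior. At an interior maximum of ρw the equation is differentiated in the direction ξ and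
combined with the first and second order conditions (`interior_max_inequality`). After division by
v^{q+1}, up to errors controlled by 1/v and v^{-q}, this reads |D_x c| + C|c| + (n-1)C/r + (1+q)C² -
Q ≥ 0, where Q is a weighted square norm of D²u/v. The equation says that the weighted trace of
D²u/v is -c + (u_t + f)/v, so Cauchy-Schwarz gives Q ≥ c²/(n-1) up to errors, and coercivity yields
a contradiction (`interior_algebra`, `interior_max_false`). The smallness is uniform for η ≤ 1.

Time derivative. The trace step needs a bound for u_t independent of T and η. A comparison principle
(`IsCylinderSolution.le_add`), applied to u and its time translates, bounds u_t by its values at t =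
0, and there the equation bounds it by u₀ (`IsRegularizedSolution.abs_deriv_le`). -/

/-! ### Defining functions of domains -/

section DefiningFunction

variable {E : Type*} [NormedAddCommGroup E] [InnerProductSpace ℝ E] [CompleteSpace E]

/-- `G` is a `C³` defining function of `Ω` near the boundary point `y`, with gradient `ν` at `y`. -/
structure IsDefiningAt (Ω : Set E) (y ν : E) (G : E → ℝ) : Prop where
  contDiffAt : ContDiffAt ℝ 3 G y
  map_zero : G y = 0
  gradient_eq : gradient G y = ν
  mem_iff : ∀ᶠ p in 𝓝 y, (p ∈ Ω ↔ G p < 0)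

theorem inner_gradient (G : E → ℝ) (p d : E) : inner ℝ (gradient G p) d = fderiv ℝ G p d := by
  simp [gradient]

theorem contDiffAt_gradient_of_contDiffAt {G : E → ℝ} {y : E} {m k : WithTop ℕ∞}
    (h : ContDiffAt ℝ k G y) (hmk : m + 1 ≤ k) : ContDiffAt ℝ m (gradient G) y :=
  ((InnerProductSpace.toDual ℝ E).symm.toContinuousLinearEquiv.contDiff.contDiffAt).comp y
    (h.fderiv_right hmk)

/-- The first-order Taylor estimate at all points near `y`. -/
theorem exists_taylor_bound {G : E → ℝ} {y : E} (h : ContDiffAt ℝ 3 G y) :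
    ∃ L > 0, ∃ δ > 0, ∀ z ∈ Metric.ball y δ, ∀ d : E, z + d ∈ Metric.ball y δ →
      |G (z + d) - G z - inner ℝ (gradient G z) d| ≤ L * ‖d‖ ^ 2 := by
  obtain ⟨K, t, ht, hK⟩ :=
    (h.fderiv_right (m := 1) (by norm_num)).exists_lipschitzOnWith
  have h1 : ∀ᶠ p in 𝓝 y, DifferentiableAt ℝ G p := by
    filter_upwards [h.eventually (by simp)] with p hp
    exact hp.differentiableAt (by simp)
  obtain ⟨δ, hδ, hball⟩ := Metric.eventually_nhds_iff_ball.1 (h1.and ht)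
  refine ⟨K + 1, by positivity, δ, hδ, fun z hz d hd => ?_⟩
  have hseg : segment ℝ z (z + d) ⊆ Metric.ball y δ :=
    (convex_ball y δ).segment_subset hz hd
  have := Convex.norm_image_sub_le_of_norm_hasFDerivWithin_le' (f := G) (f' := fderiv ℝ G)
    (φ := fderiv ℝ G z) (C := (K + 1) * ‖d‖) (s := segment ℝ z (z + d)) (x := z) (y := z + d)
    (fun x hx => (hball x (hseg hx)).1.hasFDerivAt.hasFDerivWithinAt)
    (fun x hx => ?_) (convex_segment _ _) (left_mem_segment _ _ _) (right_mem_segment _ _ _)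
  · rw [inner_gradient]
    simp only [add_sub_cancel_left, Real.norm_eq_abs] at this
    calc _ ≤ _ := this
      _ = _ := by ring
  · have h2 := hK.norm_sub_le (hball x (hseg hx)).2 (hball z hz).2
    have h3 : ‖x - z‖ ≤ ‖d‖ := by
      rw [segment_eq_image'] at hx
      obtain ⟨θ, hθ, rfl⟩ := hx
      simp only [add_sub_cancel_left, norm_smul, Real.norm_eq_abs, abs_of_nonneg hθ.1]
      nlinarith [hθ.2, norm_nonneg d]
    calc _ ≤ _ := h2
      _ ≤ K * ‖d‖ := by gcongr
      _ ≤ _ := by nlinarith [norm_nonneg d]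

/-- A tangent ball becomes a sign condition on a quadratic expression, directly comparable with the
Taylor estimate of a defining function. -/
theorem mem_ball_sub_smul_iff {y N p : E} {r : ℝ} (hN : ‖N‖ = 1) (hr : 0 < r) :
    p ∈ Metric.ball (y - r • N) r ↔ ‖p - y‖ ^ 2 + 2 * r * inner ℝ (p - y) N < 0 := by
  rw [mem_ball_iff_norm, show p - (y - r • N) = (p - y) + r • N by abel,
    ← sq_lt_sq₀ (norm_nonneg _) hr.le, norm_add_sq_real, norm_smul, inner_smul_right, hN,
    Real.norm_eq_abs, abs_of_pos hr]
  constructor <;> intro h <;> linarith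

theorem mem_ball_add_smul_iff {y N p : E} {r : ℝ} (hN : ‖N‖ = 1) (hr : 0 < r) :
    p ∈ Metric.ball (y + r • N) r ↔ ‖p - y‖ ^ 2 - 2 * r * inner ℝ (p - y) N < 0 := by
  have := mem_ball_sub_smul_iff (y := y) (p := p) (N := -N) (by simpa using hN) hr
  simpa [sub_eq_add_neg] using this

theorem norm_lt_of_sq_add_inner_neg {d N : E} {r : ℝ} (hN : ‖N‖ = 1) (hr : 0 < r)
    (h : ‖d‖ ^ 2 + 2 * r * inner ℝ d N < 0) : ‖d‖ < 2 * r := by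
  have h1 := abs_le.1 (abs_real_inner_le_norm d N)
  rw [hN, mul_one] at h1
  by_contra! h2
  nlinarith [norm_nonneg d]

/-- The normalized gradient of a defining function. -/
def unitGradient (G : E → ℝ) (p : E) : E := ‖gradient G p‖⁻¹ • gradient G p

theorem IsDefiningAt.contDiffAt_gradient {Ω : Set E} {y ν : E} {G : E → ℝ}
    (h : IsDefiningAt Ω y ν G) : ContDiffAt ℝ 2 (gradient G) y :=
  contDiffAt_gradient_of_contDiffAt h.contDiffAt (by norm_num)

theorem IsDefiningAt.contDiffAt_unitGradient {Ω : Set E} {y ν : E} {G : E → ℝ}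
    (h : IsDefiningAt Ω y ν G) (hν : ‖ν‖ = 1) : ContDiffAt ℝ 2 (unitGradient G) y := by
  have h0 : gradient G y ≠ 0 := by
    rw [h.gradient_eq]; intro h0; simp [h0] at hν
  exact ((h.contDiffAt_gradient.norm ℝ h0).inv (by simpa using h0)).smul h.contDiffAt_gradient

theorem IsDefiningAt.eventually_norm_gradient {Ω : Set E} {y ν : E} {G : E → ℝ}
    (h : IsDefiningAt Ω y ν G) (hν : ‖ν‖ = 1) : ∀ᶠ p in 𝓝 y, 1 / 2 < ‖gradient G p‖ := by
  have := h.contDiffAt_gradient.continuousAt.norm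
  refine this.eventually (lt_mem_nhds ?_)
  simp only [h.gradient_eq, hν]; norm_num

theorem norm_unitGradient {G : E → ℝ} {p : E} (h : 1 / 2 < ‖gradient G p‖) :
    ‖unitGradient G p‖ = 1 := by
  have : ‖gradient G p‖ ≠ 0 := by linarith
  rw [unitGradient, norm_smul, norm_inv, norm_norm, inv_mul_cancel₀ this]

/-- Interior and exterior tangent balls of uniform size near a boundary point. -/
theorem IsDefiningAt.exists_balls {Ω : Set E} {y ν : E} {G : E → ℝ}
    (h : IsDefiningAt Ω y ν G) (hν : ‖ν‖ = 1) :
    ∃ r > 0, ∀ᶠ z in 𝓝 y, G z = 0 →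
      Metric.ball (z - r • unitGradient G z) r ⊆ Ω ∧
      Metric.ball (z + r • unitGradient G z) r ∩ Ω = ∅ := by
  obtain ⟨L, hL, δ₁, hδ₁, hT⟩ := exists_taylor_bound h.contDiffAt
  obtain ⟨δ₂, hδ₂, hball⟩ :=
    Metric.eventually_nhds_iff_ball.1 (h.mem_iff.and (h.eventually_norm_gradient hν))
  set δ := min δ₁ δ₂ with hδ
  have hδ0 : 0 < δ := lt_min hδ₁ hδ₂
  -- In the interior ball ⟨p - z, N⟩ < -‖p - z‖²/(2r). Since the gradient has norm above 1/2, the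
  -- linear term of G beats L‖p - z‖² as soon as 4Lr ≤ 1. The bound δ/4 keeps balls touching at
  -- points within δ/2 of y inside the Taylor neighbourhood.
  set r := min (1 / (4 * L)) (δ / 4) with hr
  have hr0 : 0 < r := lt_min (by positivity) (by positivity)
  have hr1 : 4 * L * r ≤ 1 := by
    have : r ≤ 1 / (4 * L) := min_le_left _ _
    rwa [le_div_iff₀ (by positivity), mul_comm] at this
  have hr2 : 4 * r ≤ δ := by linarith [min_le_right (1 / (4 * L)) (δ / 4)]
  refine ⟨r, hr0, ?_⟩
  filter_upwards [Metric.ball_mem_nhds y (half_pos hδ0)] with z hz hGz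
  have hzδ : z ∈ Metric.ball y δ := Metric.ball_subset_ball (by linarith) hz
  have hz1 : z ∈ Metric.ball y δ₁ := Metric.ball_subset_ball (min_le_left _ _) hzδ
  have hz2 : z ∈ Metric.ball y δ₂ := Metric.ball_subset_ball (min_le_right _ _) hzδ
  have hg := (hball z hz2).2
  have hN := norm_unitGradient hg
  have hgN : gradient G z = ‖gradient G z‖ • unitGradient G z := by
    rw [unitGradient, smul_smul, mul_inv_cancel₀ (by linarith), one_smul]
  have key : ∀ p : E, ‖p - z‖ < 2 * r → (p ∈ Ω ↔ G p < 0) ∧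
      |G p - ‖gradient G z‖ * inner ℝ (p - z) (unitGradient G z)| ≤ L * ‖p - z‖ ^ 2 := by
    intro p hp
    have hpδ : p ∈ Metric.ball y δ := by
      have h1 := dist_triangle p z y
      rw [dist_eq_norm p z] at h1
      have h2 := Metric.mem_ball.1 hz
      exact Metric.mem_ball.2 (by linarith)
    refine ⟨(hball p (Metric.ball_subset_ball (min_le_right _ _) hpδ)).1, ?_⟩
    have h1 := hT z hz1 (p - z)
      (by simpa using Metric.ball_subset_ball (min_le_left _ _) hpδ)
    rw [hGz, hgN, inner_smul_left, real_inner_comm] at h1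
    simpa using h1
  constructor
  · intro p hp
    rw [mem_ball_sub_smul_iff hN hr0] at hp
    obtain ⟨h1, h2⟩ := key p (norm_lt_of_sq_add_inner_neg hN hr0 hp)
    rw [h1]
    have h3 := (abs_le.1 h2).2
    have h4 : inner ℝ (p - z) (unitGradient G z) < 0 := by
      by_contra! h5
      nlinarith [sq_nonneg ‖p - z‖, mul_nonneg hr0.le h5]
    nlinarith [sq_nonneg ‖p - z‖, mul_pos hL hr0]
  · ext p
    simp only [mem_inter_iff, mem_empty_iff_false, iff_false, not_and]
    intro hp
    rw [mem_ball_add_smul_iff hN hr0] at hp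
    obtain ⟨h1, h2⟩ := key p (norm_lt_of_sq_add_inner_neg (N := -unitGradient G z)
      (by simpa using hN) hr0 (by rw [inner_neg_right]; linarith))
    rw [h1, not_lt]
    have h3 := (abs_le.1 h2).1
    have h4 : 0 < inner ℝ (p - z) (unitGradient G z) := by
      by_contra! h5
      nlinarith [sq_nonneg ‖p - z‖, mul_nonneg hr0.le (neg_nonneg.2 h5)]
    nlinarith [sq_nonneg ‖p - z‖, mul_pos hL hr0]

/-- If an interior ball touches the boundary at `y`, its axis is the normal at `y`. -/
theorem IsDefiningAt.eq_of_ball_subset {Ω : Set E} {y ν N : E} {G : E → ℝ} {r : ℝ}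
    (h : IsDefiningAt Ω y ν G) (hν : ‖ν‖ = 1) (hN : ‖N‖ = 1) (hr : 0 < r)
    (hb : Metric.ball (y - r • N) r ⊆ Ω) : N = ν := by
  by_contra hne
  have hlt : inner ℝ N ν < 1 := by
    have h1 := norm_sub_sq_real N ν
    have h2 : 0 < ‖N - ν‖ := norm_pos_iff.2 (sub_ne_zero.2 hne)
    rw [hN, hν] at h1
    nlinarith
  -- If the axes differ, this direction enters the ball (⟨d, N⟩ < 0) and at the same time leaves Ω
  -- to first order (⟨ν, d⟩ > 0).
  set d := ν - N with hd
  have hdN : inner ℝ d N < 0 := by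
    rw [hd, inner_sub_left, real_inner_self_eq_norm_sq, hN, real_inner_comm]; linarith
  have hdν : 0 < inner ℝ ν d := by
    rw [hd, inner_sub_right, real_inner_self_eq_norm_sq, hν, real_inner_comm]; linarith
  have hline : HasDerivAt (fun s : ℝ => G (y + s • d)) (inner ℝ ν d) 0 := by
    have h1 : HasFDerivAt G (fderiv ℝ G y) (y + (0:ℝ) • d) := by
      simpa using (h.contDiffAt.differentiableAt (by simp)).hasFDerivAt
    have h2 : HasDerivAt (fun s : ℝ => y + s • d) d 0 := by
      simpa using ((hasDerivAt_id (0:ℝ)).smul_const d).const_add y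
    have := h1.comp_hasDerivAt (0:ℝ) h2
    rwa [← inner_gradient, h.gradient_eq] at this
  have hpos : ∀ᶠ s in 𝓝[>] (0:ℝ), 0 < G (y + s • d) := by
    have := (hasDerivAt_iff_tendsto_slope.1 hline).mono_left
      (nhdsWithin_mono (0:ℝ) (fun s (hs : 0 < s) => (ne_of_gt hs : s ≠ 0)))
    filter_upwards [this.eventually (lt_mem_nhds hdν), self_mem_nhdsWithin] with s hs hs0
    rw [slope_def_field] at hs
    simp only [zero_smul, add_zero, h.map_zero, sub_zero] at hs
    exact (div_pos_iff_of_pos_right hs0).1 hs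
  have hmem : ∀ᶠ s in 𝓝[>] (0:ℝ), (y + s • d ∈ Ω ↔ G (y + s • d) < 0) := by
    have h2 : Tendsto (fun s : ℝ => y + s • d) (𝓝[>] 0) (𝓝 y) := by
      have : Continuous (fun s : ℝ => y + s • d) := by fun_prop
      simpa using (this.tendsto 0).mono_left nhdsWithin_le_nhds
    exact h2.eventually h.mem_iff
  have hin : ∀ᶠ s in 𝓝[>] (0:ℝ), y + s • d ∈ Ω := by
    have h3 : ∀ᶠ s in 𝓝 (0:ℝ), s * ‖d‖ ^ 2 + 2 * r * inner ℝ d N < 0 := by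
      have : Continuous (fun s : ℝ => s * ‖d‖ ^ 2 + 2 * r * inner ℝ d N) := by fun_prop
      refine this.continuousAt.eventually (gt_mem_nhds ?_)
      simp only [zero_mul, zero_add]; nlinarith
    filter_upwards [h3.filter_mono nhdsWithin_le_nhds, self_mem_nhdsWithin] with s hs hs0
    refine hb ((mem_ball_sub_smul_iff hN hr).2 ?_)
    have hs0 : 0 < s := hs0
    rw [add_sub_cancel_left, norm_smul, inner_smul_left, Real.norm_eq_abs, abs_of_pos hs0]
    simp only [conj_trivial]
    nlinarith
  obtain ⟨s, hs1, hs2, hs3⟩ := (hpos.and (hmem.and hin)).exists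
  have := hs2.1 hs3
  linarith

end DefiningFunction

/-! ### Second-derivative tests on the line -/

/-- The second-derivative test at a local minimum. -/
theorem second_deriv_nonneg_of_isLocalMin {f f' : ℝ → ℝ} {f'' a : ℝ}
    (h1 : ∀ᶠ s in 𝓝 a, HasDerivAt f (f' s) s) (h2 : HasDerivAt f' f'' a)
    (hmin : IsLocalMin f a) : 0 ≤ f'' := by
  by_contra! hlt
  have hd : deriv f =ᶠ[𝓝 a] f' := h1.mono fun s hs => hs.deriv
  have hdd : deriv (deriv f) a = f'' := by rw [hd.deriv_eq, h2.deriv]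
  have hmax : IsLocalMax f a :=
    isLocalMax_of_deriv_deriv_neg (by rw [hdd]; exact hlt) hmin.deriv_eq_zero
      h1.self_of_nhds.continuousAt
  -- A negative second derivative makes the minimum a local maximum too, so the function is locally
  -- constant, which contradicts the sign.
  have hconst : f =ᶠ[𝓝 a] fun _ => f a := by
    filter_upwards [hmin, hmax] with s hs1 hs2
    exact le_antisymm hs2 hs1
  have h0 : deriv f =ᶠ[𝓝 a] fun _ => 0 := by
    filter_upwards [hconst.eventuallyEq_nhds] with s hs
    rw [hs.deriv_eq, deriv_const]
  rw [h0.deriv_eq, deriv_const] at hdd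
  linarith

/-- The second-derivative test at a local maximum. -/
theorem second_deriv_nonpos_of_isLocalMax {f f' : ℝ → ℝ} {f'' a : ℝ}
    (h1 : ∀ᶠ s in 𝓝 a, HasDerivAt f (f' s) s) (h2 : HasDerivAt f' f'' a)
    (hmax : IsLocalMax f a) : f'' ≤ 0 := by
  have := second_deriv_nonneg_of_isLocalMin (f := fun s => -f s) (f' := fun s => -f' s)
    (h1.mono fun s hs => hs.neg) h2.neg hmax.neg
  linarith

theorem hasDerivAt_fderiv_smul {F : Type*} [NormedAddCommGroup F] [NormedSpace ℝ F] {g : F → ℝ}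
    (h : ContDiffAt ℝ 3 g 0) (τ ξ : F) :
    HasDerivAt (fun s : ℝ => fderiv ℝ g (s • τ) ξ) (fderiv ℝ (fderiv ℝ g) 0 τ ξ) 0 := by
  have h1 : HasFDerivAt (fderiv ℝ g) (fderiv ℝ (fderiv ℝ g) 0) ((0:ℝ) • τ) := by
    rw [zero_smul]
    exact ((h.fderiv_right (m := 2) (by norm_num)).differentiableAt (by simp)).hasFDerivAt
  have h2 : HasDerivAt (fun s : ℝ => s • τ) τ 0 := by
    simpa using (hasDerivAt_id (0:ℝ)).smul_const τ
  exact (ContinuousLinearMap.apply ℝ ℝ ξ).hasFDerivAt.comp_hasDerivAt (0:ℝ)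
    (h1.comp_hasDerivAt (0:ℝ) h2)

/-! ### Local boundary graphs: defining function, normal, second fundamental form -/

section Graph

variable {n : ℕ}

/-- The defining function of the strict epigraph of `g` in the direction `-ν`. -/
def graphFun (y ν : EuclideanSpace ℝ (Fin n)) (g : (Submodule.span ℝ {ν})ᗮ → ℝ)
    (p : EuclideanSpace ℝ (Fin n)) : ℝ :=
  g ((Submodule.span ℝ {ν})ᗮ.orthogonalProjectionOnto (p - y)) + inner ℝ ν (p - y)

variable {Ω : Set (EuclideanSpace ℝ (Fin n))} {y ν : EuclideanSpace ℝ (Fin n)}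
  {g : (Submodule.span ℝ {ν})ᗮ → ℝ}

theorem hasFDerivAt_graphFun {p : EuclideanSpace ℝ (Fin n)}
    (hg : DifferentiableAt ℝ g ((Submodule.span ℝ {ν})ᗮ.orthogonalProjectionOnto (p - y))) :
    HasFDerivAt (graphFun y ν g)
      ((fderiv ℝ g ((Submodule.span ℝ {ν})ᗮ.orthogonalProjectionOnto (p - y))).comp
        (Submodule.span ℝ {ν})ᗮ.orthogonalProjectionOnto + innerSL ℝ ν) p := by
  have h0 : HasFDerivAt (fun p => p - y) (ContinuousLinearMap.id ℝ _) p :=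
    (hasFDerivAt_id p).sub_const y
  have h1 := ((Submodule.span ℝ {ν})ᗮ.orthogonalProjectionOnto).hasFDerivAt.comp p h0
  have h2 := hg.hasFDerivAt.comp p h1
  have h3 := (innerSL ℝ ν).hasFDerivAt.comp p h0
  exact h2.add h3

theorem IsBoundaryGraph.isDefiningAt (h : IsBoundaryGraph Ω y ν g) :
    IsDefiningAt Ω y ν (graphFun y ν g) := by
  have hπ : ContDiff ℝ 3 fun p : EuclideanSpace ℝ (Fin n) =>
      (Submodule.span ℝ {ν})ᗮ.orthogonalProjectionOnto (p - y) := by fun_prop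
  refine ⟨?_, ?_, ?_, ?_⟩
  · refine ContDiffAt.add (ContDiffAt.comp y ?_ hπ.contDiffAt) ?_
    · simpa using h.contDiffAt
    · exact (contDiff_const.inner ℝ (contDiff_id.sub contDiff_const)).contDiffAt
  · simp [graphFun, h.map_zero]
  · have h1 := hasFDerivAt_graphFun (y := y) (p := y) (g := g)
      (by simpa using h.contDiffAt.differentiableAt (by simp))
    rw [gradient, h1.fderiv]
    simp only [sub_self, ContinuousLinearMap.map_zero, h.fderiv_zero,
      ContinuousLinearMap.zero_comp, zero_add]
    exact (InnerProductSpace.toDual ℝ _).symm_apply_apply ν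
  · have hΨ : Tendsto (fun p : EuclideanSpace ℝ (Fin n) =>
        ((Submodule.span ℝ {ν})ᗮ.orthogonalProjectionOnto (p - y), -inner ℝ ν (p - y)))
        (𝓝 y) (𝓝 0) := by
      have : Continuous (fun p : EuclideanSpace ℝ (Fin n) =>
        ((Submodule.span ℝ {ν})ᗮ.orthogonalProjectionOnto (p - y), -inner ℝ ν (p - y))) := by
        fun_prop
      have h0 := this.tendsto y
      rw [sub_self, ContinuousLinearMap.map_zero, inner_zero_right, neg_zero] at h0
      exact h0
    filter_upwards [hΨ.eventually h.mem_iff] with p hp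
    have h3 : y + ((Submodule.span ℝ {ν})ᗮ.orthogonalProjectionOnto (p - y) :
        EuclideanSpace ℝ (Fin n)) - (-inner ℝ ν (p - y)) • ν = p := by
      rw [Submodule.coe_orthogonalProjectionOnto_apply, Submodule.starProjection_orthogonal,
        sub_apply, Submodule.starProjection_unit_singleton ℝ h.norm_eq_one]
      simp only [ContinuousLinearMap.id_apply, neg_smul, sub_neg_eq_add]
      abel
    rw [h3] at hp
    rw [hp, graphFun]
    constructor <;> intro h4 <;> linarith

/-- The curve in the boundary graph above the line in the direction `τ`. -/
def graphCurve (y ν : EuclideanSpace ℝ (Fin n)) (g : (Submodule.span ℝ {ν})ᗮ → ℝ)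
    (τ : (Submodule.span ℝ {ν})ᗮ) (s : ℝ) : EuclideanSpace ℝ (Fin n) :=
  y + s • (τ : EuclideanSpace ℝ (Fin n)) - g (s • τ) • ν

theorem inner_coe_orthogonal (τ : (Submodule.span ℝ {ν})ᗮ) :
    inner ℝ ν (τ : EuclideanSpace ℝ (Fin n)) = 0 :=
  Submodule.mem_orthogonal_singleton_iff_inner_right.1 τ.2

theorem proj_graphCurve (τ : (Submodule.span ℝ {ν})ᗮ) (s : ℝ) :
    (Submodule.span ℝ {ν})ᗮ.orthogonalProjectionOnto (graphCurve y ν g τ s - y) = s • τ := by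
  have h1 : graphCurve y ν g τ s - y =
      s • (τ : EuclideanSpace ℝ (Fin n)) - g (s • τ) • ν := by rw [graphCurve]; abel
  have h2 : (Submodule.span ℝ {ν})ᗮ.orthogonalProjectionOnto ν = 0 := by
    ext1
    rw [Submodule.coe_orthogonalProjectionOnto_apply, Submodule.starProjection_orthogonal,
      sub_apply, Submodule.starProjection_eq_self_iff.2
        (Submodule.mem_span_singleton_self ν)]
    simp
  rw [h1, map_sub, map_smul, map_smul, h2, Submodule.orthogonalProjectionOnto_mem_subspace_eq_self]
  simp

theorem IsBoundaryGraph.graphFun_graphCurve (h : IsBoundaryGraph Ω y ν g)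
    (τ : (Submodule.span ℝ {ν})ᗮ) (s : ℝ) : graphFun y ν g (graphCurve y ν g τ s) = 0 := by
  have h1 : graphCurve y ν g τ s - y =
      s • (τ : EuclideanSpace ℝ (Fin n)) - g (s • τ) • ν := by rw [graphCurve]; abel
  rw [graphFun, proj_graphCurve, h1, inner_sub_right, inner_smul_right, inner_smul_right,
    inner_coe_orthogonal, real_inner_self_eq_norm_sq, h.norm_eq_one]
  ring

theorem IsBoundaryGraph.graphCurve_zero (h : IsBoundaryGraph Ω y ν g)
    (τ : (Submodule.span ℝ {ν})ᗮ) : graphCurve y ν g τ 0 = y := by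
  simp [graphCurve, h.map_zero]

theorem IsBoundaryGraph.eventually_differentiableAt (h : IsBoundaryGraph Ω y ν g) :
    ∀ᶠ x in 𝓝 0, DifferentiableAt ℝ g x := by
  filter_upwards [h.contDiffAt.eventually (by simp)] with p hp
  exact hp.differentiableAt (by simp)

theorem tendsto_smul_zero {F : Type*} [NormedAddCommGroup F] [NormedSpace ℝ F] (τ : F) :
    Tendsto (fun s : ℝ => s • τ) (𝓝 0) (𝓝 0) := by
  have : Continuous (fun s : ℝ => s • τ) := by fun_prop
  simpa using this.tendsto 0

theorem IsBoundaryGraph.eventually_hasDerivAt (h : IsBoundaryGraph Ω y ν g)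
    (τ : (Submodule.span ℝ {ν})ᗮ) :
    ∀ᶠ s in 𝓝 (0:ℝ), HasDerivAt (fun s : ℝ => g (s • τ)) (fderiv ℝ g (s • τ) τ) s := by
  filter_upwards [(tendsto_smul_zero τ).eventually h.eventually_differentiableAt] with s hs
  have h2 : HasDerivAt (fun s : ℝ => s • τ) τ s := by
    simpa using (hasDerivAt_id s).smul_const τ
  exact hs.hasFDerivAt.comp_hasDerivAt s h2

theorem IsBoundaryGraph.hasDerivAt_fderiv (h : IsBoundaryGraph Ω y ν g)
    (τ ξ : (Submodule.span ℝ {ν})ᗮ) :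
    HasDerivAt (fun s : ℝ => fderiv ℝ g (s • τ) ξ) (fderiv ℝ (fderiv ℝ g) 0 τ ξ) 0 :=
  hasDerivAt_fderiv_smul h.contDiffAt τ ξ

theorem IsBoundaryGraph.hasDerivAt_graphCurve (h : IsBoundaryGraph Ω y ν g)
    (τ : (Submodule.span ℝ {ν})ᗮ) :
    HasDerivAt (graphCurve y ν g τ) (τ : EuclideanSpace ℝ (Fin n)) 0 := by
  have h1 := (h.eventually_hasDerivAt τ).self_of_nhds
  rw [zero_smul, h.fderiv_zero] at h1
  have h2 : HasDerivAt (fun s : ℝ => y + s • (τ : EuclideanSpace ℝ (Fin n))) τ 0 := by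
    simpa using ((hasDerivAt_id (0:ℝ)).smul_const (τ : EuclideanSpace ℝ (Fin n))).const_add y
  have h3 := h2.sub (h1.smul_const ν)
  rw [zero_apply, zero_smul, sub_zero] at h3
  exact h3

/-- Identifies D²g with the shape operator. Along the curve the gradient paired with τ is Dg(sτ)τ.
The derivative of the normalizing factor is multiplied by Dg(0)τ = 0, so only D²g(0)(τ, τ) survives.
-/
theorem IsBoundaryGraph.hasDerivAt_inner_unitGradient (h : IsBoundaryGraph Ω y ν g)
    (τ : (Submodule.span ℝ {ν})ᗮ) :
    HasDerivAt (fun s => inner ℝ (unitGradient (graphFun y ν g) (graphCurve y ν g τ s))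
      (τ : EuclideanSpace ℝ (Fin n))) (fderiv ℝ (fderiv ℝ g) 0 τ τ) 0 := by
  have hD := h.isDefiningAt
  have hne : gradient (graphFun y ν g) y ≠ 0 := by
    rw [hD.gradient_eq]; intro h0; have := h.norm_eq_one; simp [h0] at this
  have h1 : DifferentiableAt ℝ
      (fun s => ‖gradient (graphFun y ν g) (graphCurve y ν g τ s)‖⁻¹) 0 := by
    have h2 : DifferentiableAt ℝ (fun p => ‖gradient (graphFun y ν g) p‖⁻¹)
        (graphCurve y ν g τ 0) := by
      rw [h.graphCurve_zero]
      exact ((hD.contDiffAt_gradient.norm ℝ hne).inv (by simpa using hne)).differentiableAt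
        (by simp)
    exact h2.comp (0:ℝ) (h.hasDerivAt_graphCurve τ).differentiableAt
  have h3 := h1.hasDerivAt.mul (h.hasDerivAt_fderiv τ τ)
  have h4 : (fun s => inner ℝ (unitGradient (graphFun y ν g) (graphCurve y ν g τ s))
      (τ : EuclideanSpace ℝ (Fin n))) =ᶠ[𝓝 0]
      (fun s => ‖gradient (graphFun y ν g) (graphCurve y ν g τ s)‖⁻¹ *
        fderiv ℝ g (s • τ) τ) := by
    filter_upwards [(tendsto_smul_zero τ).eventually h.eventually_differentiableAt] with s hs
    have h5 := hasFDerivAt_graphFun (y := y) (p := graphCurve y ν g τ s) (g := g)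
      (by rwa [proj_graphCurve])
    rw [unitGradient, inner_smul_left, inner_gradient, h5.fderiv, proj_graphCurve]
    simp only [add_apply, ContinuousLinearMap.comp_apply,
      Submodule.orthogonalProjectionOnto_mem_subspace_eq_self, innerSL_apply_apply,
      inner_coe_orthogonal, add_zero]
    simp
  refine (h3.congr_of_eventuallyEq h4).congr_deriv ?_
  simp only [zero_smul, h.fderiv_zero, h.graphCurve_zero, hD.gradient_eq,
    h.norm_eq_one]
  simp

/-- Near `y`, the boundary of `Ω` is the zero set of a defining function. -/
theorem IsDefiningAt.mem_frontier_iff {y ν : EuclideanSpace ℝ (Fin n)}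
    {G : EuclideanSpace ℝ (Fin n) → ℝ} (h : IsDefiningAt Ω y ν G) (hν : ‖ν‖ = 1)
    (hΩ : IsOpen Ω) : ∀ᶠ z in 𝓝 y, (z ∈ frontier Ω ↔ G z = 0) := by
  obtain ⟨r, hr, hballs⟩ := h.exists_balls hν
  have hcont : ∀ᶠ z in 𝓝 y, ContinuousAt G z := by
    filter_upwards [h.contDiffAt.eventually (by simp)] with p hp
    exact hp.continuousAt
  filter_upwards [hballs, hcont, h.mem_iff.eventually_nhds, h.eventually_norm_gradient hν]
    with z hz1 hz2 hz3 hz4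
  rw [hΩ.frontier_eq]
  constructor
  · rintro ⟨hc, hn⟩
    refine le_antisymm ?_ (not_lt.1 fun hlt => hn (hz3.self_of_nhds.2 hlt))
    by_contra! hpos
    have h1 : ∀ᶠ w in 𝓝 z, w ∉ Ω := by
      filter_upwards [hz3, hz2.eventually (lt_mem_nhds hpos)] with w hw1 hw2
      rw [hw1]; exact not_lt.2 hw2.le
    exact (mem_closure_iff_frequently.1 hc) h1
  · intro h0
    refine ⟨?_, fun hin => ?_⟩
    · have h2 := closure_mono (hz1 h0).1
      refine h2 ?_
      rw [closure_ball _ hr.ne', Metric.mem_closedBall, dist_eq_norm]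
      simp [norm_smul, norm_unitGradient hz4, abs_of_pos hr]
    · have := hz3.self_of_nhds.1 hin
      linarith

theorem IsOutwardNormal.norm_eq_one (h : IsOutwardNormal Ω y ν) : ‖ν‖ = 1 := by
  obtain ⟨g, hg⟩ := h
  exact hg.norm_eq_one

theorem IsOutwardNormal.eq_of_ball_subset {N : EuclideanSpace ℝ (Fin n)} {r : ℝ}
    (h : IsOutwardNormal Ω y ν) (hN : ‖N‖ = 1) (hr : 0 < r)
    (hb : Metric.ball (y - r • N) r ⊆ Ω) : N = ν := by
  obtain ⟨g, hg⟩ := h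
  exact hg.isDefiningAt.eq_of_ball_subset hg.norm_eq_one hN hr hb

/-- An outward normal at a nearby point comes from a graph of its own, unrelated to g. The interior
ball whose axis is the unit gradient touches there, and the axis of a touching ball must be that
normal. -/
theorem IsBoundaryGraph.eventually_normal (h : IsBoundaryGraph Ω y ν g) (hΩ : IsOpen Ω) :
    ∀ᶠ z in 𝓝 y, z ∈ frontier Ω → ∀ ν', IsOutwardNormal Ω z ν' →
      unitGradient (graphFun y ν g) z = ν' := by
  obtain ⟨r, hr, hballs⟩ := h.isDefiningAt.exists_balls h.norm_eq_one
  filter_upwards [hballs, h.isDefiningAt.mem_frontier_iff h.norm_eq_one hΩ,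
    h.isDefiningAt.eventually_norm_gradient h.norm_eq_one] with z hz1 hz2 hz3 hz ν' hν'
  exact hν'.eq_of_ball_subset (norm_unitGradient hz3) hr (hz1 (hz2.1 hz)).1

theorem IsBoundaryGraph.eventually_graphCurve_mem (h : IsBoundaryGraph Ω y ν g) (hΩ : IsOpen Ω)
    (τ : (Submodule.span ℝ {ν})ᗮ) : ∀ᶠ s in 𝓝 (0:ℝ), graphCurve y ν g τ s ∈ frontier Ω := by
  have h1 := (h.hasDerivAt_graphCurve τ).continuousAt.tendsto
  rw [h.graphCurve_zero] at h1
  filter_upwards [h1.eventually (h.isDefiningAt.mem_frontier_iff h.norm_eq_one hΩ)] with s hs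
  exact hs.2 (h.graphFun_graphCurve τ s)

end Graph

/-! ### Global geometry of the domain: uniform balls, normal field, `K₀` and `C₀` -/

section Domain

variable {n : ℕ} {Ω : Set (EuclideanSpace ℝ (Fin n))}

theorem IsBoundedC3Domain.isCompact_frontier (hΩ : IsBoundedC3Domain Ω) :
    IsCompact (frontier Ω) :=
  Metric.isCompact_of_isClosed_isBounded isClosed_frontier
    (hΩ.isBounded.closure.subset frontier_subset_closure)

theorem IsBoundedC3Domain.isCompact_closure (hΩ : IsBoundedC3Domain Ω) :
    IsCompact (closure Ω) :=
  Metric.isCompact_of_isClosed_isBounded isClosed_closure hΩ.isBounded.closure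

theorem ball_sub_smul_subset {F : Type*} [NormedAddCommGroup F] [NormedSpace ℝ F]
    {y ν : F} (hν : ‖ν‖ = 1) {r r' : ℝ} (h : r ≤ r') :
    Metric.ball (y - r • ν) r ⊆ Metric.ball (y - r' • ν) r' := by
  refine Metric.ball_subset_ball' ?_
  rw [dist_eq_norm, show y - r • ν - (y - r' • ν) = (r' - r) • ν by rw [sub_smul]; abel,
    norm_smul, hν, Real.norm_eq_abs, abs_of_nonneg (by linarith)]
  linarith

theorem ball_add_smul_subset {F : Type*} [NormedAddCommGroup F] [NormedSpace ℝ F]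
    {y ν : F} (hν : ‖ν‖ = 1) {r r' : ℝ} (h : r ≤ r') :
    Metric.ball (y + r • ν) r ⊆ Metric.ball (y + r' • ν) r' := by
  have := ball_sub_smul_subset (y := y) (ν := -ν) (by simpa using hν) h
  simpa using this

/-- The uniform interior and exterior ball condition. -/
theorem IsBoundedC3Domain.exists_uniform_balls (hΩ : IsBoundedC3Domain Ω) :
    ∃ r > 0, ∀ y ∈ frontier Ω, ∀ ν, IsOutwardNormal Ω y ν →
      Metric.ball (y - r • ν) r ⊆ Ω ∧ Metric.ball (y + r • ν) r ∩ Ω = ∅ := by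
  refine hΩ.isCompact_frontier.induction_on
    (p := fun s => ∃ r > 0, ∀ y ∈ s, ∀ ν, IsOutwardNormal Ω y ν →
      Metric.ball (y - r • ν) r ⊆ Ω ∧ Metric.ball (y + r • ν) r ∩ Ω = ∅)
    ⟨1, one_pos, by simp⟩ ?_ ?_ ?_
  · rintro s t hst ⟨r, hr, h⟩
    exact ⟨r, hr, fun y hy => h y (hst hy)⟩
  · rintro s t ⟨r, hr, h⟩ ⟨r', hr', h'⟩
    have mono : ∀ {a b : ℝ} {y ν : EuclideanSpace ℝ (Fin n)}, ‖ν‖ = 1 → a ≤ b →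
        (Metric.ball (y - b • ν) b ⊆ Ω ∧ Metric.ball (y + b • ν) b ∩ Ω = ∅) →
        (Metric.ball (y - a • ν) a ⊆ Ω ∧ Metric.ball (y + a • ν) a ∩ Ω = ∅) := by
      intro a b y ν hν hab hb
      refine ⟨(ball_sub_smul_subset hν hab).trans hb.1, ?_⟩
      exact subset_empty_iff.1 (hb.2 ▸ inter_subset_inter_left _ (ball_add_smul_subset hν hab))
    refine ⟨min r r', lt_min hr hr', fun y hy ν hν => ?_⟩
    rcases hy with hy | hy
    · exact mono hν.norm_eq_one (min_le_left _ _) (h y hy ν hν)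
    · exact mono hν.norm_eq_one (min_le_right _ _) (h' y hy ν hν)
  · intro y hy
    obtain ⟨ν, g, hg⟩ := hΩ.boundary y hy
    obtain ⟨r, hr, hballs⟩ := hg.isDefiningAt.exists_balls hg.norm_eq_one
    have h := hballs.and ((hg.eventually_normal hΩ.isOpen).and
      (hg.isDefiningAt.mem_frontier_iff hg.norm_eq_one hΩ.isOpen))
    refine ⟨{z | z ∈ frontier Ω ∧ _}, inter_mem_nhdsWithin (frontier Ω) h, r, hr, ?_⟩
    rintro z ⟨hz, h1, h2, h3⟩ ν' hν'
    rw [← h2 hz ν' hν']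
    exact h1 (h3.1 hz)

/-- The normal is the restriction to the boundary of a `C²` vector field. -/
theorem IsBoundedC3Domain.exists_normal_field (hΩ : IsBoundedC3Domain Ω) :
    ∃ N : EuclideanSpace ℝ (Fin n) → EuclideanSpace ℝ (Fin n), ContDiff ℝ 2 N ∧
      ∀ y ∈ frontier Ω, ∀ ν, IsOutwardNormal Ω y ν → N y = ν := by
  -- The requirement at a boundary point forces one vector and elsewhere it is empty, so it is
  -- convex and a partition of unity can glue the local unit gradients.
  have hconv : ∀ y, Convex ℝ {w : EuclideanSpace ℝ (Fin n) |
      y ∈ frontier Ω → ∀ ν, IsOutwardNormal Ω y ν → w = ν} := by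
    intro y
    rw [convex_iff_forall_pos]
    intro w₁ h₁ w₂ h₂ a b _ _ hab hy ν hν
    rw [h₁ hy ν hν, h₂ hy ν hν, ← add_smul, hab, one_smul]
  obtain ⟨N, hN⟩ := exists_contMDiffMap_forall_mem_convex_of_local
    (F := EuclideanSpace ℝ (Fin n)) (n := 2)
    (modelWithCornersSelf ℝ (EuclideanSpace ℝ (Fin n))) hconv fun y => by
      by_cases hy : y ∈ frontier Ω
      · obtain ⟨ν, g, hg⟩ := hΩ.boundary y hy
        have h1 := (hg.isDefiningAt.contDiffAt_unitGradient hg.norm_eq_one).eventually (by simp)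
        refine ⟨_, h1.and (hg.eventually_normal hΩ.isOpen), unitGradient (graphFun y ν g),
          contMDiffOn_iff_contDiffOn.2 fun z hz => hz.1.contDiffWithinAt, fun z hz => hz.2⟩
      · exact ⟨(frontier Ω)ᶜ, isClosed_frontier.isOpen_compl.mem_nhds hy, fun _ => 0,
          contMDiffOn_const, fun z hz hz' => absurd hz' hz⟩
  exact ⟨N, contMDiff_iff_contDiff.1 N.contMDiff, hN⟩

/-- Each boundary point lies on the sphere of a ball inside Ω, and a convex set with interior
determines derivatives at the points of its closure. -/
theorem IsBoundedC3Domain.uniqueDiffOn_closure (hΩ : IsBoundedC3Domain Ω) :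
    UniqueDiffOn ℝ (closure Ω) := by
  intro x hx
  by_cases hxΩ : x ∈ Ω
  · exact (hΩ.isOpen.uniqueDiffWithinAt hxΩ).mono subset_closure
  · obtain ⟨r, hr, h⟩ := hΩ.exists_uniform_balls
    have hxf : x ∈ frontier Ω := by rw [hΩ.isOpen.frontier_eq]; exact ⟨hx, hxΩ⟩
    obtain ⟨ν, hν⟩ := hΩ.boundary x hxf
    have hb := (h x hxf ν hν).1
    refine (uniqueDiffWithinAt_convex (convex_ball (x - r • ν) r) ?_ ?_).mono
      (hb.trans subset_closure)
    · rw [Metric.isOpen_ball.interior_eq]; exact Metric.nonempty_ball.2 hr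
    · rw [closure_ball _ hr.ne', Metric.mem_closedBall, dist_eq_norm]
      simp [norm_smul, hν.norm_eq_one, abs_of_pos hr]

theorem IsBoundedC3Domain.closure_subset_closure_interior (hΩ : IsBoundedC3Domain Ω) :
    closure Ω ⊆ closure (interior (closure Ω)) :=
  closure_mono (hΩ.isOpen.subset_interior_iff.2 subset_closure)

/-- Supplies the boundedness without which the `sSup` in `interiorRadiusAt` would be a default
value. -/
theorem IsBoundedC3Domain.exists_radius_bound (hΩ : IsBoundedC3Domain Ω) :
    ∃ R, ∀ y ∈ frontier Ω, ∀ ν r, IsOutwardNormal Ω y ν → 0 < r →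
      Metric.ball (y - r • ν) r ⊆ Ω → r ≤ R := by
  obtain ⟨R, hR⟩ := hΩ.isBounded.closure.subset_closedBall 0
  refine ⟨R + R, fun y hy ν r hν hr hb => ?_⟩
  have h1 : ‖y‖ ≤ R := by simpa using hR (frontier_subset_closure hy)
  have h2 : ‖y - r • ν‖ ≤ R := by
    simpa using hR (subset_closure (hb (Metric.mem_ball_self hr)))
  have h3 := norm_sub_le y (y - r • ν)
  rw [sub_sub_cancel, norm_smul, hν.norm_eq_one, Real.norm_eq_abs, abs_of_pos hr] at h3
  linarith

theorem IsBoundedC3Domain.exists_le_interiorRadiusAt (hΩ : IsBoundedC3Domain Ω) :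
    ∃ r > 0, ∀ y ∈ frontier Ω, r ≤ interiorRadiusAt Ω y := by
  obtain ⟨r, hr, h⟩ := hΩ.exists_uniform_balls
  obtain ⟨R, hR⟩ := hΩ.exists_radius_bound
  refine ⟨r, hr, fun y hy => ?_⟩
  obtain ⟨ν, hν⟩ := hΩ.boundary y hy
  refine le_csSup ⟨R, ?_⟩ ⟨hr, ν, hν, (h y hy ν hν).1⟩
  rintro r' ⟨hr', ν', hν', hb⟩
  exact hR y hy ν' r' hν' hr' hb

theorem IsBoundedC3Domain.interiorRadiusConst_pos (hΩ : IsBoundedC3Domain Ω)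
    (hne : (frontier Ω).Nonempty) : 0 < interiorRadiusConst Ω := by
  obtain ⟨r, hr, h⟩ := hΩ.exists_le_interiorRadiusAt
  refine hr.trans_le (le_csInf (hne.image _) ?_)
  rintro _ ⟨y, hy, rfl⟩
  exact h y hy

/-- The strict inequality avoids asking whether the supremum is attained: a smaller ball sits in
some admissible one, whose axis is forced to be ν. -/
theorem IsBoundedC3Domain.ball_subset_of_lt (hΩ : IsBoundedC3Domain Ω) {r : ℝ}
    (hr : r < interiorRadiusConst Ω) {y ν : EuclideanSpace ℝ (Fin n)} (hy : y ∈ frontier Ω)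
    (hν : IsOutwardNormal Ω y ν) : Metric.ball (y - r • ν) r ⊆ Ω := by
  obtain ⟨r₀, hr₀, h⟩ := hΩ.exists_le_interiorRadiusAt
  have h1 : interiorRadiusConst Ω ≤ interiorRadiusAt Ω y := by
    refine csInf_le ⟨0, ?_⟩ ⟨y, hy, rfl⟩
    rintro _ ⟨z, hz, rfl⟩
    exact hr₀.le.trans (h z hz)
  obtain ⟨r₁, hr₁, hb₁⟩ := hΩ.exists_uniform_balls
  obtain ⟨r', ⟨hr', ν', hν', hb⟩, hlt⟩ := exists_lt_of_lt_csSup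
    (s := {r : ℝ | 0 < r ∧ ∃ ν, IsOutwardNormal Ω y ν ∧ Metric.ball (y - r • ν) r ⊆ Ω})
    ⟨r₁, hr₁, ν, hν, (hb₁ y hy ν hν).1⟩ (hr.trans_le h1)
  rw [hν.eq_of_ball_subset hν'.norm_eq_one hr' hb] at hb
  exact (ball_sub_smul_subset hν.norm_eq_one hlt.le).trans hb

/-- The squared distance from the centre of the exterior ball to the boundary curve, minus r², is
least at the contact point. Its second derivative there is 2(‖τ‖² + r D²g(τ, τ)). -/
theorem IsBoundaryGraph.neg_inv_le_principalCurvature {y ν : EuclideanSpace ℝ (Fin n)}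
    {g : (Submodule.span ℝ {ν})ᗮ → ℝ} (h : IsBoundaryGraph Ω y ν g) (hΩ : IsOpen Ω) {r : ℝ}
    (hr : 0 < r) (hb : Metric.ball (y + r • ν) r ∩ Ω = ∅) (τ : (Submodule.span ℝ {ν})ᗮ) :
    -(1 / r) * ‖τ‖ ^ 2 ≤ fderiv ℝ (fderiv ℝ g) 0 τ τ := by
  have hg2 := h.hasDerivAt_fderiv τ τ
  have hg1 := h.eventually_hasDerivAt τ
  have h1 : ∀ᶠ s in 𝓝 (0:ℝ), HasDerivAt
      (fun s : ℝ => s ^ 2 * ‖τ‖ ^ 2 + 2 * r * g (s • τ) + g (s • τ) ^ 2)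
      (2 * s * ‖τ‖ ^ 2 + 2 * r * fderiv ℝ g (s • τ) τ + 2 * g (s • τ) * fderiv ℝ g (s • τ) τ)
      s := by
    filter_upwards [hg1] with s hs
    have h2 := (((hasDerivAt_pow 2 s).mul_const (‖τ‖ ^ 2)).add (hs.const_mul (2 * r))).add
      (hs.pow 2)
    refine h2.congr_deriv ?_
    simp
  have h2 := (((((hasDerivAt_id (0:ℝ)).const_mul 2).mul_const (‖τ‖ ^ 2)).add
    (hg2.const_mul (2 * r))).add ((hg1.self_of_nhds.const_mul 2).mul hg2))
  have hmin : IsLocalMin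
      (fun s : ℝ => s ^ 2 * ‖τ‖ ^ 2 + 2 * r * g (s • τ) + g (s • τ) ^ 2) 0 := by
    have hd : Disjoint (Metric.ball (y + r • ν) r) (closure Ω) :=
      (disjoint_iff_inter_eq_empty.2 hb).closure_right Metric.isOpen_ball
    filter_upwards [h.eventually_graphCurve_mem hΩ τ] with s hs
    have h3 : graphCurve y ν g τ s ∉ Metric.ball (y + r • ν) r := fun hin =>
      disjoint_left.1 hd hin (frontier_subset_closure hs)
    rw [mem_ball_add_smul_iff h.norm_eq_one hr, not_lt,
      show graphCurve y ν g τ s - y = s • (τ : EuclideanSpace ℝ (Fin n)) - g (s • τ) • ν by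
        rw [graphCurve]; abel, norm_sub_sq_real, inner_sub_left, inner_smul_left,
      inner_smul_left, inner_smul_right, inner_smul_left,
      real_inner_comm, inner_coe_orthogonal, real_inner_self_eq_norm_sq,
      norm_smul, norm_smul, h.norm_eq_one, Real.norm_eq_abs, Real.norm_eq_abs,
      mul_pow, sq_abs, mul_one, sq_abs] at h3
    simp only [conj_trivial] at h3
    simp only [zero_smul, h.map_zero]
    have h4 : ‖(τ : EuclideanSpace ℝ (Fin n))‖ = ‖τ‖ := rfl
    rw [h4] at h3
    linarith
  have h5 := second_deriv_nonneg_of_isLocalMin h1 h2 hmin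
  simp only [zero_smul, h.map_zero, h.fderiv_zero, zero_apply] at h5
  have h6 : 0 ≤ ‖τ‖ ^ 2 + r * fderiv ℝ (fderiv ℝ g) 0 τ τ := by linarith
  rw [← sub_nonneg]
  have h7 : fderiv ℝ (fderiv ℝ g) 0 τ τ - -(1 / r) * ‖τ‖ ^ 2 =
      (‖τ‖ ^ 2 + r * fderiv ℝ (fderiv ℝ g) 0 τ τ) / r := by
    field_simp; ring
  rw [h7]
  positivity

/-- The minimum of the Rayleigh quotient is an eigenvalue. This passes from `curvatureConst`, which
is defined through eigenvalues, to a bound for the quadratic form on all tangent vectors. -/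
theorem exists_eigenvector_le {F : Type*} [NormedAddCommGroup F] [InnerProductSpace ℝ F]
    [FiniteDimensional ℝ F] [Nontrivial F] (B : F →L[ℝ] F →L[ℝ] ℝ) (hB : ∀ x y, B x y = B y x) :
    ∃ k : ℝ, ∃ x : F, x ≠ 0 ∧ (∀ y, B x y = k * inner ℝ x y) ∧ ∀ y, k * ‖y‖ ^ 2 ≤ B y y := by
  let T : F →L[ℝ] F := LinearMap.toContinuousLinearMap
    { toFun := fun x => (InnerProductSpace.toDual ℝ F).symm (B x)
      map_add' := fun x y => by simp
      map_smul' := fun c x => by simp }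
  have hT : ∀ x y, inner ℝ (T x) y = B x y := fun x y => by simp [T]
  have hS : (T : F →ₗ[ℝ] F).IsSymmetric := fun x y => by
    rw [ContinuousLinearMap.coe_coe, hT, real_inner_comm, hT, hB]
  obtain ⟨x, hx⟩ := hS.hasEigenvalue_iInf_of_finiteDimensional.exists_hasEigenvector
  refine ⟨⨅ x : {v : F // v ≠ 0}, RCLike.re (inner ℝ ((T : F →ₗ[ℝ] F) x) (x : F)) /
    ‖(x : F)‖ ^ 2, x, hx.2, fun y => ?_, fun y => ?_⟩
  · rw [← hT, ← ContinuousLinearMap.coe_coe, hx.apply_eq_smul, inner_smul_left]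
    simp
  · by_cases hy : y = 0
    · simp [hy]
    have h1 : 0 < ‖y‖ ^ 2 := by positivity
    rw [← le_div_iff₀ h1, ← hT]
    refine ciInf_le (f := fun x : {v : F // v ≠ 0} =>
      RCLike.re (inner ℝ ((T : F →ₗ[ℝ] F) x) (x : F)) / ‖(x : F)‖ ^ 2) ⟨-‖T‖, ?_⟩ ⟨y, hy⟩
    rintro _ ⟨z, rfl⟩
    have h2 := (abs_le.1 (T.rayleighQuotient_le_norm z)).1
    exact h2

theorem IsBoundedC3Domain.exists_curvature_bound (hΩ : IsBoundedC3Domain Ω) :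
    ∃ R, ∀ y ∈ frontier Ω, ∀ l, IsPrincipalCurvature Ω y (-l) → l ≤ R := by
  obtain ⟨r, hr, h⟩ := hΩ.exists_uniform_balls
  refine ⟨1 / r, ?_⟩
  rintro y hy l ⟨ν, g, hg, τ, hτ, hl⟩
  have h1 := hg.neg_inv_le_principalCurvature hΩ.isOpen hr (h y hy ν ⟨g, hg⟩).2 τ
  rw [hl τ, real_inner_self_eq_norm_sq] at h1
  have h2 : 0 < ‖τ‖ ^ 2 := by positivity
  have h3 := le_of_mul_le_mul_right h1 h2
  linarith

theorem IsBoundedC3Domain.le_curvatureConst (hΩ : IsBoundedC3Domain Ω)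
    {y : EuclideanSpace ℝ (Fin n)}
    (hy : y ∈ frontier Ω) {l : ℝ} (hl : IsPrincipalCurvature Ω y (-l)) :
    l ≤ curvatureConst Ω := by
  obtain ⟨R, hR⟩ := hΩ.exists_curvature_bound
  -- The outer bound is `max R 0` because `sSup` of an empty set is 0.
  refine (le_csSup (s := {l : ℝ | IsPrincipalCurvature Ω y (-l)}) ⟨R, fun l hl => hR y hy l hl⟩
    hl).trans (le_csSup (s := curvatureAt Ω '' frontier Ω) ⟨max R 0, ?_⟩ ⟨y, hy, rfl⟩)
  rintro _ ⟨z, hz, rfl⟩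
  exact Real.sSup_le (fun l hl => (hR z hz l hl).trans (le_max_left _ _)) (le_max_right _ _)

theorem IsBoundaryGraph.neg_curvatureConst_le (hn : 2 ≤ n) (hΩ : IsBoundedC3Domain Ω)
    {y ν : EuclideanSpace ℝ (Fin n)} (hy : y ∈ frontier Ω)
    {g : (Submodule.span ℝ {ν})ᗮ → ℝ} (h : IsBoundaryGraph Ω y ν g)
    (τ : (Submodule.span ℝ {ν})ᗮ) :
    -curvatureConst Ω * ‖τ‖ ^ 2 ≤ fderiv ℝ (fderiv ℝ g) 0 τ τ := by
  -- Here n ≥ 2 is needed: the tangent space must contain an eigenvector.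
  have hnt : Nontrivial (Submodule.span ℝ {ν})ᗮ := by
    have : Fact (Module.finrank ℝ (EuclideanSpace ℝ (Fin n)) = (n - 1) + 1) :=
      ⟨by rw [finrank_euclideanSpace_fin]; omega⟩
    have hν : ν ≠ 0 := by
      intro h0; have := h.norm_eq_one; simp [h0] at this
    apply Module.nontrivial_of_finrank_pos (R := ℝ)
    rw [Submodule.finrank_orthogonal_span_singleton (n := n - 1) hν]
    omega
  have hsym : IsSymmSndFDerivAt ℝ g 0 := h.contDiffAt.isSymmSndFDerivAt (by simp; norm_num)
  obtain ⟨k, x, hx, hk, hmin⟩ := exists_eigenvector_le (fderiv ℝ (fderiv ℝ g) 0)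
    (fun x y => hsym.eq x y)
  have h1 : -k ≤ curvatureConst Ω :=
    hΩ.le_curvatureConst hy (l := -k) ⟨ν, g, h, x, hx, by simpa using hk⟩
  refine le_trans ?_ (hmin τ)
  have : 0 ≤ ‖τ‖ ^ 2 := by positivity
  nlinarith

/-- Through every boundary point and in every tangential direction there is a boundary curve. -/
theorem IsOutwardNormal.exists_curve (hΩ : IsOpen Ω)
    {y ν τ : EuclideanSpace ℝ (Fin n)} (hν : IsOutwardNormal Ω y ν) (hτ : inner ℝ ν τ = 0) :
    ∃ γ : ℝ → EuclideanSpace ℝ (Fin n), γ 0 = y ∧ HasDerivAt γ τ 0 ∧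
      ∀ᶠ s in 𝓝 0, γ s ∈ frontier Ω := by
  obtain ⟨g, hg⟩ := hν
  let τ' : (Submodule.span ℝ {ν})ᗮ := ⟨τ, Submodule.mem_orthogonal_singleton_iff_inner_right.2 hτ⟩
  exact ⟨graphCurve y ν g τ', hg.graphCurve_zero τ', hg.hasDerivAt_graphCurve τ',
    hg.eventually_graphCurve_mem hΩ τ'⟩

/-- The shape operator of the boundary is bounded below by `-C₀`. -/
theorem IsBoundedC3Domain.shape_operator_ge (hn : 2 ≤ n) (hΩ : IsBoundedC3Domain Ω)
    {N : EuclideanSpace ℝ (Fin n) → EuclideanSpace ℝ (Fin n)} (hN : ContDiff ℝ 2 N)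
    (hN' : ∀ y ∈ frontier Ω, ∀ ν, IsOutwardNormal Ω y ν → N y = ν)
    {y ν τ : EuclideanSpace ℝ (Fin n)} (hy : y ∈ frontier Ω) (hν : IsOutwardNormal Ω y ν)
    (hτ : inner ℝ ν τ = 0) :
    -curvatureConst Ω * ‖τ‖ ^ 2 ≤ inner ℝ (fderiv ℝ N y τ) τ := by
  obtain ⟨g, hg⟩ := hν
  let τ' : (Submodule.span ℝ {ν})ᗮ := ⟨τ, Submodule.mem_orthogonal_singleton_iff_inner_right.2 hτ⟩
  have h1 := hg.neg_curvatureConst_le hn hΩ hy τ'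
  have h2 := hg.hasDerivAt_inner_unitGradient τ'
  have h3 : HasDerivAt (fun s => inner ℝ (N (graphCurve y ν g τ' s)) τ)
      (inner ℝ (fderiv ℝ N y τ) τ) 0 := by
    have h4 : HasFDerivAt N (fderiv ℝ N y) (graphCurve y ν g τ' 0) := by
      rw [hg.graphCurve_zero]
      exact (hN.differentiable (by simp) y).hasFDerivAt
    have h5 := (h4.comp_hasDerivAt (0:ℝ) (hg.hasDerivAt_graphCurve τ')).inner ℝ
      (hasDerivAt_const (0:ℝ) τ)
    simpa using h5
  -- On the boundary curve both fields are the outward normal, so the tangential derivative of N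
  -- does not depend on the extension.
  have h6 : (fun s => inner ℝ (N (graphCurve y ν g τ' s)) τ) =ᶠ[𝓝 0]
      (fun s => inner ℝ (unitGradient (graphFun y ν g) (graphCurve y ν g τ' s)) τ) := by
    have hc := (hg.hasDerivAt_graphCurve τ').continuousAt.tendsto
    rw [hg.graphCurve_zero] at hc
    filter_upwards [hc.eventually (hg.eventually_normal hΩ.isOpen),
      hg.eventually_graphCurve_mem hΩ.isOpen τ'] with s hs1 hs2
    obtain ⟨ν', hν'⟩ := hΩ.boundary _ hs2
    rw [hN' _ hs2 ν' hν', hs1 hs2 ν' hν']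
  have h7 := h3.unique (h2.congr_of_eventuallyEq h6)
  rw [h7]
  exact h1

end Domain

/-! ### Frames for the coefficient matrix I - e ⊗ e -/

section Frame

variable {n : ℕ}

theorem sum_coord_smul_single (e : EuclideanSpace ℝ (Fin n)) :
    ∑ i, e i • EuclideanSpace.single i (1:ℝ) = e := by
  ext j
  simp [Finset.sum_apply, Pi.single_apply]

/-- A frame that diagonalizes the form `|x|² - ⟨e, x⟩²`. -/
theorem exists_frame (e : EuclideanSpace ℝ (Fin n)) (he : ‖e‖ ≤ 1) :
    ∃ d : Fin n → EuclideanSpace ℝ (Fin n),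
      ∀ B : EuclideanSpace ℝ (Fin n) →ₗ[ℝ] EuclideanSpace ℝ (Fin n) →ₗ[ℝ] ℝ,
        ∑ i, B (d i) (d i) =
          ∑ i, B (EuclideanSpace.single i 1) (EuclideanSpace.single i 1) - B e e := by
  have h1 : 0 ≤ 1 - ‖e‖ ^ 2 := by nlinarith [norm_nonneg e]
  set m : ℝ := 1 / (1 + Real.sqrt (1 - ‖e‖ ^ 2)) with hm
  have hm2 : 2 * m - m ^ 2 * ‖e‖ ^ 2 = 1 := by
    have h2 := Real.sq_sqrt h1
    have h3 := Real.sqrt_nonneg (1 - ‖e‖ ^ 2)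
    have h4 : ‖e‖ ^ 2 = 1 - Real.sqrt (1 - ‖e‖ ^ 2) ^ 2 := by linarith
    rw [hm]
    generalize Real.sqrt (1 - ‖e‖ ^ 2) = r at *
    rw [h4]
    field_simp
    ring
  refine ⟨fun i => EuclideanSpace.single i 1 - (m * e i) • e, fun B => ?_⟩
  have h5 : ∀ i, B (EuclideanSpace.single i 1 - (m * e i) • e)
      (EuclideanSpace.single i 1 - (m * e i) • e) =
      B (EuclideanSpace.single i 1) (EuclideanSpace.single i 1)
        - m * B (e i • EuclideanSpace.single i 1) e - m * B e (e i • EuclideanSpace.single i 1)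
        + m ^ 2 * e i ^ 2 * B e e := by
    intro i
    simp only [map_sub, LinearMap.sub_apply, map_smul, LinearMap.smul_apply, smul_eq_mul]
    ring
  simp only [h5, Finset.sum_add_distrib, Finset.sum_sub_distrib, ← Finset.mul_sum,
    ← Finset.sum_mul]
  have h6 : ∑ i, B (e i • EuclideanSpace.single i 1) e = B e e := by
    rw [← LinearMap.sum_apply, ← map_sum, sum_coord_smul_single]
  have h7 : ∑ i, B e (e i • EuclideanSpace.single i 1) = B e e := by
    rw [← map_sum, sum_coord_smul_single]
  have h8 : ∑ i, e i ^ 2 = ‖e‖ ^ 2 := by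
    rw [EuclideanSpace.norm_sq_eq]; simp
  rw [h6, h7, h8]
  linear_combination (-B e e) * hm2

/-- `d` is a frame for the form `|x|² - ⟨e, x⟩²`. -/
def IsFrame (e : EuclideanSpace ℝ (Fin n)) (d : Fin n → EuclideanSpace ℝ (Fin n)) : Prop :=
  ∀ B : EuclideanSpace ℝ (Fin n) →ₗ[ℝ] EuclideanSpace ℝ (Fin n) →ₗ[ℝ] ℝ,
    ∑ i, B (d i) (d i) =
      ∑ i, B (EuclideanSpace.single i 1) (EuclideanSpace.single i 1) - B e e

/-- The form `⟨x, y⟩ - ⟨e, x⟩⟨e, y⟩`. -/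
def reducedForm (e x y : EuclideanSpace ℝ (Fin n)) : ℝ := inner ℝ x y - inner ℝ e x * inner ℝ e y

variable {e : EuclideanSpace ℝ (Fin n)} {d : Fin n → EuclideanSpace ℝ (Fin n)}

theorem IsFrame.sum_norm_sq (hd : IsFrame e d) : ∑ i, ‖d i‖ ^ 2 = n - ‖e‖ ^ 2 := by
  have h := hd (innerₗ _)
  simpa [innerₗ_apply_apply, real_inner_self_eq_norm_sq] using h

theorem IsFrame.sum_inner (hd : IsFrame e d)
    (T : EuclideanSpace ℝ (Fin n) →L[ℝ] EuclideanSpace ℝ (Fin n)) :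
    ∑ i, inner ℝ (T (d i)) (d i) = ∑ i, (T (EuclideanSpace.single i 1)) i - inner ℝ (T e) e := by
  have h := hd ((innerₗ _).comp (T : EuclideanSpace ℝ (Fin n) →ₗ[ℝ] EuclideanSpace ℝ (Fin n)))
  simpa [innerₗ_apply_apply, EuclideanSpace.inner_single_right] using h

theorem IsFrame.sum_norm_sq_map (hd : IsFrame e d)
    (T : EuclideanSpace ℝ (Fin n) →L[ℝ] EuclideanSpace ℝ (Fin n)) :
    ∑ i, ‖T (EuclideanSpace.single i 1)‖ ^ 2 = ∑ i, ‖T (d i)‖ ^ 2 + ‖T e‖ ^ 2 := by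
  have h := hd ((innerₗ _).compl₁₂ (T : EuclideanSpace ℝ (Fin n) →ₗ[ℝ] EuclideanSpace ℝ (Fin n))
    (T : EuclideanSpace ℝ (Fin n) →ₗ[ℝ] EuclideanSpace ℝ (Fin n)))
  simp only [LinearMap.compl₁₂_apply, ContinuousLinearMap.coe_coe, innerₗ_apply_apply,
    real_inner_self_eq_norm_sq] at h
  linarith

theorem IsFrame.sum_inner_mul_inner (hd : IsFrame e d) (x y : EuclideanSpace ℝ (Fin n)) :
    ∑ i, inner ℝ x (d i) * inner ℝ y (d i) = reducedForm e x y := by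
  have h := hd (LinearMap.mk₂ ℝ (fun a b => inner ℝ x a * inner ℝ y b)
    (by intros; rw [inner_add_right]; ring) (by intros; rw [inner_smul_right, smul_eq_mul]; ring)
    (by intros; rw [inner_add_right]; ring) (by intros; rw [inner_smul_right, smul_eq_mul]; ring))
  simp only [LinearMap.mk₂_apply] at h
  rw [h, reducedForm, real_inner_comm e x, real_inner_comm e y]
  congr 1
  simp only [EuclideanSpace.inner_single_right]
  simp [PiLp.inner_apply, mul_comm]

theorem norm_map_sq_le (T : EuclideanSpace ℝ (Fin n) →L[ℝ] EuclideanSpace ℝ (Fin n))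
    (x : EuclideanSpace ℝ (Fin n)) :
    ‖T x‖ ^ 2 ≤ ‖x‖ ^ 2 * ∑ i, ‖T (EuclideanSpace.single i 1)‖ ^ 2 := by
  have h1 : ‖T x‖ ≤ ∑ i, ‖x i‖ * ‖T (EuclideanSpace.single i 1)‖ := by
    conv_lhs => rw [← sum_coord_smul_single x, map_sum]
    refine (norm_sum_le _ _).trans (Finset.sum_le_sum fun i _ => ?_)
    rw [map_smul, norm_smul]
  calc ‖T x‖ ^ 2 ≤ (∑ i, ‖x i‖ * ‖T (EuclideanSpace.single i 1)‖) ^ 2 := by gcongr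
    _ ≤ (∑ i, ‖x i‖ ^ 2) * ∑ i, ‖T (EuclideanSpace.single i 1)‖ ^ 2 :=
      Finset.sum_mul_sq_le_sq_mul_sq _ _ _
    _ = _ := by rw [EuclideanSpace.norm_sq_eq]

/-- The source of the coercive term c²/(n-1): for the normalized Hessian the weighted trace is
nearly -c, and n - ‖e‖² is nearly n - 1. -/
theorem IsFrame.sq_sum_inner_le (hd : IsFrame e d)
    (T : EuclideanSpace ℝ (Fin n) →L[ℝ] EuclideanSpace ℝ (Fin n)) :
    (∑ i, inner ℝ (T (d i)) (d i)) ^ 2 ≤ (∑ i, ‖T (d i)‖ ^ 2) * (n - ‖e‖ ^ 2) := by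
  have h1 : |∑ i, inner ℝ (T (d i)) (d i)| ≤ ∑ i, ‖T (d i)‖ * ‖d i‖ :=
    (Finset.abs_sum_le_sum_abs _ _).trans
      (Finset.sum_le_sum fun i _ => abs_real_inner_le_norm _ _)
  rw [← hd.sum_norm_sq, ← sq_abs]
  calc _ ≤ (∑ i, ‖T (d i)‖ * ‖d i‖) ^ 2 := by gcongr
    _ ≤ _ := Finset.sum_mul_sq_le_sq_mul_sq _ _ _

theorem abs_reducedForm_le (he : ‖e‖ ≤ 1) (x y : EuclideanSpace ℝ (Fin n)) :
    |reducedForm e x y| ≤ 2 * ‖x‖ * ‖y‖ := by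
  have h1 := abs_real_inner_le_norm x y
  have h2 : |inner ℝ e x| ≤ ‖x‖ := (abs_real_inner_le_norm e x).trans
    (mul_le_of_le_one_left (norm_nonneg x) he)
  have h3 : |inner ℝ e y| ≤ ‖y‖ := (abs_real_inner_le_norm e y).trans
    (mul_le_of_le_one_left (norm_nonneg y) he)
  have h4 : |inner ℝ e x * inner ℝ e y| ≤ ‖x‖ * ‖y‖ := by
    rw [abs_mul]; gcongr
  calc _ ≤ |inner ℝ x y| + |inner ℝ e x * inner ℝ e y| := abs_sub _ _
    _ ≤ _ := by linarith

theorem reducedForm_self_le (e x : EuclideanSpace ℝ (Fin n)) : reducedForm e x x ≤ ‖x‖ ^ 2 := by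
  rw [reducedForm, real_inner_self_eq_norm_sq]
  nlinarith [sq_nonneg (inner ℝ e x)]

theorem reducedForm_self_nonneg (he : ‖e‖ ≤ 1) (x : EuclideanSpace ℝ (Fin n)) :
    0 ≤ reducedForm e x x := by
  have h2 : |inner ℝ e x| ≤ ‖x‖ := (abs_real_inner_le_norm e x).trans
    (mul_le_of_le_one_left (norm_nonneg x) he)
  have := sq_le_sq' (by linarith [abs_le.1 h2 |>.1, norm_nonneg x]) (le_abs_self _ |>.trans h2)
  rw [reducedForm, real_inner_self_eq_norm_sq]
  nlinarith

theorem reducedForm_add_smul (e g U Z : EuclideanSpace ℝ (Fin n)) (ε : ℝ) :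
    reducedForm e (g + ε • U) (g + ε • Z) = reducedForm e g g +
      ε * (reducedForm e g Z + reducedForm e U g + ε * reducedForm e U Z) := by
  simp only [reducedForm, inner_add_left, inner_add_right, inner_smul_left, inner_smul_right,
    conj_trivial]
  ring

theorem reducedForm_smul (e g : EuclideanSpace ℝ (Fin n)) (s : ℝ) :
    reducedForm e (s • g) (s • g) = s ^ 2 * reducedForm e g g := by
  simp only [reducedForm, inner_smul_left, inner_smul_right, conj_trivial]
  ring

end Frame

/-! ### Algebra of the interior maximum in normalized variables -/

section Algebra

variable {n : ℕ} {e : EuclideanSpace ℝ (Fin n)} {d : Fin n → EuclideanSpace ℝ (Fin n)}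

/-- Closes a circular estimate. The full Hessian norm s is controlled by the weighted one and by t =
‖S e‖, which in turn is controlled by εKs. As εK ≤ 1/8, this is absorbed and a bound linear in m
remains. -/
theorem norm_le_of_small_perturbation {K ε s m L t : ℝ} (hK : 1 ≤ K) (hε : 0 ≤ ε)
    (hεK : ε * K ≤ 1 / 8) (hm : 1 ≤ m) (hL : 0 ≤ L) (hs : 0 ≤ s) (ht : t ≤ K + ε * (L + K * s))
    (hst : s ≤ (m - 1) + t) : L + K * s ≤ 2 * K * (L + K) * m + L := by
  have h1 : s ≤ m - 1 + K + ε * L + ε * K * s := by linarith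
  have h2 : ε * K * s ≤ 1 / 8 * s := by gcongr
  have h3 : ε * L ≤ 1 / 8 * L := by
    have : ε ≤ 1 / 8 := by nlinarith
    gcongr
  have h4 : s ≤ 2 * (L + K) * m := by nlinarith [mul_nonneg hL (sub_nonneg.2 hm), mul_nonneg (sub_nonneg.2 hK) (sub_nonneg.2 hm)]
  nlinarith [mul_le_mul_of_nonneg_left h4 (by linarith : 0 ≤ K)]

theorem abs_mul_le_mul_sq {A x y L m : ℝ} (hA : |A| ≤ 2 * x * y) (hx0 : 0 ≤ x) (hy0 : 0 ≤ y)
    (hx : x ≤ L * m) (hy : y ≤ L * m) : |A| ≤ 2 * (L * m) ^ 2 := by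
  refine hA.trans ?_
  calc 2 * x * y ≤ 2 * (L * m) * (L * m) := by gcongr; linarith
    _ = _ := by ring

/-- Comparison of the quadratic gradient terms with their value in the limit `ε → 0`. -/
theorem gradient_terms_le (he : ‖e‖ ≤ 1) {K q ε m L C x : ℝ} (hK : 1 ≤ K) (hq0 : 0 < q)
    (hqK : q ≤ K) (hε : 0 ≤ ε) (hε1 : ε ≤ 1) (hm : 1 ≤ m) (hL : 2 * K ^ 2 ≤ L)
    {g U Z : EuclideanSpace ℝ (Fin n)} (hCK : C ≤ K) (hg : ‖g‖ ≤ C)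
    (hU : ‖U‖ ≤ L * m) (hZ : ‖Z‖ ≤ L * m) (hx : |x| ≤ K) :
    -2 * reducedForm e (g + ε • U) (g + ε • Z) - (q - 1) * reducedForm e (g + ε • U) (g + ε • U)
      + 2 * (1 / (1 + q) - ε * x) * reducedForm e ((1 + q) • g) ((1 + q) • g) ≤
      (1 + q) * C ^ 2 + ε * (30 * K * (L * m) ^ 2) := by
  have hKL : K ≤ L := by nlinarith
  have hL0 : 0 ≤ L := by linarith
  have hgm : ‖g‖ ≤ L * m := by nlinarith
  have key : ∀ {a b : EuclideanSpace ℝ (Fin n)}, ‖a‖ ≤ L * m → ‖b‖ ≤ L * m →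
      |reducedForm e a b| ≤ 2 * (L * m) ^ 2 := fun ha hb =>
    abs_mul_le_mul_sq (abs_reducedForm_le he _ _) (norm_nonneg _) (norm_nonneg _) ha hb
  rw [reducedForm_add_smul, reducedForm_add_smul, reducedForm_smul]
  have h1 := key hgm hZ
  have h2 := key hU hgm
  have h3 := key hU hZ
  have h4 := key hgm hU
  have h5 := key hU hU
  set A := reducedForm e g g
  have hA0 : 0 ≤ A := reducedForm_self_nonneg he g
  have hA1 : A ≤ C ^ 2 := (reducedForm_self_le e g).trans (by gcongr)
  set M := (L * m) ^ 2 with hM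
  have hM0 : 0 ≤ M := sq_nonneg _
  set r1 := reducedForm e g Z + reducedForm e U g + ε * reducedForm e U Z with hr1
  set r2 := reducedForm e g U + reducedForm e U g + ε * reducedForm e U U with hr2
  have small : ∀ {y : ℝ}, |y| ≤ 2 * M → |ε * y| ≤ 2 * M := fun {y} hy => by
    rw [abs_mul, abs_of_nonneg hε]; nlinarith [abs_nonneg y]
  have hr1' : |r1| ≤ 6 * M := by
    have := small h3
    calc |r1| ≤ |reducedForm e g Z| + |reducedForm e U g| + |ε * reducedForm e U Z| :=
          abs_add_three _ _ _
      _ ≤ _ := by linarith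
  have hr2' : |r2| ≤ 6 * M := by
    have := small h5
    calc |r2| ≤ |reducedForm e g U| + |reducedForm e U g| + |ε * reducedForm e U U| :=
          abs_add_three _ _ _
      _ ≤ _ := by linarith
  have hq1 : |q - 1| ≤ K := abs_le.2 ⟨by linarith, by linarith⟩
  have e1 : -(2 * r1) ≤ 12 * M := by linarith [abs_le.1 hr1']
  have e2 : -((q - 1) * r2) ≤ 6 * K * M := by
    have : |(q - 1) * r2| ≤ K * (6 * M) := by rw [abs_mul]; gcongr
    linarith [abs_le.1 this]
  have e3 : -(2 * x * ((1 + q) ^ 2 * A)) ≤ 8 * K * M := by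
    have hq2 : (1 + q) ^ 2 ≤ (2 * K) ^ 2 := by gcongr; linarith
    have hAM : (2 * K) ^ 2 * A ≤ 4 * M := by
      have hC : C ^ 2 ≤ K ^ 2 := by
        have := norm_nonneg g
        gcongr; linarith
      have hLm : 2 * K ^ 2 ≤ L * m := by nlinarith
      have : (2 * K ^ 2) ^ 2 ≤ M := by rw [hM]; gcongr
      calc (2 * K) ^ 2 * A ≤ (2 * K) ^ 2 * K ^ 2 := by gcongr; linarith
        _ = (2 * K ^ 2) ^ 2 := by ring
        _ ≤ _ := by linarith
    have : |x * ((1 + q) ^ 2 * A)| ≤ K * (4 * M) := by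
      rw [abs_mul, abs_of_nonneg (by positivity : 0 ≤ (1 + q) ^ 2 * A)]
      refine mul_le_mul hx (le_trans ?_ hAM) (by positivity) (by linarith)
      gcongr
    linarith [abs_le.1 this]
  have e4 : -(2 * r1) - (q - 1) * r2 - 2 * x * ((1 + q) ^ 2 * A) ≤ 30 * K * M := by
    have : 12 * M ≤ 12 * K * M := by nlinarith
    linarith [mul_nonneg (by linarith : (0:ℝ) ≤ K) hM0]
  -- At ε = 0 the coefficients add up to -2 - (q - 1) + 2(1 + q) = 1 + q, the origin of (1 + q)C² in
  -- the coercivity condition.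
  have e5 : -2 * (A + ε * r1) - (q - 1) * (A + ε * r2) +
      2 * (1 / (1 + q) - ε * x) * ((1 + q) ^ 2 * A) = (1 + q) * A +
        ε * (-(2 * r1) - (q - 1) * r2 - 2 * x * ((1 + q) ^ 2 * A)) := by
    field_simp; ring
  rw [e5]
  gcongr

/-- `Q` is the sum of squares and `A` collects the terms it must beat. The last hypothesis gives Q ≤
A plus a small error, hence Q = O(W). Cauchy-Schwarz gives c²/N ≤ Q plus a small error. Together δ
is at most of order ϑW², against its choice. The alternative |c| ≤ Kϑ covers the case where the
lower bound for the trace cannot be squared. -/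
theorem coercivity_contradiction {N K δ ϑ Q c A W : ℝ} (hK : 1 ≤ K) (hW : 1 ≤ W) (hN : 1 ≤ N)
    (hKW : K ^ 2 ≤ W) (hϑ0 : 0 ≤ ϑ) (hϑ1 : ϑ * W ≤ 1 / 4)
    (hϑδ : ϑ * (16 * W ^ 2) < δ) (hQ : 0 ≤ Q) (hcK : |c| ≤ K) (hA : A + δ ≤ c ^ 2 / N)
    (hQc : (|c| - K * ϑ) ^ 2 ≤ Q * (N + ϑ) ∨ |c| ≤ K * ϑ)
    (hineq : 0 ≤ A - Q + ϑ * (W * (1 + Q))) : False := by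
  have hδ : 0 ≤ δ := le_trans (by positivity) hϑδ.le
  have hc2 : c ^ 2 ≤ K ^ 2 := by rw [← sq_abs]; gcongr
  have hc2N : c ^ 2 / N ≤ K ^ 2 := (div_le_self (sq_nonneg c) hN).trans hc2
  have hQW : ϑ * (W * Q) ≤ 1 / 4 * Q := by
    calc _ = (ϑ * W) * Q := by ring
      _ ≤ _ := by gcongr
  have hQ2 : Q ≤ 2 * W := by nlinarith
  have h1 : c ^ 2 / N ≤ Q + ϑ * (Q + 2 * W) := by
    rw [div_le_iff₀ (by linarith)]
    have hN' : 0 ≤ (N - 1) * (ϑ * (Q + 2 * W)) :=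
      mul_nonneg (by linarith) (mul_nonneg hϑ0 (by linarith))
    rcases hQc with h | h
    · have h2 : c ^ 2 ≤ (|c| - K * ϑ) ^ 2 + 2 * |c| * K * ϑ := by
        rw [← sq_abs c]; nlinarith [sq_nonneg (K * ϑ)]
      have h3 : |c| * K * ϑ ≤ W * ϑ := by
        gcongr
        calc |c| * K ≤ K * K := by gcongr
          _ ≤ _ := by linarith
      nlinarith
    · have h2 : c ^ 2 ≤ (K * ϑ) ^ 2 := by rw [← sq_abs]; gcongr
      have h3 : (K * ϑ) ^ 2 ≤ W * ϑ := by
        have : ϑ ≤ 1 := by nlinarith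
        calc (K * ϑ) ^ 2 = K ^ 2 * (ϑ * ϑ) := by ring
          _ ≤ W * (1 * ϑ) := by gcongr
          _ = _ := by ring
      nlinarith [mul_nonneg hQ (by linarith : 0 ≤ N), mul_nonneg hϑ0 hQ, mul_nonneg hϑ0 (by linarith : 0 ≤ W)]
  have h2 : δ ≤ ϑ * (Q + 2 * W) + ϑ * (W * (1 + Q)) := by linarith
  have h3 : Q + 2 * W + W * (1 + Q) ≤ 16 * W ^ 2 := by nlinarith
  nlinarith [mul_le_mul_of_nonneg_left h3 hϑ0]

/-- The constant that controls the error terms in the interior estimate. -/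
def interiorErrorConst (K : ℝ) : ℝ := 20000 * K ^ 11

-- In the application e = Du/v, S = D²u/v, ε = v^{-q} and G = -Dρ/ρ. At ε = 0 the two relations for
-- h say S e = h = G/(1+q), and the inequality implies D + C|c| + (n-1)β + (1+q)C² - Q ≥ 0 apart
-- from errors of order ϑ, which coercivity excludes. The proof bounds all errors by ϑW(1 + Q).
set_option maxHeartbeats 1000000 in
theorem interior_algebra (hn : 2 ≤ n) {K q δ ε ϑ C c D β b : ℝ} (hK : 1 ≤ K) (hq0 : 0 < q)
    (hqK : q ≤ K) (hnK : (n : ℝ) ≤ K) (hε : 0 ≤ ε) (hεϑ : ε ≤ ϑ)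
    (hϑ1 : ϑ * interiorErrorConst K ≤ 1 / 4)
    (hϑδ : ϑ * (16 * interiorErrorConst K ^ 2) < δ)
    {X Y G h : EuclideanSpace ℝ (Fin n)}
    {S : EuclideanSpace ℝ (Fin n) →L[ℝ] EuclideanSpace ℝ (Fin n)}
    (hd : IsFrame e d) (he : ‖e‖ ≤ 1) (he' : 1 - ‖e‖ ^ 2 ≤ ϑ) (hX : ‖X‖ ≤ K) (hY : ‖Y‖ ≤ K)
    (hCK : C ≤ K) (hG : ‖G‖ ≤ (1 + q) * C) (hβ0 : 0 ≤ β) (hβK : β ≤ K)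
    (hb0 : 0 ≤ b) (hb : b ≤ (1 + q) * β) (hcK : |c| ≤ K) (hDK : D ≤ K)
    (hh : S (e - ε • X) = h) (hh' : h = (1 / (1 + q) - ε * inner ℝ X e) • G + ε • Y)
    (htr : |∑ i, inner ℝ (S (d i)) (d i) + c| ≤ K * ϑ)
    (hcoer : δ + D + C * |c| + (n - 1) * β + (1 + q) * C ^ 2 ≤ c ^ 2 / (n - 1))
    (hineq : 0 ≤ -2 * reducedForm e (S e) h + D * (1 + ε * K) + |c| * ‖h‖ + K * ϑ
      - ∑ i, ‖S (d i)‖ ^ 2 - (q - 1) * reducedForm e (S e) (S e)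
      + ε * K ^ 2 * (1 + Real.sqrt (∑ i, ‖S (d i)‖ ^ 2))
      + 2 * (1 / (1 + q) - ε * inner ℝ X e) * reducedForm e G G
      + (1 / (1 + q) - ε * inner ℝ X e) * b * (n - ‖e‖ ^ 2)) : False := by
  have hn' : (2:ℝ) ≤ n := by exact_mod_cast hn
  have hϑ0 : 0 ≤ ϑ := hε.trans hεϑ
  set Q := ∑ i, ‖S (d i)‖ ^ 2 with hQ
  have hQ0 : 0 ≤ Q := Finset.sum_nonneg fun i _ => sq_nonneg _
  set m := 1 + Real.sqrt Q with hm
  have hsq := Real.sq_sqrt hQ0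
  have hsq0 := Real.sqrt_nonneg Q
  have hm1 : 1 ≤ m := by linarith
  have hm2 : m ^ 2 ≤ 2 * (1 + Q) := by
    calc m ^ 2 = 2 * (1 + Real.sqrt Q ^ 2) - (Real.sqrt Q - 1) ^ 2 := by rw [hm]; ring
      _ ≤ 2 * (1 + Q) := by rw [hsq]; linarith [sq_nonneg (Real.sqrt Q - 1)]
  have hm3 : 1 ≤ m ^ 2 := one_le_pow₀ hm1
  have hm4 : m ≤ m ^ 2 := le_self_pow₀ hm1 two_ne_zero
  have he2 : ‖e‖ ^ 2 ≤ 1 := pow_le_one₀ (norm_nonneg e) he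
  have hK11 : K ≤ K ^ 11 := le_self_pow₀ hK (by norm_num)
  have hK2 : K ^ 2 ≤ K ^ 11 := pow_le_pow_right₀ hK (by norm_num)
  set W := interiorErrorConst K with hW
  have hW' : W = 20000 * K ^ 11 := rfl
  have hεK : ε * K ≤ 1 / 8 := by
    have h1 : 2 * (ε * K) ≤ ϑ * W := by
      rw [hW']
      calc 2 * (ε * K) = ε * (2 * K) := by ring
        _ ≤ ϑ * (20000 * K ^ 11) := by gcongr; linarith
    linarith
  have hε1 : ε ≤ 1 := (le_mul_of_one_le_right hε hK).trans (hεK.trans (by norm_num))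
  set x := inner ℝ X e with hx
  have hxK : |x| ≤ K := (abs_real_inner_le_norm X e).trans
    ((mul_le_of_le_one_right (norm_nonneg X) he).trans hX)
  have hC0 : 0 ≤ C := (mul_nonneg_iff_of_pos_left (by linarith)).1 ((norm_nonneg G).trans hG)
  set g := (1 / (1 + q)) • G with hg
  have hGg : G = (1 + q) • g := by
    rw [hg, smul_smul, mul_one_div_cancel (by linarith), one_smul]
  have hgC : ‖g‖ ≤ C := by
    rw [hg, norm_smul, Real.norm_eq_abs, abs_of_pos (by positivity), one_div,
      inv_mul_le_iff₀ (by linarith)]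
    exact hG
  set Z := Y - x • G with hZ
  have hhZ : h = g + ε • Z := by
    rw [hh', hg, hZ, sub_smul, smul_sub, smul_smul]; abel
  -- The first-order relation is solved for S e: both h and S e are g plus ε times a remainder. The
  -- remainder U contains S X, so it can only be bounded in terms of Q.
  set U := Z + S X with hU
  have hSe : S e = g + ε • U := by
    rw [map_sub, map_smul, hhZ] at hh
    rw [hU, smul_add, ← add_assoc, ← hh]; abel
  set L := 3 * K ^ 3 with hL
  have hZL : ‖Z‖ ≤ L := by
    have h1 : ‖x • G‖ ≤ K * (2 * K * K) := by
      rw [norm_smul, Real.norm_eq_abs]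
      gcongr
      refine hG.trans ?_
      gcongr
      linarith
    have h2 : K ≤ K ^ 3 := le_self_pow₀ hK (by norm_num)
    calc ‖Z‖ ≤ ‖Y‖ + ‖x • G‖ := norm_sub_le _ _
      _ ≤ K + K * (2 * K * K) := by gcongr
      _ = K + 2 * K ^ 3 := by ring
      _ ≤ L := by linarith
  set s := Real.sqrt (Q + ‖S e‖ ^ 2) with hs
  have hsS : ∀ y, ‖S y‖ ≤ ‖y‖ * s := by
    intro y
    have h1 := norm_map_sq_le S y
    rw [hd.sum_norm_sq_map, ← hQ] at h1
    refine (sq_le_sq₀ (norm_nonneg _) (by positivity)).1 ?_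
    rw [mul_pow, hs, Real.sq_sqrt (by positivity)]
    exact h1
  have hs1 : s ≤ (m - 1) + ‖S e‖ := by
    rw [hs, hm, add_sub_cancel_left]
    refine Real.sqrt_le_iff.2 ⟨by positivity, ?_⟩
    rw [add_sq, hsq]
    linarith [mul_nonneg hsq0 (norm_nonneg (S e))]
  have hUs : ‖U‖ ≤ L + K * s := by
    calc ‖U‖ ≤ ‖Z‖ + ‖S X‖ := norm_add_le _ _
      _ ≤ L + ‖X‖ * s := by gcongr; exact hsS X
      _ ≤ L + K * s := by gcongr
  have hSe1 : ‖S e‖ ≤ K + ε * (L + K * s) := by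
    rw [hSe]
    calc ‖g + ε • U‖ ≤ ‖g‖ + ‖ε • U‖ := norm_add_le _ _
      _ = ‖g‖ + ε * ‖U‖ := by rw [norm_smul ε, Real.norm_eq_abs, abs_of_nonneg hε]
      _ ≤ K + ε * (L + K * s) := by gcongr; exact hgC.trans hCK
  have hLs := norm_le_of_small_perturbation hK hε hεK hm1 (by positivity) (Real.sqrt_nonneg _)
    hSe1 hs1
  -- With L = 3K³ one has 2K(L + K) + L ≤ 11K⁴, and then 30K(L'm)² = 3630K⁹m².
  set L' := 11 * K ^ 4 with hL'
  have hK34 : K ^ 3 ≤ K ^ 4 := pow_le_pow_right₀ hK (by norm_num)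
  have hK24 : K ^ 2 ≤ K ^ 4 := pow_le_pow_right₀ hK (by norm_num)
  have hUL : ‖U‖ ≤ L' * m := by
    refine (hUs.trans hLs).trans ?_
    have h1 : 2 * K * (L + K) + L ≤ L' := by rw [hL, hL']; linarith
    have h2 : 0 ≤ L := by positivity
    calc 2 * K * (L + K) * m + L ≤ 2 * K * (L + K) * m + L * m := by
          gcongr; exact le_mul_of_one_le_right h2 hm1
      _ = (2 * K * (L + K) + L) * m := by ring
      _ ≤ L' * m := by gcongr
  have hZL' : ‖Z‖ ≤ L' * m := by
    refine hZL.trans ?_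
    have h1 : L ≤ L' := by
      have : 0 ≤ K ^ 4 := by positivity
      rw [hL, hL']; linarith
    exact h1.trans (le_mul_of_one_le_right (by positivity) hm1)
  have hgrad := gradient_terms_le he hK hq0 hqK hε hε1 hm1
    (L := L') (by rw [hL']; linarith [sq_nonneg K]) hCK hgC hUL hZL' hxK
  rw [← hSe, ← hhZ, ← hGg] at hgrad
  have hh1 : ‖h‖ ≤ C + ε * L := by
    rw [hhZ]
    calc ‖g + ε • Z‖ ≤ ‖g‖ + ‖ε • Z‖ := norm_add_le _ _
      _ = ‖g‖ + ε * ‖Z‖ := by rw [norm_smul ε, Real.norm_eq_abs, abs_of_nonneg hε]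
      _ ≤ _ := by gcongr
  have hch : |c| * ‖h‖ ≤ C * |c| + ε * (3 * K ^ 4) := by
    calc |c| * ‖h‖ ≤ |c| * (C + ε * L) := by gcongr
      _ = C * |c| + ε * (|c| * L) := by ring
      _ ≤ C * |c| + ε * (K * L) := by gcongr
      _ = _ := by rw [hL]; ring
  have hDt : D * (1 + ε * K) ≤ D + ε * K ^ 2 := by
    calc D * (1 + ε * K) = D + ε * (D * K) := by ring
      _ ≤ D + ε * (K * K) := by gcongr
      _ = _ := by ring
  have hwb : (1 / (1 + q) - ε * x) * b * (n - ‖e‖ ^ 2) ≤ (n - 1) * β + ϑ * (3 * K ^ 4) := by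
    have hne : 0 ≤ n - ‖e‖ ^ 2 := by linarith
    have h1 : (1 / (1 + q) - ε * x) * b ≤ β + ϑ * (2 * K ^ 3) := by
      have h3 : 1 / (1 + q) * b ≤ β := by
        rw [one_div, inv_mul_le_iff₀ (by linarith)]; exact hb
      have h4 : -(ε * x * b) ≤ ϑ * (2 * K ^ 3) := by
        have h5 : |x * b| ≤ K * (2 * K * K) := by
          rw [abs_mul, abs_of_nonneg hb0]
          gcongr
          refine hb.trans ?_
          gcongr
          linarith
        have h6 : -(x * b) ≤ 2 * K ^ 3 := by
          have := (abs_le.1 h5).1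
          calc _ ≤ K * (2 * K * K) := by linarith
            _ = _ := by ring
        calc -(ε * x * b) = ε * -(x * b) := by ring
          _ ≤ ε * (2 * K ^ 3) := by gcongr
          _ ≤ _ := by gcongr
      linarith
    have h2 : n - ‖e‖ ^ 2 ≤ (n - 1) + ϑ := by linarith
    calc _ ≤ (β + ϑ * (2 * K ^ 3)) * (n - ‖e‖ ^ 2) := by gcongr
      _ = β * (n - ‖e‖ ^ 2) + ϑ * (2 * K ^ 3) * (n - ‖e‖ ^ 2) := by ring
      _ ≤ β * ((n - 1) + ϑ) + ϑ * (2 * K ^ 3) * K := by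
        gcongr
        linarith [sq_nonneg ‖e‖]
      _ = (n - 1) * β + ϑ * (β + 2 * K ^ 4) := by ring
      _ ≤ (n - 1) * β + ϑ * (3 * K ^ 4) := by
        have : K ≤ K ^ 4 := le_self_pow₀ hK (by norm_num)
        gcongr
        linarith
  have hK29 : K ^ 2 ≤ K ^ 9 := pow_le_pow_right₀ hK (by norm_num)
  have hK49 : K ^ 4 ≤ K ^ 9 := pow_le_pow_right₀ hK (by norm_num)
  have hK19 : K ≤ K ^ 9 := le_self_pow₀ hK (by norm_num)
  have hK911 : K ^ 9 ≤ K ^ 11 := pow_le_pow_right₀ hK (by norm_num)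
  have hT : ε * K ^ 2 * m ≤ ϑ * (K ^ 9 * m ^ 2) := by
    calc ε * K ^ 2 * m = ε * (K ^ 2 * m) := by ring
      _ ≤ ϑ * (K ^ 9 * m ^ 2) := by gcongr
  have hgr : ε * (30 * K * (L' * m) ^ 2) ≤ ϑ * (3630 * K ^ 9 * m ^ 2) := by
    calc ε * (30 * K * (L' * m) ^ 2) = ε * (3630 * K ^ 9 * m ^ 2) := by rw [hL']; ring
      _ ≤ _ := by gcongr
  have hε' : ∀ {y : ℝ}, y ≤ K ^ 9 → 0 ≤ y → ε * y ≤ ϑ * (K ^ 9 * m ^ 2) := by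
    intro y hy hy0
    calc ε * y ≤ ϑ * K ^ 9 := by gcongr
      _ ≤ ϑ * (K ^ 9 * m ^ 2) := by
        have : 0 ≤ K ^ 9 := by positivity
        gcongr
        exact le_mul_of_one_le_right this hm3
  have hϑ' : ∀ {y : ℝ}, y ≤ K ^ 9 → 0 ≤ y → ϑ * y ≤ ϑ * (K ^ 9 * m ^ 2) := by
    intro y hy hy0
    have : 0 ≤ K ^ 9 := by positivity
    gcongr
    exact hy.trans (le_mul_of_one_le_right this hm3)
  have f1 := hε' hK29 (by positivity)
  have f2 := hε' hK49 (by positivity)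
  have f3 := hϑ' hK19 (by positivity)
  have f4 := hϑ' hK49 (by positivity)
  have f5 : 0 ≤ ϑ * (K ^ 9 * m ^ 2) := by positivity
  -- The gradient terms contribute 3630 units and the remaining errors fewer than 10. Since m² ≤ 2(1
  -- + Q), this is at most doubled, still below 20000.
  have hfin : ϑ * (K ^ 9 * m ^ 2) * 3640 ≤ ϑ * (W * (1 + Q)) := by
    have : K ^ 9 * m ^ 2 * 3640 ≤ W * (1 + Q) := by
      rw [hW']
      calc K ^ 9 * m ^ 2 * 3640 ≤ K ^ 11 * (2 * (1 + Q)) * 3640 := by gcongr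
        _ ≤ _ := by
          have : 0 ≤ K ^ 11 * (1 + Q) := by positivity
          linarith
    calc _ = ϑ * (K ^ 9 * m ^ 2 * 3640) := by ring
      _ ≤ _ := by gcongr
  refine coercivity_contradiction (N := n - 1) (A := D + C * |c| + (n - 1) * β + (1 + q) * C ^ 2)
    hK (W := W) (by rw [hW']; linarith) (by linarith) (by rw [hW']; linarith) hϑ0 hϑ1 hϑδ hQ0 hcK
    (by linarith) ?_ (by linarith)
  by_cases hc : |c| ≤ K * ϑ
  · exact Or.inr hc
  · left
    push Not at hc
    have h1 := hd.sq_sum_inner_le S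
    set t := ∑ i, inner ℝ (S (d i)) (d i) with ht
    have h2 : |c| - K * ϑ ≤ |t| := by
      have h3 : |c| ≤ |t + c| + |t| := by
        calc |c| = |(t + c) - t| := by ring_nf
          _ ≤ _ := abs_sub _ _
      linarith
    calc (|c| - K * ϑ) ^ 2 ≤ |t| ^ 2 := by gcongr
      _ = t ^ 2 := sq_abs t
      _ ≤ Q * (n - ‖e‖ ^ 2) := h1
      _ ≤ Q * (n - 1 + ϑ) := by gcongr; linarith

end Algebra

/-! ### The area element, the test quantity w and their derivatives along curves -/

section Quantity

variable {E : Type*} [NormedAddCommGroup E] [InnerProductSpace ℝ E]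

/-- `√(η² + |p|²)`. -/
def areaElem (η : ℝ) (p : E) : ℝ := Real.sqrt (η ^ 2 + ‖p‖ ^ 2)

/-- The quantity `v^{q+1}/(q+1) - ⟨X, p⟩` to which the maximum principle is applied. -/
def gradQuantity (η q : ℝ) (X p : E) : ℝ := areaElem η p ^ (q + 1) / (q + 1) - inner ℝ X p

variable {η q : ℝ}

theorem areaElem_pos (hη : 0 < η) (p : E) : 0 < areaElem η p :=
  Real.sqrt_pos.2 (by positivity)

theorem sq_areaElem (η : ℝ) (p : E) : areaElem η p ^ 2 = η ^ 2 + ‖p‖ ^ 2 :=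
  Real.sq_sqrt (by positivity)

theorem norm_le_areaElem (η : ℝ) (p : E) : ‖p‖ ≤ areaElem η p :=
  Real.le_sqrt_of_sq_le (by linarith [sq_nonneg η])

theorem areaElem_le (hη : η ∈ Ioc (0:ℝ) 1) (p : E) : areaElem η p ≤ 1 + ‖p‖ := by
  refine Real.sqrt_le_iff.2 ⟨by positivity, ?_⟩
  nlinarith [hη.1, hη.2, norm_nonneg p]

theorem continuous_areaElem (η : ℝ) : Continuous (areaElem η : E → ℝ) := by
  unfold areaElem; fun_prop

theorem continuous_gradQuantity (hη : 0 < η) :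
    Continuous fun z : E × E => gradQuantity η q z.1 z.2 := by
  unfold gradQuantity
  refine (Continuous.div_const (Continuous.rpow_const
    ((continuous_areaElem η).comp continuous_snd) fun z => Or.inl (areaElem_pos hη _).ne') _).sub ?_
  fun_prop

theorem hasDerivAt_areaElem (hη : 0 < η) {p : ℝ → E} {p' : E} {s : ℝ} (hp : HasDerivAt p p' s) :
    HasDerivAt (fun s => areaElem η (p s)) (inner ℝ (p s) p' / areaElem η (p s)) s := by
  have h1 := ((hp.norm_sq).const_add (η ^ 2)).sqrt (by positivity)
  refine h1.congr_deriv ?_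
  rw [areaElem]
  have := (areaElem_pos hη (p s)).ne'
  rw [areaElem] at this
  field_simp

theorem hasDerivWithinAt_areaElem (hη : 0 < η) {p : ℝ → E} {p' : E} {s : ℝ} {I : Set ℝ}
    (hp : HasDerivWithinAt p p' I s) :
    HasDerivWithinAt (fun s => areaElem η (p s)) (inner ℝ (p s) p' / areaElem η (p s)) I s := by
  have h1 := ((hp.norm_sq).const_add (η ^ 2)).sqrt (by positivity)
  refine h1.congr_deriv ?_
  rw [areaElem]
  have := (areaElem_pos hη (p s)).ne'
  rw [areaElem] at this
  field_simp

theorem hasDerivAt_areaElem_rpow (hη : 0 < η) {p : ℝ → E} {p' : E} {s : ℝ} (r : ℝ)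
    (hp : HasDerivAt p p' s) :
    HasDerivAt (fun s => areaElem η (p s) ^ r)
      (r * areaElem η (p s) ^ (r - 2) * inner ℝ (p s) p') s := by
  have hv := areaElem_pos hη (p s)
  refine ((hasDerivAt_areaElem hη hp).rpow_const (p := r) (Or.inl hv.ne')).congr_deriv ?_
  rw [show r - 1 = (r - 2) + 1 by ring, Real.rpow_add_one hv.ne']
  field_simp

theorem hasDerivWithinAt_areaElem_rpow (hη : 0 < η) {p : ℝ → E} {p' : E} {s : ℝ} {I : Set ℝ}
    (r : ℝ) (hp : HasDerivWithinAt p p' I s) :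
    HasDerivWithinAt (fun s => areaElem η (p s) ^ r)
      (r * areaElem η (p s) ^ (r - 2) * inner ℝ (p s) p') I s := by
  have hv := areaElem_pos hη (p s)
  refine ((hasDerivWithinAt_areaElem hη hp).rpow_const (p := r) (Or.inl hv.ne')).congr_deriv ?_
  rw [show r - 1 = (r - 2) + 1 by ring, Real.rpow_add_one hv.ne']
  field_simp

/-- The vector ξ = v^{q-1}p - X appearing here is the direction in which the equation is later
differentiated. -/
theorem hasDerivWithinAt_gradQuantity (hη : 0 < η) (hq : 0 < q) {p X : ℝ → E} {p' X' : E} {s : ℝ}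
    {I : Set ℝ} (hp : HasDerivWithinAt p p' I s) (hX : HasDerivWithinAt X X' I s) :
    HasDerivWithinAt (fun s => gradQuantity η q (X s) (p s))
      (inner ℝ (areaElem η (p s) ^ (q - 1) • p s - X s) p' - inner ℝ X' (p s)) I s := by
  have h1 := ((hasDerivWithinAt_areaElem_rpow hη (q + 1) hp).div_const (q + 1)).sub (hX.inner ℝ hp)
  refine h1.congr_deriv ?_
  rw [inner_sub_left, inner_smul_left, show q + 1 - 2 = q - 1 by ring]
  simp only [conj_trivial]
  field_simp
  ring

theorem hasDerivAt_gradQuantity (hη : 0 < η) (hq : 0 < q) {p X : ℝ → E} {p' X' : E} {s : ℝ}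
    (hp : HasDerivAt p p' s) (hX : HasDerivAt X X' s) :
    HasDerivAt (fun s => gradQuantity η q (X s) (p s))
      (inner ℝ (areaElem η (p s) ^ (q - 1) • p s - X s) p' - inner ℝ X' (p s)) s :=
  (hasDerivWithinAt_gradQuantity hη hq hp.hasDerivWithinAt hX.hasDerivWithinAt).hasDerivAt
    univ_mem

theorem hasDerivAt_deriv_gradQuantity (hη : 0 < η) {p X p' X' : ℝ → E} {p'' X'' : E} {s : ℝ}
    (hp : HasDerivAt p (p' s) s) (hX : HasDerivAt X (X' s) s) (hp' : HasDerivAt p' p'' s)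
    (hX' : HasDerivAt X' X'' s) :
    HasDerivAt (fun s => inner ℝ (areaElem η (p s) ^ (q - 1) • p s - X s) (p' s)
        - inner ℝ (X' s) (p s))
      (inner ℝ (areaElem η (p s) ^ (q - 1) • p s - X s) p''
        + areaElem η (p s) ^ (q - 1) * ‖p' s‖ ^ 2
        + (q - 1) * areaElem η (p s) ^ (q - 3) * inner ℝ (p s) (p' s) ^ 2
        - 2 * inner ℝ (X' s) (p' s) - inner ℝ X'' (p s)) s := by
  have h1 := ((((hasDerivAt_areaElem_rpow hη (q - 1) hp).smul hp).sub hX).inner ℝ hp').sub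
    (hX'.inner ℝ hp)
  refine h1.congr_deriv ?_
  simp only [Pi.sub_apply, Pi.smul_apply', inner_sub_left, inner_add_left, inner_smul_left,
    conj_trivial, real_inner_self_eq_norm_sq, show q - 1 - 2 = q - 3 by ring]
  ring

end Quantity

/-! ### Restriction of vector fields to lines -/

section Lines

variable {E F : Type*} [NormedAddCommGroup E] [NormedSpace ℝ E]
  [NormedAddCommGroup F] [NormedSpace ℝ F]

theorem hasDerivAt_line (x d : E) (s : ℝ) : HasDerivAt (fun s : ℝ => x + s • d) d s := by
  simpa using ((hasDerivAt_id s).smul_const d).const_add x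

theorem tendsto_line (x d : E) : Tendsto (fun s : ℝ => x + s • d) (𝓝 0) (𝓝 x) := by
  have h : Continuous (fun s : ℝ => x + s • d) := by fun_prop
  simpa using h.tendsto 0

theorem eventually_hasDerivAt_line {p : E → F} {x : E} (hp : ContDiffAt ℝ 2 p x) (d : E) :
    ∀ᶠ s in 𝓝 (0:ℝ), HasDerivAt (fun s : ℝ => p (x + s • d)) (fderiv ℝ p (x + s • d) d) s := by
  have h1 : ∀ᶠ z in 𝓝 x, DifferentiableAt ℝ p z := by
    filter_upwards [hp.eventually (by simp)] with z hz
    exact hz.differentiableAt (by simp)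
  filter_upwards [(tendsto_line x d).eventually h1] with s hs
  exact hs.hasFDerivAt.comp_hasDerivAt s (hasDerivAt_line x d s)

theorem HasFDerivAt.hasDerivAt_line_zero {p : E → F} {p' : E →L[ℝ] F} {x : E}
    (hp : HasFDerivAt p p' x) (d : E) : HasDerivAt (fun s : ℝ => p (x + s • d)) (p' d) 0 := by
  have h1 : HasFDerivAt p p' (x + (0:ℝ) • d) := by simpa using hp
  exact h1.comp_hasDerivAt (0:ℝ) (hasDerivAt_line x d 0)

theorem hasFDerivAt_fderiv_of_contDiffAt {p : E → F} {x : E} (hp : ContDiffAt ℝ 2 p x) :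
    HasFDerivAt (fderiv ℝ p) (fderiv ℝ (fderiv ℝ p) x) x :=
  ((hp.fderiv_right (m := 1) (by norm_num)).differentiableAt (by simp)).hasFDerivAt

theorem hasDerivAt_fderiv_line {p : E → F} {x : E} (hp : ContDiffAt ℝ 2 p x) (d z : E) :
    HasDerivAt (fun s : ℝ => fderiv ℝ p (x + s • d) z) (fderiv ℝ (fderiv ℝ p) x d z) 0 :=
  (ContinuousLinearMap.apply ℝ F z).hasFDerivAt.comp_hasDerivAt (0:ℝ)
    ((hasFDerivAt_fderiv_of_contDiffAt hp).hasDerivAt_line_zero d)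

end Lines

/-! ### Critical-point conditions for ρw -/

section InteriorMaximum

variable {E : Type*} [NormedAddCommGroup E] [InnerProductSpace ℝ E]

/-- First and second order conditions along the line in the direction `d` at a local maximum of
`ρ w`, where `ρ = A - B |x - x_c|²`. -/
theorem line_conditions_of_isLocalMax {η q A B : ℝ} (hη : 0 < η) (hq : 0 < q) {p X : E → E}
    {x xc : E} (hp : ContDiffAt ℝ 2 p x) (hX : ContDiffAt ℝ 2 X x)
    (hmax : IsLocalMax (fun z => (A - B * ‖z - xc‖ ^ 2) * gradQuantity η q (X z) (p z)) x)
    (hρ : 0 < A - B * ‖x - xc‖ ^ 2) {b v w : ℝ} {G ξ : E} (hb : b = 2 * B / (A - B * ‖x - xc‖ ^ 2))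
    (hv : v = areaElem η (p x))
    (hw : w = gradQuantity η q (X x) (p x)) (hG : G = b • (x - xc))
    (hξ : ξ = v ^ (q - 1) • p x - X x) (d : E) :
    inner ℝ ξ (fderiv ℝ p x d) - inner ℝ (fderiv ℝ X x d) (p x) = w * inner ℝ G d ∧
    inner ℝ ξ (fderiv ℝ (fderiv ℝ p) x d d) + v ^ (q - 1) * ‖fderiv ℝ p x d‖ ^ 2
        + (q - 1) * v ^ (q - 3) * inner ℝ (p x) (fderiv ℝ p x d) ^ 2
        - 2 * inner ℝ (fderiv ℝ X x d) (fderiv ℝ p x d)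
        - inner ℝ (fderiv ℝ (fderiv ℝ X) x d d) (p x) ≤
      b * w * ‖d‖ ^ 2 + 2 * w * inner ℝ G d ^ 2 := by
  set ρ : ℝ := A - B * ‖x - xc‖ ^ 2 with hρdef
  have hd2 : ∀ s : ℝ, HasDerivAt (fun s : ℝ => A - B * ‖x + s • d - xc‖ ^ 2)
      (-(2 * B * inner ℝ (x + s • d - xc) d)) s := by
    intro s
    have h1 := ((((hasDerivAt_line x d s).sub_const xc).norm_sq).const_mul B).const_sub A
    refine h1.congr_deriv ?_
    ring
  have hd3 : HasDerivAt (fun s : ℝ => -(2 * B * inner ℝ (x + s • d - xc) d))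
      (-(2 * B * ‖d‖ ^ 2)) 0 := by
    have h1 := ((((hasDerivAt_line x d 0).sub_const xc).inner ℝ
      (hasDerivAt_const (0:ℝ) d)).const_mul (2 * B)).neg
    refine h1.congr_deriv ?_
    simp
  have hp1 := eventually_hasDerivAt_line hp d
  have hX1 := eventually_hasDerivAt_line hX d
  have hw1 : ∀ᶠ s in 𝓝 (0:ℝ), HasDerivAt
      (fun s : ℝ => gradQuantity η q (X (x + s • d)) (p (x + s • d)))
      (inner ℝ (areaElem η (p (x + s • d)) ^ (q - 1) • p (x + s • d) - X (x + s • d))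
        (fderiv ℝ p (x + s • d) d) - inner ℝ (fderiv ℝ X (x + s • d) d) (p (x + s • d))) s := by
    filter_upwards [hp1, hX1] with s hs1 hs2
    exact hasDerivAt_gradQuantity hη hq hs1 hs2
  have hw2 := hasDerivAt_deriv_gradQuantity (q := q) hη hp1.self_of_nhds hX1.self_of_nhds
    (hasDerivAt_fderiv_line hp d d) (hasDerivAt_fderiv_line hX d d)
  have hF1 := hw1.mono fun s hs => (hd2 s).mul hs
  have hF2 := (hd3.mul hw1.self_of_nhds).add ((hd2 0).mul hw2)
  have hmax' : IsLocalMax (fun s : ℝ => (A - B * ‖x + s • d - xc‖ ^ 2) *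
      gradQuantity η q (X (x + s • d)) (p (x + s • d))) 0 := by
    have := (tendsto_line x d).eventually hmax
    filter_upwards [this] with s hs
    simpa using hs
  have c1 := hmax'.hasDerivAt_eq_zero hF1.self_of_nhds
  have c2 := second_deriv_nonpos_of_isLocalMax hF1 hF2 hmax'
  simp only [zero_smul, add_zero, ← hρdef, ← hw, ← hv, ← hξ] at c1 c2
  have hbρ : b * ρ = 2 * B := by rw [hb]; field_simp
  have hGd : inner ℝ G d = b * inner ℝ (x - xc) d := by rw [hG, inner_smul_left]; simp
  set a := inner ℝ ξ (fderiv ℝ p x d) - inner ℝ (fderiv ℝ X x d) (p x) with ha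
  have c3 : a = w * inner ℝ G d := by
    rw [hGd]
    have : ρ * a = ρ * (w * (b * inner ℝ (x - xc) d)) := by
      linear_combination c1 - (w * inner ℝ (x - xc) d) * hbρ
    exact mul_left_cancel₀ hρ.ne' this
  refine ⟨c3, ?_⟩
  -- The first-order condition turns the cross term 2ρ'w' into a multiple of w⟨G, d⟩², which becomes
  -- the last term of the claim after division by ρ.
  rw [c3] at c2
  set W := inner ℝ ξ (fderiv ℝ (fderiv ℝ p) x d d) + v ^ (q - 1) * ‖fderiv ℝ p x d‖ ^ 2
        + (q - 1) * v ^ (q - 3) * inner ℝ (p x) (fderiv ℝ p x d) ^ 2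
        - 2 * inner ℝ (fderiv ℝ X x d) (fderiv ℝ p x d)
        - inner ℝ (fderiv ℝ (fderiv ℝ X) x d d) (p x) with hW
  have h5 : ρ * W ≤ ρ * (b * w * ‖d‖ ^ 2 + 2 * w * inner ℝ G d ^ 2) := by
    have e1 : ρ * (b * w * ‖d‖ ^ 2 + 2 * w * inner ℝ G d ^ 2) =
        2 * B * w * ‖d‖ ^ 2 + 4 * B * inner ℝ (x - xc) d * (w * inner ℝ G d) := by
      rw [hGd]
      linear_combination (w * ‖d‖ ^ 2 + 2 * w * (b * inner ℝ (x - xc) d ^ 2)) * hbρ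
    rw [e1]
    linarith
  exact le_of_mul_le_mul_left h5 hρ

end InteriorMaximum

/-! ### The equation in nondivergence form and its directional derivative -/

section DifferentiatedEquation

variable {n : ℕ}

/-- The right-hand side of the equation in nondivergence form, at a point with gradient `p`, Hessian
`S` and values `a`, `b` of `c`, `f`. -/
def flowOperator (η : ℝ) (p : EuclideanSpace ℝ (Fin n))
    (S : EuclideanSpace ℝ (Fin n) →L[ℝ] EuclideanSpace ℝ (Fin n)) (a b : ℝ) : ℝ :=
  ∑ i, (S (EuclideanSpace.single i 1)) i - inner ℝ (S p) p / areaElem η p ^ 2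
    + a * areaElem η p - b

theorem hasDerivAt_flowOperator_line {η : ℝ} (hη : 0 < η)
    {p : EuclideanSpace ℝ (Fin n) → EuclideanSpace ℝ (Fin n)} {x ξ : EuclideanSpace ℝ (Fin n)}
    (hp : ContDiffAt ℝ 2 p x) {a b : ℝ → ℝ} {a' b' v : ℝ} (hv : v = areaElem η (p x))
    (ha : HasDerivAt a a' 0) (hb : HasDerivAt b b' 0) :
    HasDerivAt (fun s : ℝ => flowOperator η (p (x + s • ξ)) (fderiv ℝ p (x + s • ξ)) (a s) (b s))
      (∑ i, (fderiv ℝ (fderiv ℝ p) x ξ (EuclideanSpace.single i 1)) i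
        - (inner ℝ (fderiv ℝ (fderiv ℝ p) x ξ (p x)) (p x)
            + inner ℝ (fderiv ℝ p x (fderiv ℝ p x ξ)) (p x)
            + inner ℝ (fderiv ℝ p x (p x)) (fderiv ℝ p x ξ)) / v ^ 2
        + 2 * inner ℝ (fderiv ℝ p x (p x)) (p x) * inner ℝ (p x) (fderiv ℝ p x ξ) / v ^ 4
        + a' * v + a 0 * (inner ℝ (p x) (fderiv ℝ p x ξ) / v) - b') 0 := by
  have hv0 : 0 < v := hv ▸ areaElem_pos hη _
  have hp1 := (eventually_hasDerivAt_line hp ξ).self_of_nhds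
  have hvd := hasDerivAt_areaElem hη hp1
  have h1 : HasDerivAt (fun s : ℝ => ∑ i, (fderiv ℝ p (x + s • ξ) (EuclideanSpace.single i 1)) i)
      (∑ i, (fderiv ℝ (fderiv ℝ p) x ξ (EuclideanSpace.single i 1)) i) 0 := by
    refine HasDerivAt.fun_sum fun i _ => ?_
    exact (EuclideanSpace.proj i).hasFDerivAt.comp_hasDerivAt (0:ℝ)
      (hasDerivAt_fderiv_line hp ξ (EuclideanSpace.single i 1))
  have h2 : HasDerivAt (fun s : ℝ => fderiv ℝ p (x + s • ξ) (p (x + s • ξ)))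
      (fderiv ℝ (fderiv ℝ p) x ξ (p x) + fderiv ℝ p x (fderiv ℝ p x ξ)) 0 := by
    have h3 := ((hasFDerivAt_fderiv_of_contDiffAt hp).hasDerivAt_line_zero ξ).clm_apply hp1
    simpa using h3
  have h3 := h2.inner ℝ hp1
  have h4 := ((h1.sub (h3.div (hvd.pow 2) (by
    simpa using (areaElem_pos hη _).ne'))).add (ha.mul hvd)).sub hb
  refine h4.congr_deriv ?_
  simp only [Pi.pow_apply, zero_smul, add_zero, ← hv]
  rw [inner_add_left]
  field_simp
  ring

end DifferentiatedEquation

/-! ### The differential inequality at an interior maximum -/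

section InteriorEstimate

variable {n : ℕ}

/-- With p = Du, third derivatives of u are totally symmetric. This matches the second-order
condition, differentiated twice along d, with the equation differentiated once along ξ. -/
theorem inner_third_derivative_symm {E : Type*} [NormedAddCommGroup E] [InnerProductSpace ℝ E]
    {p : E → E} {x : E} (hp : ContDiffAt ℝ 2 p x)
    (hsym : ∀ᶠ z in 𝓝 x, ∀ a b, inner ℝ (fderiv ℝ p z a) b = inner ℝ (fderiv ℝ p z b) a)
    (ξ d : E) : inner ℝ ξ (fderiv ℝ (fderiv ℝ p) x d d) =
      inner ℝ (fderiv ℝ (fderiv ℝ p) x ξ d) d := by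
  have h1 : IsSymmSndFDerivAt ℝ p x := hp.isSymmSndFDerivAt (by simp)
  have h2 : HasDerivAt (fun s : ℝ => inner ℝ (fderiv ℝ p (x + s • d) d) ξ)
      (inner ℝ (fderiv ℝ (fderiv ℝ p) x d d) ξ) 0 := by
    simpa using (hasDerivAt_fderiv_line hp d d).inner ℝ (hasDerivAt_const (0:ℝ) ξ)
  have h3 : HasDerivAt (fun s : ℝ => inner ℝ (fderiv ℝ p (x + s • d) ξ) d)
      (inner ℝ (fderiv ℝ (fderiv ℝ p) x d ξ) d) 0 := by
    simpa using (hasDerivAt_fderiv_line hp d ξ).inner ℝ (hasDerivAt_const (0:ℝ) d)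
  have h4 : (fun s : ℝ => inner ℝ (fderiv ℝ p (x + s • d) d) ξ) =ᶠ[𝓝 0]
      (fun s : ℝ => inner ℝ (fderiv ℝ p (x + s • d) ξ) d) := by
    filter_upwards [(tendsto_line x d).eventually hsym] with s hs
    exact hs d ξ
  rw [real_inner_comm, h2.unique (h3.congr_of_eventuallyEq h4), h1.eq d ξ]

/-- The derivatives of X contribute only terms linear in the Hessian, which after normalization
carry a factor ε and are absorbed by Q. -/
theorem IsFrame.sum_error_le {e : EuclideanSpace ℝ (Fin n)} {d : Fin n → EuclideanSpace ℝ (Fin n)}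
    (hd : IsFrame e d) {K v : ℝ} (hK : 1 ≤ K) (hnK : (n : ℝ) ≤ K) (hv : 0 ≤ v)
    (S D : EuclideanSpace ℝ (Fin n) →L[ℝ] EuclideanSpace ℝ (Fin n))
    (D2 : EuclideanSpace ℝ (Fin n) →L[ℝ] EuclideanSpace ℝ (Fin n) →L[ℝ] EuclideanSpace ℝ (Fin n))
    (hD : 2 * ‖D‖ ≤ K) (hD2 : ‖D2‖ ≤ K) {p : EuclideanSpace ℝ (Fin n)} (hp : ‖p‖ ≤ v) :
    ∑ i, (2 * inner ℝ (D (d i)) (S (d i)) + inner ℝ (D2 (d i) (d i)) p) ≤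
      K ^ 2 * (v + Real.sqrt (∑ i, ‖S (d i)‖ ^ 2)) := by
  have hdn : ∑ i, ‖d i‖ ^ 2 ≤ K := by
    rw [hd.sum_norm_sq]; linarith [sq_nonneg ‖e‖]
  have h1 : ∀ i, 2 * inner ℝ (D (d i)) (S (d i)) + inner ℝ (D2 (d i) (d i)) p ≤
      K * (‖d i‖ * ‖S (d i)‖) + K * v * ‖d i‖ ^ 2 := by
    intro i
    have a1 := (le_abs_self _).trans (abs_real_inner_le_norm (D (d i)) (S (d i)))
    have a2 := (le_abs_self _).trans (abs_real_inner_le_norm (D2 (d i) (d i)) p)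
    have a3 : ‖D (d i)‖ * ‖S (d i)‖ ≤ ‖D‖ * ‖d i‖ * ‖S (d i)‖ := by
      gcongr; exact D.le_opNorm _
    have a4 : ‖D2 (d i) (d i)‖ * ‖p‖ ≤ K * ‖d i‖ * ‖d i‖ * v := by
      gcongr
      refine (D2.le_opNorm₂ _ _).trans ?_
      gcongr
    have a5 : 2 * ‖D‖ * (‖d i‖ * ‖S (d i)‖) ≤ K * (‖d i‖ * ‖S (d i)‖) := by gcongr
    calc _ ≤ 2 * (‖D‖ * ‖d i‖ * ‖S (d i)‖) + K * ‖d i‖ * ‖d i‖ * v := by linarith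
      _ = 2 * ‖D‖ * (‖d i‖ * ‖S (d i)‖) + K * v * ‖d i‖ ^ 2 := by ring
      _ ≤ _ := by linarith
  have h2 : ∑ i, ‖d i‖ * ‖S (d i)‖ ≤ K * Real.sqrt (∑ i, ‖S (d i)‖ ^ 2) := by
    refine (Real.sum_mul_le_sqrt_mul_sqrt _ _ _).trans ?_
    gcongr
    refine Real.sqrt_le_iff.2 ⟨by linarith, hdn.trans ?_⟩
    nlinarith
  calc _ ≤ ∑ i, (K * (‖d i‖ * ‖S (d i)‖) + K * v * ‖d i‖ ^ 2) := Finset.sum_le_sum fun i _ => h1 i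
    _ = K * ∑ i, ‖d i‖ * ‖S (d i)‖ + K * v * ∑ i, ‖d i‖ ^ 2 := by
      rw [Finset.sum_add_distrib, Finset.mul_sum, Finset.mul_sum]
    _ ≤ K * (K * Real.sqrt (∑ i, ‖S (d i)‖ ^ 2)) + K * v * K := by gcongr
    _ = _ := by ring

/-- The inequality at an interior maximum, before normalization. -/
theorem interior_max_inequality {η q A B c₀ cz fz b v w : ℝ} (hη : 0 < η) (hq : 0 < q)
    {p X : EuclideanSpace ℝ (Fin n) → EuclideanSpace ℝ (Fin n)}
    {x xc G ξ e g cx fx : EuclideanSpace ℝ (Fin n)} {ut c f : EuclideanSpace ℝ (Fin n) → ℝ}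
    {d : Fin n → EuclideanSpace ℝ (Fin n)}
    (hp : ContDiffAt ℝ 2 p x) (hX : ContDiffAt ℝ 2 X x)
    (hsym : ∀ᶠ z in 𝓝 x, ∀ a b, inner ℝ (fderiv ℝ p z a) b = inner ℝ (fderiv ℝ p z b) a)
    (hmax : IsLocalMax (fun z => (A - B * ‖z - xc‖ ^ 2) * gradQuantity η q (X z) (p z)) x)
    (hρ : 0 < A - B * ‖x - xc‖ ^ 2) (hb : b = 2 * B / (A - B * ‖x - xc‖ ^ 2))
    (hv : v = areaElem η (p x)) (hw : w = gradQuantity η q (X x) (p x)) (hG : G = b • (x - xc))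
    (hξ : ξ = v ^ (q - 1) • p x - X x) (he : p x = v • e) (hd : IsFrame e d)
    (hut : HasFDerivAt ut (innerSL ℝ g) x) (hgξ : 0 ≤ inner ℝ g ξ)
    (heq : ∀ᶠ z in 𝓝 x, ut z = flowOperator η (p z) (fderiv ℝ p z) (c z) (f z))
    (hc : HasFDerivAt c (innerSL ℝ (cx + cz • p x)) x)
    (hf : HasFDerivAt f (innerSL ℝ (fx + fz • p x)) x) (hc₀ : c₀ = c x)
    (hcz : cz ≤ 0) (hfz : 0 ≤ fz) (hpξ : 0 ≤ inner ℝ (p x) ξ) :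
    0 ≤ b * w * (n - ‖e‖ ^ 2) + 2 * w * reducedForm e G G
      - v ^ (q - 1) * ∑ i, ‖fderiv ℝ p x (d i)‖ ^ 2
      - (q - 1) * v ^ (q - 3) * reducedForm e (fderiv ℝ p x (p x)) (fderiv ℝ p x (p x))
      + ∑ i, (2 * inner ℝ (fderiv ℝ X x (d i)) (fderiv ℝ p x (d i))
          + inner ℝ (fderiv ℝ (fderiv ℝ X) x (d i) (d i)) (p x))
      - 2 / v ^ 2 * reducedForm e (fderiv ℝ p x (p x)) (fderiv ℝ p x ξ)
      + inner ℝ cx ξ * v + c₀ * inner ℝ e (fderiv ℝ p x ξ) - inner ℝ fx ξ := by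
  have hv0 : 0 < v := hv ▸ areaElem_pos hη _
  set S := fderiv ℝ p x with hS
  set T := fderiv ℝ (fderiv ℝ p) x with hT
  have hSsym := hsym.self_of_nhds
  have h1 := hut.hasDerivAt_line_zero ξ
  have h2 := hasDerivAt_flowOperator_line hη (ξ := ξ) hp hv (hc.hasDerivAt_line_zero ξ)
    (hf.hasDerivAt_line_zero ξ)
  have h3 := h1.unique (h2.congr_of_eventuallyEq ((tendsto_line x ξ).eventually heq))
  simp only [innerSL_apply_apply, zero_smul, add_zero, ← hS, ← hT, ← hc₀, inner_add_left,
    inner_smul_left, conj_trivial] at h3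
  -- The second-order condition summed over the frame. The left side becomes the principal part of
  -- the equation differentiated along ξ.
  have hlines : ∑ i, inner ℝ (T ξ (d i)) (d i) ≤ b * w * (n - ‖e‖ ^ 2) + 2 * w * reducedForm e G G
      - v ^ (q - 1) * ∑ i, ‖S (d i)‖ ^ 2
      - (q - 1) * v ^ (q - 3) * reducedForm e (S (p x)) (S (p x))
      + ∑ i, (2 * inner ℝ (fderiv ℝ X x (d i)) (S (d i))
          + inner ℝ (fderiv ℝ (fderiv ℝ X) x (d i) (d i)) (p x)) := by
    rw [← hd.sum_norm_sq, ← hd.sum_inner_mul_inner, ← hd.sum_inner_mul_inner, Finset.mul_sum,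
      Finset.mul_sum, Finset.mul_sum, Finset.mul_sum, ← Finset.sum_add_distrib,
      ← Finset.sum_sub_distrib, ← Finset.sum_sub_distrib, ← Finset.sum_add_distrib]
    refine Finset.sum_le_sum fun i _ => ?_
    have h4 := (line_conditions_of_isLocalMax hη hq hp hX hmax hρ hb hv hw hG hξ (d i)).2
    rw [inner_third_derivative_symm hp hsym, ← hS, ← hT] at h4
    have h5 : inner ℝ (p x) (S (d i)) = inner ℝ (S (p x)) (d i) := by
      rw [real_inner_comm, hSsym]
    rw [h5] at h4
    linarith
  have htr := hd.sum_inner (T ξ)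
  have hTp : inner ℝ (T ξ (p x)) (p x) = v ^ 2 * inner ℝ (T ξ e) e := by
    rw [he, map_smul, inner_smul_left, inner_smul_right]; simp; ring
  have hSS : inner ℝ (S (S ξ)) (p x) = inner ℝ (S (p x)) (S ξ) := hSsym _ _
  have hpe : ∀ y, inner ℝ (p x) y = v * inner ℝ e y := fun y => by
    rw [he, inner_smul_left]; simp
  have hred : reducedForm e (S (p x)) (S ξ) = inner ℝ (S (p x)) (S ξ)
      - inner ℝ e (S (p x)) * inner ℝ e (S ξ) := rfl
  have hSp : inner ℝ (S (p x)) (p x) = v * inner ℝ e (S (p x)) := by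
    rw [real_inner_comm, hpe]
  have key : inner ℝ g ξ = ∑ i, inner ℝ (T ξ (d i)) (d i)
      - 2 / v ^ 2 * reducedForm e (S (p x)) (S ξ)
      + (inner ℝ cx ξ + cz * inner ℝ (p x) ξ) * v + c₀ * inner ℝ e (S ξ)
      - (inner ℝ fx ξ + fz * inner ℝ (p x) ξ) := by
    rw [h3, htr, hTp, hSS, hred, hSp, hpe (S ξ)]
    field_simp
    ring
  -- Monotonicity of c and f in z, together with ⟨p, ξ⟩ ≥ 0, lets both zero-order terms be
  -- discarded.
  have hcz' : cz * inner ℝ (p x) ξ * v ≤ 0 :=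
    mul_nonpos_of_nonpos_of_nonneg (mul_nonpos_of_nonpos_of_nonneg hcz hpξ) hv0.le
  have hfz' : 0 ≤ fz * inner ℝ (p x) ξ := mul_nonneg hfz hpξ
  rw [key] at hgξ
  linarith

end InteriorEstimate

/-! ### Exclusion of interior maxima with large area element -/

section InteriorEstimate

variable {n : ℕ}

theorem reducedForm_smul_smul (e x y : EuclideanSpace ℝ (Fin n)) (s t : ℝ) :
    reducedForm e (s • x) (t • y) = s * t * reducedForm e x y := by
  simp only [reducedForm, inner_smul_left, inner_smul_right, conj_trivial]
  ring

/-- At an interior maximum of `ρ w` the area element is not large. -/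
theorem interior_max_false (hn : 2 ≤ n) {η q A B c₀ cz fz b v w K δ ϑ C β D : ℝ}
    (hη : η ∈ Ioc (0:ℝ) 1) (hq : 0 < q) (hK : 1 ≤ K) (hqK : q ≤ K) (hnK : (n : ℝ) ≤ K)
    (hϑ1 : ϑ * interiorErrorConst K ≤ 1 / 4) (hϑδ : ϑ * (16 * interiorErrorConst K ^ 2) < δ)
    {p X : EuclideanSpace ℝ (Fin n) → EuclideanSpace ℝ (Fin n)}
    {x xc G ξ g cx fx : EuclideanSpace ℝ (Fin n)} {ut c f : EuclideanSpace ℝ (Fin n) → ℝ}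
    (hp : ContDiffAt ℝ 2 p x) (hX : ContDiffAt ℝ 2 X x)
    (hsym : ∀ᶠ z in 𝓝 x, ∀ a b, inner ℝ (fderiv ℝ p z a) b = inner ℝ (fderiv ℝ p z b) a)
    (hmax : IsLocalMax (fun z => (A - B * ‖z - xc‖ ^ 2) * gradQuantity η q (X z) (p z)) x)
    (hρ : 0 < A - B * ‖x - xc‖ ^ 2) (hb : b = 2 * B / (A - B * ‖x - xc‖ ^ 2))
    (hv : v = areaElem η (p x)) (hw : w = gradQuantity η q (X x) (p x)) (hG : G = b • (x - xc))
    (hξ : ξ = v ^ (q - 1) • p x - X x)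
    (hut : HasFDerivAt ut (innerSL ℝ g) x) (hgξ : 0 ≤ inner ℝ g ξ)
    (heq : ∀ᶠ z in 𝓝 x, ut z = flowOperator η (p z) (fderiv ℝ p z) (c z) (f z))
    (hc : HasFDerivAt c (innerSL ℝ (cx + cz • p x)) x)
    (hf : HasFDerivAt f (innerSL ℝ (fx + fz • p x)) x) (hc₀ : c₀ = c x)
    (hcz : cz ≤ 0) (hfz : 0 ≤ fz)
    (hXK : ‖X x‖ ≤ K) (hDX : 2 * ‖fderiv ℝ X x‖ ≤ K) (hD2X : ‖fderiv ℝ (fderiv ℝ X) x‖ ≤ K)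
    (hfx : 2 * ‖fx‖ ≤ K) (hutf : |ut x + f x| ≤ K) (hcD : ‖cx‖ ≤ D) (hDK : D ≤ K)
    (hcK : |c₀| ≤ K) (hCK : C ≤ K) (hGC : ‖G‖ ≤ (1 + q) * C) (hβ0 : 0 ≤ β) (hβK : β ≤ K)
    (hb0 : 0 ≤ b) (hbβ : b ≤ (1 + q) * β)
    (hcoer : δ + D + C * |c₀| + (n - 1) * β + (1 + q) * C ^ 2 ≤ c₀ ^ 2 / (n - 1))
    (hv1 : v⁻¹ ≤ ϑ) (hvq : v ^ (-q) ≤ ϑ) : False := by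
  have hv0 : 0 < v := hv ▸ areaElem_pos hη.1 _
  have hvi : 0 < v⁻¹ := inv_pos.2 hv0
  have hϑ0 : 0 ≤ ϑ := hvi.le.trans hv1
  -- The scaling of the problem: ξ = z(e - εX) with ε = 1/z, and the whole inequality carries the
  -- factor z * v = v^(q+1).
  set z := v ^ q with hz
  have hz0 : 0 < z := Real.rpow_pos_of_pos hv0 q
  set ε := z⁻¹ with hε
  have hε0 : 0 < ε := inv_pos.2 hz0
  have hεϑ : ε ≤ ϑ := by rw [hε, hz, ← Real.rpow_neg hv0.le]; exact hvq
  have hzε : z * ε = 1 := mul_inv_cancel₀ hz0.ne'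
  have hp1 : v ^ (q - 1) = z / v := by rw [Real.rpow_sub_one hv0.ne']
  have hp3 : v ^ (q - 3) = z / v ^ 3 := by
    rw [show q - 3 = q - (3:ℕ) by norm_num, Real.rpow_sub_natCast hv0.ne']
  have hϑs : ϑ ≤ 1 / 8 ∧ ϑ * K ≤ 1 / 8 := by
    have h1 : K ≤ K ^ 11 := le_self_pow₀ hK (by norm_num)
    have h2 : ϑ * (8 * K) ≤ 1 := by
      have : ϑ * (8 * K) ≤ ϑ * interiorErrorConst K := by
        rw [interiorErrorConst]; gcongr; linarith
      linarith
    have h3 : ϑ * K ≤ 1 / 8 := by linarith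
    exact ⟨(le_mul_of_one_le_right hϑ0 hK).trans h3, h3⟩
  obtain ⟨e, he⟩ : ∃ e, e = v⁻¹ • p x := ⟨_, rfl⟩
  have hpe : p x = v • e := by rw [he, smul_smul, mul_inv_cancel₀ hv0.ne', one_smul]
  have hsq : v ^ 2 = η ^ 2 + ‖p x‖ ^ 2 := hv ▸ sq_areaElem η (p x)
  have hne : ‖e‖ ^ 2 = 1 - η ^ 2 * v⁻¹ ^ 2 := by
    rw [he, norm_smul, Real.norm_eq_abs, abs_of_pos hvi, mul_pow]
    have : ‖p x‖ ^ 2 = v ^ 2 - η ^ 2 := by linarith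
    rw [this]
    field_simp
  have he1 : ‖e‖ ≤ 1 := by
    refine (sq_le_one_iff₀ (norm_nonneg e)).1 ?_
    rw [hne]; linarith [mul_nonneg (sq_nonneg η) (sq_nonneg v⁻¹)]
  -- The defect is η²/v², so η ≤ 1 makes its smallness uniform in η.
  have he2 : 1 - ‖e‖ ^ 2 ≤ ϑ := by
    rw [hne]
    have h1 : η ^ 2 ≤ 1 := pow_le_one₀ hη.1.le hη.2
    calc 1 - (1 - η ^ 2 * v⁻¹ ^ 2) = η ^ 2 * (v⁻¹ * v⁻¹) := by ring
      _ ≤ 1 * (ϑ * 1) := by gcongr; linarith [hϑs.1]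
      _ = ϑ := by ring
  obtain ⟨d, hd⟩ := exists_frame e he1
  have hd : IsFrame e d := hd
  set S := fderiv ℝ p x with hS
  have hSsym : ∀ a b, inner ℝ (S a) b = inner ℝ (S b) a := hsym.self_of_nhds
  set St : EuclideanSpace ℝ (Fin n) →L[ℝ] EuclideanSpace ℝ (Fin n) := v⁻¹ • S with hSt
  have hSSt : ∀ y, S y = v • St y := fun y => by
    rw [hSt, smul_apply, smul_smul, mul_inv_cancel₀ hv0.ne', one_smul]
  have hξe : ξ = z • (e - ε • X x) := by
    rw [hξ, hp1, hpe, smul_sub, smul_smul, smul_smul, hzε, one_smul, div_mul_cancel₀ _ hv0.ne']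
  set h := St (e - ε • X x) with hh
  have hSξ : S ξ = (z * v) • h := by rw [hξe, map_smul, hSSt, smul_smul]
  have hSp : S (p x) = v ^ 2 • St e := by
    rw [hpe, map_smul, hSSt, smul_smul]; ring_nf
  have hw' : w = z * v * (1 / (1 + q) - ε * inner ℝ (X x) e) := by
    rw [hw, gradQuantity, ← hv, Real.rpow_add_one hv0.ne', ← hz, hpe, inner_smul_right]
    have : z * v * (ε * inner ℝ (X x) e) = v * inner ℝ (X x) e := by
      linear_combination (v * inner ℝ (X x) e) * hzε
    rw [mul_sub, this, add_comm q 1]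
    ring
  set DX := fderiv ℝ X x with hDXdef
  set Y := ContinuousLinearMap.adjoint DX e with hY
  have hYK : ‖Y‖ ≤ K := by
    calc ‖Y‖ ≤ ‖ContinuousLinearMap.adjoint DX‖ * ‖e‖ := ContinuousLinearMap.le_opNorm _ _
      _ = ‖DX‖ * ‖e‖ := by rw [LinearIsometryEquiv.norm_map]
      _ ≤ ‖DX‖ * 1 := by gcongr
      _ ≤ K := by linarith [norm_nonneg DX]
  have hh' : h = (1 / (1 + q) - ε * inner ℝ (X x) e) • G + ε • Y := by
    -- The first-order conditions in all directions at once, using the symmetry of the Hessian and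
    -- moving DX onto e by its adjoint.
    have h1 : S ξ = w • G + v • Y := by
      refine ext_inner_right ℝ fun y => ?_
      have h2 := (line_conditions_of_isLocalMax hη.1 hq hp hX hmax hρ hb hv hw hG hξ y).1
      rw [← hS, ← hDXdef] at h2
      rw [hSsym ξ y, real_inner_comm, inner_add_left, inner_smul_left,
        inner_smul_left, hY, ContinuousLinearMap.adjoint_inner_left]
      simp only [conj_trivial]
      rw [hpe, inner_smul_right, real_inner_comm e (DX y)] at h2
      linarith
    have h3 : (z * v) • h = (z * v) •
        ((1 / (1 + q) - ε * inner ℝ (X x) e) • G + ε • Y) := by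
      rw [← hSξ, h1, hw', smul_add, smul_smul, smul_smul,
        show z * v * ε = v by linear_combination v * hzε]
    exact smul_right_injective _ (mul_pos hz0 hv0).ne' h3
  have hXe : |inner ℝ (X x) e| ≤ K := (abs_real_inner_le_norm _ _).trans
    ((mul_le_of_le_one_right (norm_nonneg _) he1).trans hXK)
  have hξn : ‖e - ε • X x‖ ≤ 1 + ε * K := by
    refine (norm_sub_le _ _).trans ?_
    rw [norm_smul, Real.norm_eq_abs, abs_of_pos hε0]
    gcongr
  have hεK : ε * K ≤ 1 / 8 := le_trans (by gcongr) hϑs.2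
  have hpξ : 0 ≤ inner ℝ (p x) ξ := by
    rw [hpe, hξe, inner_smul_left, inner_smul_right, inner_sub_right, inner_smul_right,
      real_inner_self_eq_norm_sq, real_inner_comm]
    have h1 : ε * inner ℝ (X x) e ≤ 1 / 8 := by
      calc _ ≤ ε * K := by gcongr; exact (le_abs_self _).trans hXe
        _ ≤ _ := hεK
    have h2 : 0 ≤ ‖e‖ ^ 2 - ε * inner ℝ (X x) e := by linarith [hϑs.1]
    simp only [conj_trivial]
    positivity
  have hI := interior_max_inequality hη.1 hq hp hX hsym hmax hρ hb hv hw hG hξ hpe hd hut hgξ heq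
    hc hf hc₀ hcz hfz hpξ
  rw [← hS, ← hDXdef] at hI
  set Q := ∑ i, ‖St (d i)‖ ^ 2 with hQ
  have hSQ : ∑ i, ‖S (d i)‖ ^ 2 = v ^ 2 * Q := by
    rw [hQ, Finset.mul_sum]
    refine Finset.sum_congr rfl fun i _ => ?_
    rw [hSSt, norm_smul, Real.norm_eq_abs, abs_of_pos hv0, mul_pow]
  have herr := hd.sum_error_le hK hnK hv0.le S DX (fderiv ℝ (fderiv ℝ X) x) hDX hD2X
    (p := p x) (hv ▸ norm_le_areaElem η (p x))
  rw [hSQ, Real.sqrt_mul (sq_nonneg v), Real.sqrt_sq hv0.le] at herr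
  have hcξ : inner ℝ cx ξ * v ≤ z * v * (D * (1 + ε * K)) := by
    rw [hξe, inner_smul_right]
    have h1 : inner ℝ cx (e - ε • X x) ≤ D * (1 + ε * K) := by
      refine (le_abs_self _).trans ((abs_real_inner_le_norm _ _).trans ?_)
      have := norm_nonneg cx
      gcongr
      linarith
    calc _ = z * v * inner ℝ cx (e - ε • X x) := by ring
      _ ≤ _ := by gcongr
  have hfξ : -inner ℝ fx ξ ≤ z * v * (K * ϑ) := by
    rw [hξe, inner_smul_right]
    have h1 : -inner ℝ fx (e - ε • X x) ≤ K := by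
      refine (neg_le_abs _).trans ((abs_real_inner_le_norm _ _).trans ?_)
      calc ‖fx‖ * ‖e - ε • X x‖ ≤ ‖fx‖ * 2 := by gcongr; linarith
        _ ≤ K := by linarith
    have h2 : 1 ≤ v * ϑ := by
      calc 1 = v * v⁻¹ := (mul_inv_cancel₀ hv0.ne').symm
        _ ≤ v * ϑ := by gcongr
    calc -(z * inner ℝ fx (e - ε • X x)) = z * -inner ℝ fx (e - ε • X x) := by ring
      _ ≤ z * K := by gcongr
      _ ≤ z * K * (v * ϑ) := le_mul_of_one_le_right (by positivity) h2
      _ = _ := by ring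
  have hceh : c₀ * inner ℝ e (S ξ) ≤ z * v * (|c₀| * ‖h‖) := by
    rw [hSξ, inner_smul_right]
    have h1 : c₀ * inner ℝ e h ≤ |c₀| * ‖h‖ := by
      refine (le_abs_self _).trans ?_
      rw [abs_mul]
      gcongr
      exact (abs_real_inner_le_norm _ _).trans (mul_le_of_le_one_left (norm_nonneg _) he1)
    calc c₀ * (z * v * inner ℝ e h) = z * v * (c₀ * inner ℝ e h) := by ring
      _ ≤ _ := by gcongr
  refine interior_algebra hn hK hq hqK hnK hε0.le hεϑ hϑ1 hϑδ (Y := Y) (G := G) (h := h) (S := St)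
    hd he1 he2 hXK hYK hCK hGC hβ0 hβK hb0 hbβ hcK hDK hh.symm hh' ?_ hcoer ?_
  · have h1 := hd.sum_inner S
    have h2 := heq.self_of_nhds
    rw [flowOperator, ← hv, ← hS, ← hc₀] at h2
    have h3 : ∑ i, inner ℝ (S (d i)) (d i) = v * ∑ i, inner ℝ (St (d i)) (d i) := by
      rw [Finset.mul_sum]
      refine Finset.sum_congr rfl fun i _ => ?_
      rw [hSSt, inner_smul_left]; simp
    have h4 : inner ℝ (S (p x)) (p x) = v ^ 2 * inner ℝ (S e) e := by
      rw [hpe, map_smul, inner_smul_left, inner_smul_right]; simp; ring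
    rw [h4, mul_div_cancel_left₀ _ (by positivity)] at h2
    -- This is the equation divided by v. The bound for u_t + f makes the right side O(1/v), so the
    -- weighted trace is nearly -c.
    have h5 : ∑ i, inner ℝ (St (d i)) (d i) + c₀ = v⁻¹ * (ut x + f x) := by
      rw [eq_inv_mul_iff_mul_eq₀ hv0.ne', mul_add, ← h3]
      linarith
    rw [h5, abs_mul, abs_of_pos hvi, mul_comm K]
    gcongr
  · have hfinal : 0 ≤ z * v * (-2 * reducedForm e (St e) h + D * (1 + ε * K) + |c₀| * ‖h‖ + K * ϑ
        - Q - (q - 1) * reducedForm e (St e) (St e) + ε * K ^ 2 * (1 + Real.sqrt Q)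
        + 2 * (1 / (1 + q) - ε * inner ℝ (X x) e) * reducedForm e G G
        + (1 / (1 + q) - ε * inner ℝ (X x) e) * b * (n - ‖e‖ ^ 2)) := by
      have e1 : b * w * (n - ‖e‖ ^ 2) =
          z * v * ((1 / (1 + q) - ε * inner ℝ (X x) e) * b * (n - ‖e‖ ^ 2)) := by
        rw [hw']; ring
      have e2 : 2 * w * reducedForm e G G =
          z * v * (2 * (1 / (1 + q) - ε * inner ℝ (X x) e) * reducedForm e G G) := by
        rw [hw']; ring
      have e3 : v ^ (q - 1) * ∑ i, ‖S (d i)‖ ^ 2 = z * v * Q := by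
        rw [hSQ, hp1]; field_simp
      have e4 : (q - 1) * v ^ (q - 3) * reducedForm e (S (p x)) (S (p x)) =
          z * v * ((q - 1) * reducedForm e (St e) (St e)) := by
        rw [hSp, reducedForm_smul_smul, hp3]; field_simp
      have e5 : 2 / v ^ 2 * reducedForm e (S (p x)) (S ξ) =
          z * v * (2 * reducedForm e (St e) h) := by
        rw [hSp, hSξ, reducedForm_smul_smul]; field_simp
      have e6 : K ^ 2 * (v + v * Real.sqrt Q) = z * v * (ε * K ^ 2 * (1 + Real.sqrt Q)) := by
        linear_combination (-(v * K ^ 2 * (1 + Real.sqrt Q))) * hzε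
      rw [e1, e2, e3, e4, e5] at hI
      rw [e6] at herr
      linarith
    exact nonneg_of_mul_nonneg_right hfinal (mul_pos hz0 hv0)

end InteriorEstimate

/-! ### The normal derivative of w at a boundary maximum -/

section BoundaryEstimate

theorem HasFDerivWithinAt.comp_hasDerivAt_of_eventually_mem {E F : Type*} [NormedAddCommGroup E]
    [NormedSpace ℝ E] [NormedAddCommGroup F] [NormedSpace ℝ F] {f : E → F} {f' : E →L[ℝ] F}
    {s : Set E} {x τ : E} {γ : ℝ → E} (hf : HasFDerivWithinAt f f' s x) (hγ : HasDerivAt γ τ 0)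
    (hx : γ 0 = x) (hmem : ∀ᶠ r in 𝓝 0, γ r ∈ s) :
    HasDerivAt (fun r => f (γ r)) (f' τ) 0 := by
  subst hx
  exact (hf.comp_hasDerivWithinAt (s := {r | γ r ∈ s}) (0:ℝ) hγ.hasDerivWithinAt
    fun r hr => hr).hasDerivAt hmem

/-- Here ε = v^{-q}, `a` is the mixed tangential-normal Hessian entry divided by v, and `s` the
tangential one. The differentiated boundary condition reads aκ ≤ C₀ + O(ε) with κ = 1 + O(ε²), so
the gap between C₀ and C absorbs all errors for small ε. -/
theorem boundary_algebra {K q C₀ C a s κ φ ε x y m : ℝ} (hK : 1 ≤ K) (hq : 0 < q) (hqK : q ≤ K)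
    (hε : 0 ≤ ε) (hC₀ : 0 ≤ C₀) (hC₀K : C₀ ≤ K) (hCK : C ≤ K) (hC : 0 ≤ C)
    (hεK : ε * (14 * K ^ 5) ≤ 1 / 2)
    (hsmall : C₀ + ε * (14 * K ^ 5) < C) (hφ : |φ| ≤ K) (hs : |s| ≤ 1)
    (hκ : κ = 1 + (q - 1) * φ ^ 2 * ε ^ 2) (hx : |x| ≤ 2 * K ^ 2) (hy : |y| ≤ K) (hm : |m| ≤ K)
    (ha : a * κ ≤ C₀ + ε * (x - (q - 1) * φ * s)) :
    a - ε * y < C * (1 - (1 + q) * ε * m) := by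
  have hK5 : ∀ k ≤ 5, K ^ k ≤ K ^ 5 := fun k hk => pow_le_pow_right₀ hK hk
  have hq1 : |q - 1| ≤ K := abs_le.2 ⟨by linarith, by linarith⟩
  have hε1 : ε ≤ 1 := by
    have := hK5 0 (by norm_num)
    nlinarith
  have h1 : |(q - 1) * φ * s| ≤ K ^ 2 := by
    rw [abs_mul, abs_mul]
    calc _ ≤ K * K * 1 := by gcongr
      _ = K ^ 2 := by ring
  have h2 : ε * (x - (q - 1) * φ * s) ≤ ε * (3 * K ^ 2) := by
    gcongr
    linarith [(abs_le.1 hx).2, (abs_le.1 h1).1]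
  have h3 : |1 - κ| ≤ ε * K ^ 3 := by
    rw [hκ, show 1 - (1 + (q - 1) * φ ^ 2 * ε ^ 2) = -((q - 1) * φ ^ 2 * ε ^ 2) by ring, abs_neg,
      abs_mul, abs_mul, abs_of_nonneg (sq_nonneg φ), abs_of_nonneg (sq_nonneg ε), ← sq_abs φ]
    calc |q - 1| * |φ| ^ 2 * ε ^ 2 ≤ K * K ^ 2 * (ε * 1) := by
          rw [sq ε]; gcongr
      _ = _ := by ring
  have hae : a ≤ C₀ + ε * (11 * K ^ 5) := by
    rcases le_or_gt a 0 with h | h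
    · have : 0 ≤ ε * (11 * K ^ 5) := by positivity
      linarith
    · have h4 : a * (1 - κ) ≤ a * (ε * K ^ 3) := by gcongr; exact (le_abs_self _).trans h3
      have h5 : ε * K ^ 3 ≤ 1 / 2 := by
        refine le_trans ?_ hεK
        have := hK5 3 (by norm_num)
        gcongr
        linarith [pow_pos (by linarith : 0 < K) 5]
      have h6 : a ≤ 8 * K ^ 2 := by
        have h7 : a * (ε * K ^ 3) ≤ a * (1 / 2) := by gcongr
        have h8 : ε * (3 * K ^ 2) ≤ 1 * (3 * K ^ 2) := by gcongr
        have h9 : K ≤ K ^ 2 := le_self_pow₀ hK two_ne_zero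
        linarith
      have h7 : a * (ε * K ^ 3) ≤ ε * (8 * K ^ 5) := by
        calc a * (ε * K ^ 3) ≤ 8 * K ^ 2 * (ε * K ^ 3) := by gcongr
          _ = _ := by ring
      have h8 : ε * (3 * K ^ 2) ≤ ε * (3 * K ^ 5) := by
        have := hK5 2 (by norm_num)
        gcongr
      linarith
  have h4 : -(ε * y) ≤ ε * K ^ 5 := by
    have := hK5 1 (by norm_num)
    rw [← mul_neg]
    gcongr
    linarith [(abs_le.1 hy).1]
  have h5 : C * ((1 + q) * ε * m) ≤ ε * (2 * K ^ 5) := by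
    have h6 : (1 + q) * m ≤ 2 * K * K := by
      calc (1 + q) * m ≤ (1 + q) * K := by gcongr; exact (le_abs_self m).trans hm
        _ ≤ _ := by gcongr; linarith
    calc C * ((1 + q) * ε * m) = ε * (C * ((1 + q) * m)) := by ring
      _ ≤ ε * (C * (2 * K * K)) :=
        mul_le_mul_of_nonneg_left (mul_le_mul_of_nonneg_left h6 hC) hε
      _ ≤ ε * (K * (2 * K * K)) := by gcongr
      _ = ε * (2 * K ^ 3) := by ring
      _ ≤ _ := by
        have := hK5 3 (by norm_num)
        gcongr
  -- The errors 11K⁵ (from a), K⁵ (from y) and 2K⁵ (from m) add up to 14K⁵.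
  linarith

variable {n : ℕ} {Ω : Set (EuclideanSpace ℝ (Fin n))}

/-- At a boundary maximum of `w` with large area element, the normal derivative of `w` is less than
`(1 + q) C w`. -/
theorem boundary_max_normal_derivative_lt (hn : 2 ≤ n) (hΩ : IsBoundedC3Domain Ω)
    {N p X : EuclideanSpace ℝ (Fin n) → EuclideanSpace ℝ (Fin n)} (hN : ContDiff ℝ 2 N)
    (hN' : ∀ y ∈ frontier Ω, ∀ ν, IsOutwardNormal Ω y ν → N y = ν)
    {x ν ξ : EuclideanSpace ℝ (Fin n)} (hx : x ∈ frontier Ω) (hν : IsOutwardNormal Ω x ν)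
    {η q K C₀ C v w : ℝ} {φ : EuclideanSpace ℝ (Fin n) → ℝ} (hη : 0 < η) (hq : 0 < q)
    {S DX : EuclideanSpace ℝ (Fin n) →L[ℝ] EuclideanSpace ℝ (Fin n)}
    {Dφ : EuclideanSpace ℝ (Fin n) →L[ℝ] ℝ}
    (hp : HasFDerivWithinAt p S (closure Ω) x) (hX : HasFDerivWithinAt X DX (closure Ω) x)
    (hφ : HasFDerivWithinAt φ Dφ (closure Ω) x) (hXφ : X x = φ x • N x)
    (hS : ∀ a b, inner ℝ (S a) b = inner ℝ (S b) a)
    (hbc : ∀ y ∈ frontier Ω, inner ℝ (p y) (N y) = φ y * areaElem η (p y) ^ (1 - q))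
    (hmax : ∀ y ∈ closure Ω, gradQuantity η q (X y) (p y) ≤ gradQuantity η q (X x) (p x))
    (hv : v = areaElem η (p x)) (hw : w = gradQuantity η q (X x) (p x))
    (hξ : ξ = v ^ (q - 1) • p x - X x)
    (hK : 1 ≤ K) (hqK : q ≤ K) (hC₀ : 0 ≤ C₀) (hC₀' : curvatureConst Ω ≤ C₀) (hC₀K : C₀ ≤ K)
    (hCK : C ≤ K) (hφK : |φ x| ≤ K) (hDφ : ‖Dφ‖ ≤ K) (hDN : ‖fderiv ℝ N x‖ ≤ K)
    (hDX : ‖DX‖ ≤ K) (hεK : v ^ (-q) * (14 * K ^ 5) ≤ 1 / 2)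
    (hsmall : C₀ + v ^ (-q) * (14 * K ^ 5) < C) :
    inner ℝ ξ (S ν) - inner ℝ (DX ν) (p x) < (1 + q) * C * w := by
  have hv0 : 0 < v := hv ▸ areaElem_pos hη _
  set z := v ^ q with hz
  have hz0 : 0 < z := Real.rpow_pos_of_pos hv0 q
  obtain ⟨ε, hε⟩ : ∃ ε, ε = z⁻¹ := ⟨_, rfl⟩
  rw [Real.rpow_neg hv0.le, ← hz, ← hε] at hεK hsmall
  have hε0 : 0 < ε := hε ▸ inv_pos.2 hz0
  have hzε : z * ε = 1 := by rw [hε]; exact mul_inv_cancel₀ hz0.ne'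
  have hp1 : v ^ (q - 1) = z / v := by rw [Real.rpow_sub_one hv0.ne']
  have hp3 : v ^ (q - 3) = z / v ^ 3 := by
    rw [show q - 3 = q - (3:ℕ) by norm_num, Real.rpow_sub_natCast hv0.ne']
  obtain ⟨e, he⟩ : ∃ e, e = v⁻¹ • p x := ⟨_, rfl⟩
  have hpe : p x = v • e := by rw [he, smul_smul, mul_inv_cancel₀ hv0.ne', one_smul]
  have he1 : ‖e‖ ≤ 1 := by
    rw [he, norm_smul, norm_inv, Real.norm_eq_abs, abs_of_pos hv0, inv_mul_le_iff₀ hv0, mul_one, hv]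
    exact norm_le_areaElem η (p x)
  have hNx := hN' x hx ν hν
  have hν1 := hν.norm_eq_one
  rw [hNx] at hXφ
  -- The boundary condition divided by v: the unit-scale gradient is tangential up to order v^{-q}.
  have heν : inner ℝ e ν = φ x * ε := by
    have h1 := hbc x hx
    rw [hNx, ← hv, Real.rpow_sub hv0, Real.rpow_one, ← hz, hpe, inner_smul_left] at h1
    simp only [conj_trivial] at h1
    have h2 : v * inner ℝ e ν = v * (φ x * ε) := by rw [h1, hε]; ring
    exact mul_left_cancel₀ hv0.ne' h2
  obtain ⟨τ, hτ⟩ : ∃ τ, τ = e - (φ x * ε) • ν := ⟨_, rfl⟩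
  have hντ : inner ℝ ν τ = 0 := by
    rw [hτ, inner_sub_right, inner_smul_right, real_inner_self_eq_norm_sq, hν1, real_inner_comm, heν]
    ring
  have hτ1 : ‖τ‖ ≤ 1 := by
    have h1 : ‖e‖ ^ 2 = ‖τ‖ ^ 2 + (φ x * ε) ^ 2 := by
      have h2 : e = τ + (φ x * ε) • ν := by rw [hτ]; abel
      conv_lhs => rw [h2]
      rw [norm_add_sq_real, inner_smul_right, real_inner_comm, hντ, norm_smul, hν1,
        Real.norm_eq_abs, mul_one, sq_abs]
      ring
    refine (sq_le_one_iff₀ (norm_nonneg τ)).1 ?_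
    have := pow_le_one₀ (n := 2) (norm_nonneg e) he1
    linarith [sq_nonneg (φ x * ε)]
  -- The reason for subtracting ⟨φN, Du⟩ in w: the boundary condition makes ξ tangent to ∂Ω.
  have hξτ : ξ = z • τ := by
    rw [hξ, hp1, hpe, hXφ, hτ, smul_sub, smul_smul, smul_smul, div_mul_cancel₀ _ hv0.ne',
      show z * (φ x * ε) = φ x by linear_combination (φ x) * hzε]
  obtain ⟨γ, hγ0, hγ, hγmem⟩ := hν.exists_curve hΩ.isOpen hντ
  have hγcl : ∀ᶠ r in 𝓝 0, γ r ∈ closure Ω := hγmem.mono fun r hr => frontier_subset_closure hr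
  have hpγ := hp.comp_hasDerivAt_of_eventually_mem hγ hγ0 hγcl
  have hXγ := hX.comp_hasDerivAt_of_eventually_mem hγ hγ0 hγcl
  have hφγ := hφ.comp_hasDerivAt_of_eventually_mem hγ hγ0 hγcl
  have hNγ : HasDerivAt (fun r => N (γ r)) (fderiv ℝ N x τ) 0 :=
    ((hN.differentiable (by simp) x).hasFDerivAt.hasFDerivWithinAt
      (s := closure Ω)).comp_hasDerivAt_of_eventually_mem hγ hγ0 hγcl
  set DN := fderiv ℝ N x with hDNdef
  -- Maximality of w along a boundary curve in the direction τ determines the purely tangential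
  -- Hessian entry, which turns out to be O(ε) after division by v.
  have htan : inner ℝ ξ (S τ) - inner ℝ (DX τ) (p x) = 0 := by
    have h1 := hasDerivAt_gradQuantity hη hq hpγ hXγ
    rw [hγ0, ← hv, ← hξ] at h1
    refine IsLocalMax.hasDerivAt_eq_zero ?_ h1
    filter_upwards [hγcl] with r hr
    rw [hγ0]
    exact hmax _ hr
  obtain ⟨s, hs⟩ : ∃ s, s = inner ℝ τ (S τ) / v := ⟨_, rfl⟩
  have hsτ : inner ℝ τ (S τ) = v * s := by rw [hs]; field_simp
  have hs' : s = ε * inner ℝ (DX τ) e := by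
    rw [hξτ, hpe, inner_smul_left, inner_smul_right, hsτ] at htan
    simp only [conj_trivial] at htan
    have h1 : (z * v) * s = (z * v) * (ε * inner ℝ (DX τ) e) := by
      linear_combination htan - (v * inner ℝ (DX τ) e) * hzε
    exact mul_left_cancel₀ (mul_pos hz0 hv0).ne' h1
  -- In the form v^{q-1}⟨Du, N⟩ = φ the boundary condition is differentiated along the curve. This
  -- relates the mixed entry to the shape operator ⟨DN τ, τ⟩, which is bounded below by the
  -- curvature.
  have hbc' : HasDerivAt (fun r => areaElem η (p (γ r)) ^ (q - 1) * inner ℝ (p (γ r)) (N (γ r)))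
      (Dφ τ) 0 := by
    refine hφγ.congr_of_eventuallyEq ?_
    filter_upwards [hγmem] with r hr
    have h1 := areaElem_pos hη (p (γ r))
    rw [hbc _ hr, mul_left_comm, ← Real.rpow_add h1]
    simp
  obtain ⟨a, ha⟩ : ∃ a, a = inner ℝ (S τ) ν / v := ⟨_, rfl⟩
  have haτ : inner ℝ (S τ) ν = v * a := by rw [ha]; field_simp
  have hbd := hbc'.unique ((hasDerivAt_areaElem_rpow hη (q - 1) hpγ).mul (hpγ.inner ℝ hNγ))
  simp only [hγ0, ← hv, hNx] at hbd
  rw [show q - 1 - 2 = q - 3 by ring, hp3, hp1, haτ] at hbd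
  have hpS : inner ℝ (p x) (S τ) = v ^ 2 * (s + φ x * ε * a) := by
    have h1 : e = τ + (φ x * ε) • ν := by rw [hτ]; abel
    rw [hpe, h1, inner_smul_left, inner_add_left, inner_smul_left, hsτ, real_inner_comm, haτ]
    simp only [conj_trivial]
    ring
  have hpν : inner ℝ (p x) ν = v * (φ x * ε) := by rw [hpe, inner_smul_left, heν]; simp
  have hpDN : inner ℝ (p x) (DN τ) = v * (inner ℝ (DN τ) τ + φ x * ε * inner ℝ ν (DN τ)) := by
    have h1 : e = τ + (φ x * ε) • ν := by rw [hτ]; abel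
    rw [hpe, h1, inner_smul_left, inner_add_left, inner_smul_left, real_inner_comm]
    simp only [conj_trivial]
  have hshape := hΩ.shape_operator_ge hn hN hN' hx hν hντ
  rw [← hDNdef] at hshape
  rw [hpS, hpν, hpDN] at hbd
  have hbd' : Dφ τ = (q - 1) * φ x * (s + φ x * ε * a)
      + z * (a + (inner ℝ (DN τ) τ + φ x * ε * inner ℝ ν (DN τ))) := by
    rw [hbd]
    field_simp
    linear_combination ((q - 1) * φ x * (s + φ x * ε * a)) * hzε
  have hcurv : -inner ℝ (DN τ) τ ≤ C₀ := by
    have h1 : ‖τ‖ ^ 2 ≤ 1 := pow_le_one₀ (norm_nonneg τ) hτ1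
    have h2 : curvatureConst Ω * ‖τ‖ ^ 2 ≤ C₀ * ‖τ‖ ^ 2 := by gcongr
    have h3 : C₀ * ‖τ‖ ^ 2 ≤ C₀ * 1 := by gcongr
    linarith
  have opb : ∀ {F : Type} [NormedAddCommGroup F] [NormedSpace ℝ F]
      (T : EuclideanSpace ℝ (Fin n) →L[ℝ] F) {y : EuclideanSpace ℝ (Fin n)}, ‖T‖ ≤ K → ‖y‖ ≤ 1 →
      ‖T y‖ ≤ K := fun T y hT hy => (T.le_opNorm y).trans
    ((mul_le_of_le_one_right (norm_nonneg T) hy).trans hT)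
  have inb : ∀ {y y' : EuclideanSpace ℝ (Fin n)}, ‖y‖ ≤ K → ‖y'‖ ≤ 1 → |inner ℝ y y'| ≤ K :=
    fun hy hy' => (abs_real_inner_le_norm _ _).trans
      ((mul_le_of_le_one_right (norm_nonneg _) hy').trans hy)
  have hC0 : 0 ≤ C := by
    have : 0 ≤ ε * (14 * K ^ 5) := by positivity
    linarith
  have hsb : |s| ≤ 1 := by
    rw [hs', abs_mul, abs_of_pos hε0]
    have h1 := inb (opb DX hDX hτ1) he1
    have h2 : K ≤ 14 * K ^ 5 := by
      have : K ≤ K ^ 5 := le_self_pow₀ hK (by norm_num)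
      linarith
    calc ε * |inner ℝ (DX τ) e| ≤ ε * (14 * K ^ 5) := by gcongr; exact h1.trans h2
      _ ≤ 1 := by linarith
  have hmain := boundary_algebra (a := a) (s := s) (κ := 1 + (q - 1) * φ x ^ 2 * ε ^ 2) (φ := φ x)
    (x := Dφ τ - φ x * inner ℝ ν (DN τ)) (y := inner ℝ (DX ν) e) (m := inner ℝ (X x) e)
    hK hq hqK hε0.le hC₀ hC₀K hCK hC0 hεK hsmall hφK hsb rfl ?_ (inb (opb DX hDX hν1.le) he1) ?_ ?_
  · have h1 : inner ℝ ξ (S ν) - inner ℝ (DX ν) (p x) = z * v * (a - ε * inner ℝ (DX ν) e) := by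
      rw [hξτ, hpe, inner_smul_left, inner_smul_right, real_inner_comm, hS, haτ]
      simp only [conj_trivial]
      linear_combination (v * inner ℝ (DX ν) e) * hzε
    have h2 : (1 + q) * C * w = z * v * (C * (1 - (1 + q) * ε * inner ℝ (X x) e)) := by
      rw [hw, gradQuantity, ← hv, Real.rpow_add_one hv0.ne', ← hz, hpe, inner_smul_right]
      have h3 : (1 + q) * (z * v / (q + 1)) = z * v := by
        have : q + 1 ≠ 0 := by linarith
        field_simp
        ring
      linear_combination C * h3 + ((1 + q) * C * v * inner ℝ (X x) e) * hzε
    rw [h1, h2]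
    exact mul_lt_mul_of_pos_left hmain (mul_pos hz0 hv0)
  · have h1 : |Dφ τ| ≤ K := opb Dφ hDφ hτ1
    have h2 : |φ x * inner ℝ ν (DN τ)| ≤ K * K := by
      rw [abs_mul, real_inner_comm]
      gcongr
      exact inb (opb DN hDN hτ1) hν1.le
    have h3 : K ≤ K ^ 2 := le_self_pow₀ hK two_ne_zero
    calc _ ≤ |Dφ τ| + |φ x * inner ℝ ν (DN τ)| := abs_sub _ _
      _ ≤ _ := by linarith
  · refine inb ?_ he1
    rw [hXφ, norm_smul, hν1, mul_one]
    exact hφK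
  · have h1 : a * (1 + (q - 1) * φ x ^ 2 * ε ^ 2) = -inner ℝ (DN τ) τ +
        ε * (Dφ τ - φ x * inner ℝ ν (DN τ) - (q - 1) * φ x * s) := by
      rw [hbd']
      linear_combination (-(a + inner ℝ (DN τ) τ + φ x * ε * inner ℝ ν (DN τ))) * hzε
    rw [h1]
    linarith

end BoundaryEstimate

/-! ### Regularity up to the boundary and the nondivergence form -/

section Regularity

theorem ParabolicHolderOnCompacts.continuousOn {X Y : Type*} [NormedAddCommGroup X]
    [NormedAddCommGroup Y] {σ : ℝ} (hσ : 0 < σ) {F : X → ℝ → Y} {S K : Set (X × ℝ)}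
    (h : ParabolicHolderOnCompacts σ F S) (hKS : K ⊆ S) (hK : IsCompact K) :
    ContinuousOn (fun p : X × ℝ => F p.1 p.2) K := by
  obtain ⟨C, hC⟩ := h K hKS hK
  intro p₀ hp₀
  rw [ContinuousWithinAt, tendsto_iff_norm_sub_tendsto_zero]
  have hcont : Continuous fun p : X × ℝ =>
      C * (‖p.1 - p₀.1‖ ^ σ + |p.2 - p₀.2| ^ (σ / 2)) := by
    refine continuous_const.mul (Continuous.add ?_ ?_)
    · exact (continuous_norm.comp (continuous_fst.sub continuous_const)).rpow_const
        fun _ => Or.inr hσ.le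
    · exact (continuous_abs.comp (continuous_snd.sub continuous_const)).rpow_const
        fun _ => Or.inr (by positivity)
  have hlim := (hcont.tendsto p₀).mono_left (nhdsWithin_le_nhds (s := K))
  simp only [sub_self, norm_zero, abs_zero, Real.zero_rpow hσ.ne',
    Real.zero_rpow (by positivity : σ / 2 ≠ 0), add_zero, mul_zero] at hlim
  refine squeeze_zero' (Eventually.of_forall fun _ => norm_nonneg _) ?_ hlim
  filter_upwards [self_mem_nhdsWithin] with p hp
  exact hC p hp p₀ hp₀

variable {n : ℕ} {Ω : Set (EuclideanSpace ℝ (Fin n))}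

theorem inner_gradientWithin {E : Type*} [NormedAddCommGroup E] [InnerProductSpace ℝ E]
    [CompleteSpace E] (f : E → ℝ) (s : Set E) (x d : E) :
    inner ℝ (gradientWithin f s x) d = fderivWithin ℝ f s x d := by
  simp [gradientWithin]

theorem innerSL_gradientWithin {E : Type*} [NormedAddCommGroup E] [InnerProductSpace ℝ E]
    [CompleteSpace E] (f : E → ℝ) (s : Set E) (x : E) :
    innerSL ℝ (gradientWithin f s x) = fderivWithin ℝ f s x := by
  ext d
  rw [innerSL_apply_apply, inner_gradientWithin]

theorem ContDiffOn.gradientWithin_right {E : Type*} [NormedAddCommGroup E] [InnerProductSpace ℝ E]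
    [CompleteSpace E] {f : E → ℝ} {s : Set E} {m k : WithTop ℕ∞} (h : ContDiffOn ℝ k f s)
    (hs : UniqueDiffOn ℝ s) (hmk : m + 1 ≤ k) : ContDiffOn ℝ m (fun x => gradientWithin f s x) s :=
  (InnerProductSpace.toDual ℝ E).symm.toContinuousLinearEquiv.contDiff.comp_contDiffOn
    (h.fderivWithin hs hmk)

theorem gradientWithin_eq_gradient {E : Type*} [NormedAddCommGroup E] [InnerProductSpace ℝ E]
    [CompleteSpace E] (f : E → ℝ) {s : Set E} {x : E} (hs : s ∈ 𝓝 x) :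
    gradientWithin f s x = gradient f x := by
  rw [gradientWithin, gradient, fderivWithin_of_mem_nhds hs]

theorem inner_fderivWithin_gradientWithin {E : Type*} [NormedAddCommGroup E]
    [InnerProductSpace ℝ E] [CompleteSpace E] {f : E → ℝ} {s : Set E} (h : ContDiffOn ℝ 2 f s)
    (hs : UniqueDiffOn ℝ s) {x : E} (hx : x ∈ s) (a b : E) :
    inner ℝ (fderivWithin ℝ (fun y => gradientWithin f s y) s x a) b =
      iteratedFDerivWithin ℝ 2 f s x ![a, b] := by
  rw [iteratedFDerivWithin_two_apply f hs hx]
  have h1 : DifferentiableWithinAt ℝ (fderivWithin ℝ f s) s x :=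
    ((h.fderivWithin (m := 1) hs (by norm_num)).differentiableOn (by simp)) x hx
  have h2 := (InnerProductSpace.toDual ℝ E).symm.toContinuousLinearEquiv.comp_fderivWithin
    (f := fderivWithin ℝ f s) (hs x hx)
  have h3 : (fun y => gradientWithin f s y) =
      (InnerProductSpace.toDual ℝ E).symm.toContinuousLinearEquiv ∘ fderivWithin ℝ f s := rfl
  rw [h3, h2]
  simp

/-- Symmetry persists at boundary points because they are limits of interior ones. It is what allows
the mixed entry to be read both as ⟨S ν, τ⟩ and as ⟨S τ, ν⟩. -/
theorem inner_fderivWithin_gradientWithin_symm {E : Type*} [NormedAddCommGroup E]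
    [InnerProductSpace ℝ E] [CompleteSpace E] {f : E → ℝ} {s : Set E} (h : ContDiffOn ℝ 2 f s)
    (hs : UniqueDiffOn ℝ s) (hs' : s ⊆ closure (interior s)) {x : E} (hx : x ∈ s) (a b : E) :
    inner ℝ (fderivWithin ℝ (fun y => gradientWithin f s y) s x a) b =
      inner ℝ (fderivWithin ℝ (fun y => gradientWithin f s y) s x b) a := by
  rw [inner_fderivWithin_gradientWithin h hs hx, inner_fderivWithin_gradientWithin h hs hx,
    iteratedFDerivWithin_two_apply f hs hx, iteratedFDerivWithin_two_apply f hs hx]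
  have := (h x hx).isSymmSndFDerivWithinAt (by simp) hs (hs' hx) hx
  simpa using this.eq a b

variable {σ T : ℝ} {u : EuclideanSpace ℝ (Fin n) → ℝ → ℝ}

theorem IsBoundedC3Domain.isCompact_cylinder (hΩ : IsBoundedC3Domain Ω) (T : ℝ) :
    IsCompact (closure Ω ×ˢ Icc 0 T) := hΩ.isCompact_closure.prod isCompact_Icc

theorem IsParabolicCkHolder.continuousOn (hΩ : IsBoundedC3Domain Ω) (hσ : 0 < σ)
    (hu : IsParabolicCkHolder 2 σ (closure Ω) (Icc 0 T) u) :
    ContinuousOn (fun p : EuclideanSpace ℝ (Fin n) × ℝ => u p.1 p.2) (closure Ω ×ˢ Icc 0 T) := by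
  have h := (hu.holder_space 0 (by norm_num)).continuousOn hσ Subset.rfl (hΩ.isCompact_cylinder T)
  have h2 := (ContinuousMultilinearMap.apply ℝ (fun _ : Fin 0 => EuclideanSpace ℝ (Fin n)) ℝ
    0).continuous.comp_continuousOn h
  exact h2.congr fun p hp => by simp

theorem IsParabolicCkHolder.continuousOn_timeDeriv (hΩ : IsBoundedC3Domain Ω) (hσ : 0 < σ)
    (hu : IsParabolicCkHolder 2 σ (closure Ω) (Icc 0 T) u) :
    ContinuousOn (fun p : EuclideanSpace ℝ (Fin n) × ℝ => derivWithin (u p.1) (Icc 0 T) p.2)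
      (closure Ω ×ˢ Icc 0 T) := by
  have h := (hu.holder_time_space 0 (by norm_num)).continuousOn hσ Subset.rfl
    (hΩ.isCompact_cylinder T)
  have h2 := (ContinuousMultilinearMap.apply ℝ (fun _ : Fin 0 => EuclideanSpace ℝ (Fin n)) ℝ
    0).continuous.comp_continuousOn h
  exact h2.congr fun p hp => by simp

theorem continuousOn_of_inner {Z : Type*} [TopologicalSpace Z] {F : Z → EuclideanSpace ℝ (Fin n)}
    {K : Set Z} (h : ∀ d, ContinuousOn (fun z => inner ℝ (F z) d) K) : ContinuousOn F K := by
  have h1 : ContinuousOn (fun z => WithLp.ofLp (F z)) K := by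
    refine continuousOn_pi.2 fun i => (h (EuclideanSpace.single i 1)).congr fun z hz => ?_
    simp [EuclideanSpace.inner_single_right]
  exact (PiLp.continuous_toLp 2 _).comp_continuousOn h1

theorem IsParabolicCkHolder.continuousOn_spaceGrad (hΩ : IsBoundedC3Domain Ω) (hσ : 0 < σ)
    (hu : IsParabolicCkHolder 2 σ (closure Ω) (Icc 0 T) u) :
    ContinuousOn (fun p : EuclideanSpace ℝ (Fin n) × ℝ => spaceGrad Ω u p.1 p.2)
      (closure Ω ×ˢ Icc 0 T) := by
  have h := (hu.holder_space 1 (by norm_num)).continuousOn hσ Subset.rfl (hΩ.isCompact_cylinder T)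
  refine continuousOn_of_inner fun d => ?_
  have h2 := (ContinuousMultilinearMap.apply ℝ (fun _ : Fin 1 => EuclideanSpace ℝ (Fin n)) ℝ
    (fun _ => d)).continuous.comp_continuousOn h
  refine h2.congr fun p hp => ?_
  simp only [Function.comp_apply, ContinuousMultilinearMap.apply_apply]
  rw [spaceGrad, inner_gradientWithin,
    iteratedFDerivWithin_one_apply (hΩ.uniqueDiffOn_closure p.1 hp.1)]

theorem IsParabolicCkHolder.continuousOn_hessian (hΩ : IsBoundedC3Domain Ω) (hσ : 0 < σ)
    (hu : IsParabolicCkHolder 2 σ (closure Ω) (Icc 0 T) u) :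
    ContinuousOn (fun p : EuclideanSpace ℝ (Fin n) × ℝ =>
      iteratedFDerivWithin ℝ 2 (fun y => u y p.2) (closure Ω) p.1) (closure Ω ×ˢ Icc 0 T) :=
  (hu.holder_space 2 le_rfl).continuousOn hσ Subset.rfl (hΩ.isCompact_cylinder T)

theorem closure_mem_nhds (hΩ : IsOpen Ω) {x : EuclideanSpace ℝ (Fin n)} (hx : x ∈ Ω) :
    closure Ω ∈ 𝓝 x := mem_of_superset (hΩ.mem_nhds hx) subset_closure

theorem spaceGrad_eventuallyEq (hΩ : IsOpen Ω) {x : EuclideanSpace ℝ (Fin n)} (hx : x ∈ Ω)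
    (F : EuclideanSpace ℝ (Fin n) → ℝ → ℝ) (t : ℝ) :
    (fun y => spaceGrad Ω F y t) =ᶠ[𝓝 x] gradient (fun y => F y t) := by
  filter_upwards [hΩ.mem_nhds hx] with y hy
  exact gradientWithin_eq_gradient _ (closure_mem_nhds hΩ hy)

theorem hasFDerivAt_innerSL_gradient {E : Type*} [NormedAddCommGroup E] [InnerProductSpace ℝ E]
    [CompleteSpace E] {f : E → ℝ} {x : E} (h : DifferentiableAt ℝ f x) :
    HasFDerivAt f (innerSL ℝ (gradient f x)) x := by
  have h1 : innerSL ℝ (gradient f x) = fderiv ℝ f x := by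
    ext d
    rw [innerSL_apply_apply, inner_gradient]
  rw [h1]
  exact h.hasFDerivAt

theorem hasFDerivAt_spaceGrad (hΩ : IsOpen Ω) {x : EuclideanSpace ℝ (Fin n)} (hx : x ∈ Ω)
    {F : EuclideanSpace ℝ (Fin n) → ℝ → ℝ} {t : ℝ} (h : DifferentiableAt ℝ (fun y => F y t) x) :
    HasFDerivAt (fun y => F y t) (innerSL ℝ (spaceGrad Ω F x t)) x := by
  rw [(spaceGrad_eventuallyEq hΩ hx F t).eq_of_nhds]
  exact hasFDerivAt_innerSL_gradient h

theorem contDiffAt_spaceGrad (hΩ : IsOpen Ω) {x : EuclideanSpace ℝ (Fin n)} (hx : x ∈ Ω)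
    {F : EuclideanSpace ℝ (Fin n) → ℝ → ℝ} {t : ℝ} {m k : WithTop ℕ∞}
    (h : ContDiffAt ℝ k (fun y => F y t) x) (hmk : m + 1 ≤ k) :
    ContDiffAt ℝ m (fun y => spaceGrad Ω F y t) x :=
  (contDiffAt_gradient_of_contDiffAt h hmk).congr_of_eventuallyEq (spaceGrad_eventuallyEq hΩ hx F t)

theorem fderiv_spaceGrad_eq_fderivWithin (hΩ : IsOpen Ω) {x : EuclideanSpace ℝ (Fin n)}
    (hx : x ∈ Ω) (F : EuclideanSpace ℝ (Fin n) → ℝ → ℝ) (t : ℝ) :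
    fderiv ℝ (fun y => spaceGrad Ω F y t) x =
      fderivWithin ℝ (fun y => spaceGrad Ω F y t) (closure Ω) x :=
  (fderivWithin_of_mem_nhds (closure_mem_nhds hΩ hx)).symm

/-- The equation in nondivergence form. -/
theorem areaFactor_mul_divergence {η : ℝ} (hη : 0 < η) {x : EuclideanSpace ℝ (Fin n)} {t : ℝ}
    (h : DifferentiableAt ℝ (fun y => spaceGrad Ω u y t) x) (a b : ℝ) :
    areaFactor Ω η u x t *
        divergence (fun y => (areaFactor Ω η u y t)⁻¹ • spaceGrad Ω u y t) x
      + a * areaFactor Ω η u x t - b =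
    flowOperator η (spaceGrad Ω u x t) (fderiv ℝ (fun y => spaceGrad Ω u y t) x) a b := by
  set p := fun y => spaceGrad Ω u y t with hp
  have hv : ∀ y, areaFactor Ω η u y t = areaElem η (p y) := fun y => rfl
  have hv0 := areaElem_pos hη (p x)
  have hpx : spaceGrad Ω u x t = p x := rfl
  have hdiv : divergence (fun y => (areaElem η (p y))⁻¹ • p y) x =
      (areaElem η (p x))⁻¹ * (∑ i, (fderiv ℝ p x (EuclideanSpace.single i 1)) i
        - inner ℝ (fderiv ℝ p x (p x)) (p x) / areaElem η (p x) ^ 2) := by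
    have hvd : DifferentiableAt ℝ (fun y => (areaElem η (p y))⁻¹) x := by
      refine DifferentiableAt.inv ?_ hv0.ne'
      unfold areaElem
      refine DifferentiableAt.sqrt ?_ (by positivity)
      exact (h.norm_sq ℝ).const_add _
    have hvd' : ∀ d, fderiv ℝ (fun y => (areaElem η (p y))⁻¹) x d =
        -inner ℝ (p x) (fderiv ℝ p x d) / areaElem η (p x) ^ 3 := by
      intro d
      have h1 := hvd.hasFDerivAt.hasDerivAt_line_zero d
      have h2 := (hasDerivAt_areaElem hη (h.hasFDerivAt.hasDerivAt_line_zero d)).inv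
        (areaElem_pos hη _).ne'
      rw [h1.unique h2]
      simp only [zero_smul, add_zero]
      field_simp
    have hfd : ∀ d, fderiv ℝ (fun y => (areaElem η (p y))⁻¹ • p y) x d =
        (areaElem η (p x))⁻¹ • fderiv ℝ p x d +
          (-inner ℝ (p x) (fderiv ℝ p x d) / areaElem η (p x) ^ 3) • p x := by
      intro d
      rw [fderiv_fun_smul hvd h]
      simp [hvd']
    rw [divergence]
    simp only [hfd, PiLp.add_apply, PiLp.smul_apply, smul_eq_mul, Finset.sum_add_distrib,
      ← Finset.mul_sum]
    have hs : ∑ i, -inner ℝ (p x) (fderiv ℝ p x (EuclideanSpace.single i 1))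
        / areaElem η (p x) ^ 3 * (p x) i =
        -inner ℝ (fderiv ℝ p x (p x)) (p x) / areaElem η (p x) ^ 3 := by
      conv_rhs => rw [← sum_coord_smul_single (p x)]
      rw [map_sum, sum_coord_smul_single, sum_inner, ← Finset.sum_neg_distrib, Finset.sum_div]
      refine Finset.sum_congr rfl fun i _ => ?_
      rw [map_smul, inner_smul_left, real_inner_comm]
      simp only [conj_trivial]
      ring
    rw [hs]
    field_simp
    ring
  simp only [hv]
  rw [hpx, hdiv, flowOperator]
  field_simp

end Regularity

/-! ### Exchange of space and time derivatives -/

section TimeDerivative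

variable {n : ℕ} {Ω : Set (EuclideanSpace ℝ (Fin n))} {σ T : ℝ}
  {u : EuclideanSpace ℝ (Fin n) → ℝ → ℝ}

theorem hasDerivAt_euclidean_of_inner {F : ℝ → EuclideanSpace ℝ (Fin n)}
    {g : EuclideanSpace ℝ (Fin n)} {t : ℝ}
    (h : ∀ d, HasDerivAt (fun s => inner ℝ (F s) d) (inner ℝ g d) t) : HasDerivAt F g t := by
  rw [hasDerivAt_iff_hasFDerivAt, ← hasFDerivWithinAt_univ, hasFDerivWithinAt_euclidean]
  intro i
  have := h (EuclideanSpace.single i 1)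
  simp only [EuclideanSpace.inner_single_right, one_mul, conj_trivial] at this
  refine (this.hasFDerivAt.congr_fderiv ?_).hasFDerivWithinAt
  ext
  simp

/-- The class provides D_x u_t but does not assert that Du is differentiable in time. Spatial
difference quotients of u converge to ⟨Du, d⟩, and by uniform continuity of D_x u_t their time
derivatives converge uniformly near t₁, which permits the exchange. -/
theorem IsParabolicCkHolder.hasDerivAt_inner_spaceGrad (hΩ : IsOpen Ω) (hσ : 0 < σ)
    (hu : IsParabolicCkHolder 3 σ Ω (Ioc 0 T) u) {x : EuclideanSpace ℝ (Fin n)} (hx : x ∈ Ω)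
    {t₁ : ℝ} (ht : t₁ ∈ Ioo 0 T) (d : EuclideanSpace ℝ (Fin n)) :
    HasDerivAt (fun t => inner ℝ (spaceGrad Ω u x t) d)
      (fderiv ℝ (fun y => deriv (u y) t₁) x d) t₁ := by
  obtain ⟨a, ha0, hat⟩ := exists_between ht.1
  obtain ⟨b, hbt, hbT⟩ := exists_between ht.2
  obtain ⟨r, hr, hball⟩ := Metric.nhds_basis_closedBall.mem_iff.1 (hΩ.mem_nhds hx)
  have hIoo : ∀ t ∈ Icc a b, t ∈ Ioc 0 T := fun t h => ⟨by linarith [h.1], by linarith [h.2]⟩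
  have hder : ∀ t ∈ Icc a b, ∀ y, derivWithin (u y) (Ioc 0 T) t = deriv (u y) t := fun t h y =>
    derivWithin_of_mem_nhds (Ioc_mem_nhds (by linarith [h.1]) (by linarith [h.2]))
  have hdt : ∀ t ∈ Icc a b, ∀ y ∈ Ω, HasDerivAt (u y) (deriv (u y) t) t := fun t h y hy =>
    ((hu.differentiableOn_time y hy).differentiableAt
      (Ioc_mem_nhds (by linarith [h.1]) (by linarith [h.2]))).hasDerivAt
  have hdw : ∀ t ∈ Icc a b, ∀ y ∈ Ω, DifferentiableAt ℝ (fun y => deriv (u y) t) y := by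
    intro t h y hy
    have h1 := (hu.contDiffOn_time_space 1 (by norm_num) t (hIoo t h)).differentiableOn (by simp)
    simp only [hder t h] at h1
    exact h1.differentiableAt (hΩ.mem_nhds hy)
  have hcont : ContinuousOn (fun p : EuclideanSpace ℝ (Fin n) × ℝ =>
      fderiv ℝ (fun y => deriv (u y) p.2) p.1 d) (Metric.closedBall x r ×ˢ Icc a b) := by
    have h := (hu.holder_time_space 1 (by norm_num)).continuousOn hσ
      (K := Metric.closedBall x r ×ˢ Icc a b)
      (prod_mono hball hIoo) ((isCompact_closedBall x r).prod isCompact_Icc)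
    have h2 := (ContinuousMultilinearMap.apply ℝ (fun _ : Fin 1 => EuclideanSpace ℝ (Fin n)) ℝ
      (fun _ => d)).continuous.comp_continuousOn h
    refine h2.congr fun p hp => ?_
    simp only [Function.comp_apply, ContinuousMultilinearMap.apply_apply]
    rw [iteratedFDerivWithin_one_apply (hΩ.uniqueDiffOn p.1 (hball hp.1)),
      fderivWithin_of_mem_nhds (hΩ.mem_nhds (hball hp.1))]
    simp only [hder p.2 hp.2]
  have huc := ((isCompact_closedBall x r).prod isCompact_Icc).uniformContinuousOn_of_continuous
    hcont
  rw [Metric.uniformContinuousOn_iff] at huc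
  refine hasDerivAt_of_tendstoUniformlyOn (l := 𝓝[≠] (0:ℝ)) (s := Ioo a b) isOpen_Ioo
    (f := fun s t => s⁻¹ * (u (x + s • d) t - u x t))
    (f' := fun s t => s⁻¹ * (deriv (u (x + s • d)) t - deriv (u x) t))
    (g' := fun t => fderiv ℝ (fun y => deriv (u y) t) x d) ?_ ?_ ?_ ⟨hat, hbt⟩
  · rw [Metric.tendstoUniformlyOn_iff]
    intro ε hε
    obtain ⟨ρ, hρ, hρε⟩ := huc (ε / 2) (by positivity)
    have hlim : ∀ᶠ s in 𝓝 (0:ℝ), x + s • d ∈ Metric.ball x (min r ρ) :=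
      (tendsto_line x d).eventually (Metric.ball_mem_nhds x (by positivity))
    filter_upwards [nhdsWithin_le_nhds hlim, self_mem_nhdsWithin] with s hs hs0 t ht
    have hs0 : s ≠ 0 := hs0
    have htI : t ∈ Icc a b := ⟨ht.1.le, ht.2.le⟩
    have hseg : ∀ τ ∈ uIcc 0 s, x + τ • d ∈ Metric.ball x (min r ρ) := by
      intro τ hτ
      rw [mem_ball_iff_norm, add_sub_cancel_left, norm_smul] at hs ⊢
      refine lt_of_le_of_lt (mul_le_mul_of_nonneg_right ?_ (norm_nonneg d)) hs
      simpa using abs_sub_left_of_mem_uIcc hτ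
    have hmv := Convex.norm_image_sub_le_of_norm_hasDerivWithin_le (s := uIcc (0:ℝ) s)
      (f := fun τ : ℝ => deriv (u (x + τ • d)) t - τ * fderiv ℝ (fun y => deriv (u y) t) x d)
      (f' := fun τ : ℝ => fderiv ℝ (fun y => deriv (u y) t) (x + τ • d) d
        - fderiv ℝ (fun y => deriv (u y) t) x d) (C := ε / 2) (x := 0) (y := s) ?_ ?_ (convex_uIcc 0 s)
      left_mem_uIcc right_mem_uIcc
    · simp only [zero_smul, add_zero, zero_mul, sub_zero] at hmv
      rw [Real.dist_eq, abs_sub_comm]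
      have h1 : s⁻¹ * (deriv (u (x + s • d)) t - deriv (u x) t)
          - fderiv ℝ (fun y => deriv (u y) t) x d = s⁻¹ * (deriv (u (x + s • d)) t
            - s * fderiv ℝ (fun y => deriv (u y) t) x d - deriv (u x) t) := by
        field_simp
        ring
      rw [h1, abs_mul, abs_inv]
      rw [Real.norm_eq_abs, Real.norm_eq_abs] at hmv
      have hspos := abs_pos.2 hs0
      calc |s|⁻¹ * _ ≤ |s|⁻¹ * (ε / 2 * |s|) := by gcongr
        _ = ε / 2 := by field_simp
        _ < ε := by linarith
    · intro τ hτ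
      have hy := Metric.ball_subset_ball (min_le_left r ρ) (hseg τ hτ)
      have h1 := (hdw t htI _ (hball (Metric.ball_subset_closedBall hy))).hasFDerivAt.comp_hasDerivAt
        τ (hasDerivAt_line x d τ)
      have h2 := h1.sub ((hasDerivAt_id τ).mul_const (fderiv ℝ (fun y => deriv (u y) t) x d))
      refine (h2.congr_deriv ?_).hasDerivWithinAt
      simp
    · intro τ hτ
      have hy := hseg τ hτ
      have hy1 := Metric.ball_subset_closedBall (Metric.ball_subset_ball (min_le_left r ρ) hy)
      have hy2 := Metric.ball_subset_ball (min_le_right r ρ) hy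
      have := hρε (x + τ • d, t) ⟨hy1, htI⟩ (x, t) ⟨Metric.mem_closedBall_self hr.le, htI⟩ (by
        rw [Prod.dist_eq]
        simpa using hy2)
      rw [Real.dist_eq] at this
      exact this.le
  · have hlim : ∀ᶠ s in 𝓝 (0:ℝ), x + s • d ∈ Ω :=
      (tendsto_line x d).eventually (hΩ.mem_nhds hx)
    filter_upwards [nhdsWithin_le_nhds hlim] with s hs t ht
    have htI : t ∈ Icc a b := ⟨ht.1.le, ht.2.le⟩
    exact ((hdt t htI _ hs).sub (hdt t htI x hx)).const_mul _
  · intro t ht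
    have htI : t ∈ Icc a b := ⟨ht.1.le, ht.2.le⟩
    have h1 : DifferentiableAt ℝ (fun y => u y t) x :=
      ((hu.contDiffOn_space t (hIoo t htI)).differentiableOn (by simp)).differentiableAt
        (hΩ.mem_nhds hx)
    have h2 := (hasFDerivAt_spaceGrad hΩ hx h1).hasDerivAt_line_zero d
    rw [hasDerivAt_iff_tendsto_slope_zero] at h2
    simpa using h2

theorem IsParabolicCkHolder.exists_hasDerivAt_spaceGrad (hΩ : IsOpen Ω) (hσ : 0 < σ)
    (hu : IsParabolicCkHolder 3 σ Ω (Ioc 0 T) u) {x : EuclideanSpace ℝ (Fin n)} (hx : x ∈ Ω)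
    {t₁ : ℝ} (ht : t₁ ∈ Ioo 0 T) :
    ∃ g, HasDerivAt (fun t => spaceGrad Ω u x t) g t₁ ∧
      HasFDerivAt (fun y => deriv (u y) t₁) (innerSL ℝ g) x := by
  refine ⟨gradient (fun y => deriv (u y) t₁) x, hasDerivAt_euclidean_of_inner fun d => ?_, ?_⟩
  · rw [inner_gradient]
    exact hu.hasDerivAt_inner_spaceGrad hΩ hσ hx ht d
  · refine hasFDerivAt_innerSL_gradient ?_
    have h1 := (hu.contDiffOn_time_space 1 (by norm_num) t₁ ⟨ht.1, ht.2.le⟩).differentiableOn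
      (by simp)
    have hder : ∀ y, derivWithin (u y) (Ioc 0 T) t₁ = deriv (u y) t₁ := fun y =>
      derivWithin_of_mem_nhds (Ioc_mem_nhds ht.1 ht.2)
    simp only [hder] at h1
    exact h1.differentiableAt (hΩ.mem_nhds hx)

theorem eventually_inner_fderiv_spaceGrad_symm (hΩ : IsOpen Ω) {F : EuclideanSpace ℝ (Fin n) → ℝ → ℝ}
    {t : ℝ} (h : ContDiffOn ℝ 2 (fun y => F y t) Ω) {x : EuclideanSpace ℝ (Fin n)} (hx : x ∈ Ω) :
    ∀ᶠ z in 𝓝 x, ∀ a b, inner ℝ (fderiv ℝ (fun y => spaceGrad Ω F y t) z a) b =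
      inner ℝ (fderiv ℝ (fun y => spaceGrad Ω F y t) z b) a := by
  filter_upwards [hΩ.mem_nhds hx] with z hz a b
  have h1 : (fun y => gradientWithin (fun y => F y t) Ω y) =ᶠ[𝓝 z] fun y => spaceGrad Ω F y t := by
    filter_upwards [hΩ.mem_nhds hz, spaceGrad_eventuallyEq hΩ hz F t] with y hy hy2
    rw [hy2, gradientWithin_eq_gradient _ (hΩ.mem_nhds hy)]
  have h2 := inner_fderivWithin_gradientWithin_symm h hΩ.uniqueDiffOn
    (by rw [hΩ.interior_eq]; exact subset_closure) hz a b
  rwa [fderivWithin_of_mem_nhds (hΩ.mem_nhds hz), h1.fderiv_eq] at h2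

end TimeDerivative

/-! ### From a boundary maximum to an interior maximum -/

section Maximum

theorem HasDerivAt.nonneg_of_forall_le {F : ℝ → ℝ} {F' t : ℝ} (hF : HasDerivAt F F' t)
    (ht : 0 < t) (hmax : ∀ s ∈ Icc 0 t, F s ≤ F t) : 0 ≤ F' := by
  have h : Tendsto (slope F t) (𝓝[<] t) (𝓝 F') :=
    (hasDerivWithinAt_iff_tendsto_slope' (s := Iio t) (by simp)).1 hF.hasDerivWithinAt
  refine ge_of_tendsto h ?_
  filter_upwards [Ioo_mem_nhdsLT ht] with s hs
  rw [slope_def_field]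
  exact div_nonneg_of_nonpos (by linarith [hmax s ⟨hs.1.le, hs.2.le⟩]) (by linarith [hs.2])

theorem exists_gt_of_hasDerivWithinAt_pos {F : ℝ → ℝ} {F' r : ℝ}
    (hF : HasDerivWithinAt F F' (Ici 0) 0) (hF' : 0 < F') (hr : 0 < r) :
    ∃ s ∈ Ioo 0 r, F 0 < F s := by
  have h : Tendsto (slope F 0) (𝓝[>] 0) (𝓝 F') :=
    (hasDerivWithinAt_iff_tendsto_slope' (s := Ioi 0) (by simp)).1 (hF.mono Ioi_subset_Ici_self)
  obtain ⟨s, hs, hs'⟩ := ((h.eventually (lt_mem_nhds hF')).and (Ioo_mem_nhdsGT hr)).exists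
  refine ⟨s, hs', ?_⟩
  rw [slope_def_field, sub_zero] at hs
  have := (div_pos_iff_of_pos_right hs'.1).1 hs
  linarith

theorem HasFDerivWithinAt.hasDerivWithinAt_line {E F : Type*} [NormedAddCommGroup E]
    [NormedSpace ℝ E] [NormedAddCommGroup F] [NormedSpace ℝ F] {f : E → F} {f' : E →L[ℝ] F}
    {S : Set E} {x d : E} (hf : HasFDerivWithinAt f f' S x)
    (hS : ∀ᶠ s in 𝓝[≥] (0:ℝ), x + s • d ∈ S) :
    HasDerivWithinAt (fun s : ℝ => f (x + s • d)) (f' d) (Ici 0) 0 := by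
  have h1 : HasFDerivWithinAt f f' S (x + (0:ℝ) • d) := by simpa using hf
  have h2 := h1.comp_hasDerivWithinAt (s := {s | x + s • d ∈ S}) (0:ℝ)
    (hasDerivAt_line x d 0).hasDerivWithinAt fun s hs => hs
  exact h2.mono_of_mem_nhdsWithin hS

theorem eventually_add_smul_neg_mem_closure {E : Type*} [NormedAddCommGroup E]
    [InnerProductSpace ℝ E] {Ω : Set E} {x ν : E} {r : ℝ} (hr : 0 < r) (hν : ‖ν‖ = 1)
    (hball : Metric.ball (x - r • ν) r ⊆ Ω) : ∀ᶠ s in 𝓝[≥] (0:ℝ), x + s • -ν ∈ closure Ω := by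
  filter_upwards [Icc_mem_nhdsGE hr] with s hs
  have h : x + s • -ν ∈ Metric.closedBall (x - r • ν) r := by
    have : x + s • -ν - (x - r • ν) = (r - s) • ν := by rw [sub_smul, smul_neg]; abel
    rw [mem_closedBall_iff_norm, this, norm_smul, hν, mul_one, Real.norm_eq_abs,
      abs_of_nonneg (by linarith [hs.2])]
    linarith [hs.1]
  rw [← closure_ball _ hr.ne'] at h
  exact closure_mono hball h

/-- From a boundary maximum one passes to a maximum inside an interior ball, after multiplication
with a concave cut-off function. -/
theorem exists_interior_max_of_boundary_max {E : Type*} [NormedAddCommGroup E]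
    [InnerProductSpace ℝ E] [ProperSpace E] {Ω : Set E} {Ψ : E → ℝ → ℝ} {S B r D t₀ : ℝ}
    {x₀ ν : E} (hΨ : ContinuousOn (fun p : E × ℝ => Ψ p.1 p.2) (closure Ω ×ˢ Icc 0 S))
    (ht₀ : t₀ ∈ Icc 0 S) (hmax : ∀ x ∈ closure Ω, ∀ t ∈ Icc 0 S, Ψ x t ≤ Ψ x₀ t₀)
    (hr : 0 < r) (hν : ‖ν‖ = 1)
    (hball : Metric.ball (x₀ - r • ν) r ⊆ Ω)
    (hD : HasDerivWithinAt (fun s : ℝ => Ψ (x₀ + s • -ν) t₀) D (Ici 0) 0)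
    (hD' : 0 < D + 2 * B * r * Ψ x₀ t₀) :
    ∃ x₁ ∈ Metric.ball (x₀ - r • ν) r, ∃ t₁ ∈ Icc 0 S,
      Ψ x₀ t₀ < (1 + B * r ^ 2 - B * ‖x₁ - (x₀ - r • ν)‖ ^ 2) * Ψ x₁ t₁ ∧
      ∀ x ∈ Metric.closedBall (x₀ - r • ν) r, ∀ t ∈ Icc 0 S,
        (1 + B * r ^ 2 - B * ‖x - (x₀ - r • ν)‖ ^ 2) * Ψ x t ≤
          (1 + B * r ^ 2 - B * ‖x₁ - (x₀ - r • ν)‖ ^ 2) * Ψ x₁ t₁ := by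
  set xc := x₀ - r • ν with hxc
  have hsub : Metric.closedBall xc r ⊆ closure Ω := by
    rw [← closure_ball xc hr.ne']
    exact closure_mono hball
  have hcont : ContinuousOn (fun p : E × ℝ => (1 + B * r ^ 2 - B * ‖p.1 - xc‖ ^ 2) * Ψ p.1 p.2)
      (Metric.closedBall xc r ×ˢ Icc 0 S) := by
    refine ContinuousOn.mul (Continuous.continuousOn (by fun_prop)) (hΨ.mono ?_)
    exact prod_mono hsub Subset.rfl
  obtain ⟨⟨x₁, t₁⟩, ⟨hx₁, ht₁⟩, hmax₁⟩ :=
    ((isCompact_closedBall xc r).prod isCompact_Icc).exists_isMaxOn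
      ⟨(xc, t₀), Metric.mem_closedBall_self hr.le, ht₀⟩ hcont
  have hmax₂ : ∀ x ∈ Metric.closedBall xc r, ∀ t ∈ Icc 0 S,
      (1 + B * r ^ 2 - B * ‖x - xc‖ ^ 2) * Ψ x t ≤
        (1 + B * r ^ 2 - B * ‖x₁ - xc‖ ^ 2) * Ψ x₁ t₁ := fun x hx t ht => hmax₁ (mk_mem_prod hx ht)
  have hstrict : Ψ x₀ t₀ < (1 + B * r ^ 2 - B * ‖x₁ - xc‖ ^ 2) * Ψ x₁ t₁ := by
    have h1 : ∀ s : ℝ, ‖x₀ + s • -ν - xc‖ = |r - s| := by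
      intro s
      have : x₀ + s • -ν - xc = (r - s) • ν := by rw [hxc, sub_smul, smul_neg]; abel
      rw [this, norm_smul, hν, mul_one, Real.norm_eq_abs]
    -- Along the inward normal the cut-off has value 1 and slope 2Br at the boundary point, so the
    -- hypothesis on D makes the product strictly increasing there.
    have h2 : HasDerivWithinAt (fun s : ℝ => (1 + B * r ^ 2 - B * (r - s) ^ 2) *
        Ψ (x₀ + s • -ν) t₀) (D + 2 * B * r * Ψ x₀ t₀) (Ici 0) 0 := by
      have h3 : HasDerivAt (fun s : ℝ => 1 + B * r ^ 2 - B * (r - s) ^ 2) (2 * B * r) 0 := by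
        have := ((((hasDerivAt_id (0:ℝ)).const_sub r).pow 2).const_mul B).const_sub (1 + B * r ^ 2)
        refine this.congr_deriv ?_
        simp
        ring
      refine (h3.hasDerivWithinAt.mul hD).congr_deriv ?_
      simp
      ring
    obtain ⟨s, hs, hs'⟩ := exists_gt_of_hasDerivWithinAt_pos h2 hD' (r := r) hr
    have h4 : x₀ + s • -ν ∈ Metric.closedBall xc r := by
      rw [mem_closedBall_iff_norm, h1, abs_of_pos (by linarith [hs.2])]
      linarith [hs.1]
    have h5 := hmax₂ _ h4 t₀ ht₀
    rw [h1, sq_abs] at h5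
    refine lt_of_lt_of_le ?_ h5
    simpa using hs'
  refine ⟨x₁, ?_, t₁, ht₁, hstrict, hmax₂⟩
  rw [mem_ball_iff_norm]
  rw [mem_closedBall_iff_norm] at hx₁
  -- On the sphere the cut-off equals 1, so the product cannot exceed the maximum of Ψ there.
  refine lt_of_le_of_ne hx₁ fun h => ?_
  rw [h] at hstrict
  have := hmax x₁ (hsub (mem_closedBall_iff_norm.2 hx₁)) t₁ ht₁
  linarith [show (1 + B * r ^ 2 - B * r ^ 2) * Ψ x₁ t₁ = Ψ x₁ t₁ by ring]

end Maximum

/-! ### Differences of the operator and conditions at a maximum of ρW -/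

section Comparison

theorem abs_areaElem_sub_le {E : Type*} [NormedAddCommGroup E] [InnerProductSpace ℝ E] {η : ℝ}
    (hη : 0 < η) (p p' : E) : |areaElem η p - areaElem η p'| ≤ ‖p - p'‖ := by
  have h1 := areaElem_pos hη p
  have h2 := areaElem_pos hη p'
  have h3 : (areaElem η p - areaElem η p') * (areaElem η p + areaElem η p') =
      (‖p‖ - ‖p'‖) * (‖p‖ + ‖p'‖) := by
    linear_combination sq_areaElem η p - sq_areaElem η p'
  have h4 := norm_le_areaElem η p
  have h5 := norm_le_areaElem η p'
  have h6 : |areaElem η p - areaElem η p'| * (areaElem η p + areaElem η p') ≤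
      ‖p - p'‖ * (areaElem η p + areaElem η p') := by
    rw [← abs_of_pos (add_pos h1 h2), ← abs_mul, h3, abs_mul,
      abs_of_nonneg (add_nonneg (norm_nonneg p) (norm_nonneg p')), abs_of_pos (add_pos h1 h2)]
    gcongr
    exact abs_norm_sub_norm_le p p'
  exact le_of_mul_le_mul_right h6 (add_pos h1 h2)

theorem norm_inv_areaElem_smul_le {E : Type*} [NormedAddCommGroup E] [InnerProductSpace ℝ E]
    {η : ℝ} (hη : 0 < η) (p : E) : ‖(areaElem η p)⁻¹ • p‖ ≤ 1 := by
  have h1 := areaElem_pos hη p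
  rw [norm_smul, norm_inv, Real.norm_eq_abs, abs_of_pos h1, inv_mul_le_iff₀ h1, mul_one]
  exact norm_le_areaElem η p

theorem norm_inv_areaElem_smul_sub_le {E : Type*} [NormedAddCommGroup E] [InnerProductSpace ℝ E]
    {η : ℝ} (hη : 0 < η) (p p' : E) :
    ‖(areaElem η p)⁻¹ • p - (areaElem η p')⁻¹ • p'‖ ≤ 2 / η * ‖p - p'‖ := by
  have h1 := areaElem_pos hη p
  have h2 := areaElem_pos hη p'
  have hηv : η ≤ areaElem η p := Real.le_sqrt_of_sq_le (by linarith [sq_nonneg ‖p‖])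
  have h3 : (areaElem η p)⁻¹ • p - (areaElem η p')⁻¹ • p' = (areaElem η p)⁻¹ • ((p - p')
      + (areaElem η p' - areaElem η p) • ((areaElem η p')⁻¹ • p')) := by
    rw [smul_add, smul_sub, smul_smul, smul_smul]
    have : (areaElem η p)⁻¹ * ((areaElem η p' - areaElem η p) * (areaElem η p')⁻¹) =
        (areaElem η p)⁻¹ - (areaElem η p')⁻¹ := by field_simp
    rw [← mul_assoc] at this
    rw [this, sub_smul]
    abel
  rw [h3, norm_smul, norm_inv, Real.norm_eq_abs, abs_of_pos h1]
  have h4 : ‖p - p' + (areaElem η p' - areaElem η p) • ((areaElem η p')⁻¹ • p')‖ ≤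
      2 * ‖p - p'‖ := by
    refine (norm_add_le _ _).trans ?_
    rw [norm_smul (areaElem η p' - areaElem η p), Real.norm_eq_abs]
    have h5 := abs_areaElem_sub_le hη p' p
    rw [norm_sub_rev] at h5
    have h6 := mul_le_mul h5 (norm_inv_areaElem_smul_le hη p') (norm_nonneg _) (norm_nonneg _)
    linarith
  calc _ ≤ η⁻¹ * (2 * ‖p - p'‖) := by gcongr
    _ = _ := by ring

variable {n : ℕ}

theorem inner_map_self_div_sq {η : ℝ} (hη : 0 < η) (p : EuclideanSpace ℝ (Fin n))
    (S : EuclideanSpace ℝ (Fin n) →L[ℝ] EuclideanSpace ℝ (Fin n)) :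
    inner ℝ (S p) p / areaElem η p ^ 2 =
      inner ℝ (S ((areaElem η p)⁻¹ • p)) ((areaElem η p)⁻¹ • p) := by
  rw [map_smul, inner_smul_left, inner_smul_right]
  simp only [conj_trivial]
  have := (areaElem_pos hη p).ne'
  field_simp

/-- The coefficients at p₁ are tested on S₁ - S₂, which is at most κ. Changing the coefficients
costs the Lipschitz constant 2/η of p/v times ‖S₂‖, and the zero-order terms have favourable signs.
Dependence on η and H is harmless, since the comparison principle does not retain these constants.
-/
theorem flowOperator_sub_le {η κ H Cc a₁ a₂ b₁ b₂ : ℝ} (hη : 0 < η)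
    {p₁ p₂ : EuclideanSpace ℝ (Fin n)}
    {S₁ S₂ : EuclideanSpace ℝ (Fin n) →L[ℝ] EuclideanSpace ℝ (Fin n)} (hκ : 0 ≤ κ)
    (hS : ∀ d, inner ℝ ((S₁ - S₂) d) d ≤ κ * ‖d‖ ^ 2) (hS₂ : ‖S₂‖ ≤ H) (ha : a₁ ≤ a₂)
    (hb : b₂ ≤ b₁) (ha₂ : |a₂| ≤ Cc) :
    flowOperator η p₁ S₁ a₁ b₁ - flowOperator η p₂ S₂ a₂ b₂ ≤
      n * κ + (4 * H / η + Cc) * ‖p₁ - p₂‖ := by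
  have h1 := areaElem_pos hη p₁
  set e₁ := (areaElem η p₁)⁻¹ • p₁ with he₁
  set e₂ := (areaElem η p₂)⁻¹ • p₂ with he₂
  have he₁1 : ‖e₁‖ ≤ 1 := norm_inv_areaElem_smul_le hη p₁
  have he₂1 : ‖e₂‖ ≤ 1 := norm_inv_areaElem_smul_le hη p₂
  have hH : 0 ≤ H := (norm_nonneg _).trans hS₂
  obtain ⟨d, hd⟩ := exists_frame e₁ he₁1
  have hd : IsFrame e₁ d := hd
  have h2 : ∑ i, ((S₁ - S₂) (EuclideanSpace.single i 1)) i - inner ℝ ((S₁ - S₂) e₁) e₁ ≤ n * κ := by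
    rw [← hd.sum_inner]
    calc _ ≤ ∑ i, κ * ‖d i‖ ^ 2 := Finset.sum_le_sum fun i _ => hS (d i)
      _ = κ * (n - ‖e₁‖ ^ 2) := by rw [← Finset.mul_sum, hd.sum_norm_sq]
      _ ≤ κ * n := by gcongr; linarith [sq_nonneg ‖e₁‖]
      _ = _ := mul_comm _ _
  have h3 : inner ℝ (S₂ e₂) e₂ - inner ℝ (S₂ e₁) e₁ ≤ 4 * H / η * ‖p₁ - p₂‖ := by
    have h4 : inner ℝ (S₂ e₂) e₂ - inner ℝ (S₂ e₁) e₁ =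
        -(inner ℝ (S₂ (e₁ - e₂)) e₂ + inner ℝ (S₂ e₁) (e₁ - e₂)) := by
      rw [map_sub, inner_sub_left, inner_sub_right]; ring
    have h5 := norm_inv_areaElem_smul_sub_le hη p₁ p₂
    rw [← he₁, ← he₂] at h5
    have h6 : |inner ℝ (S₂ (e₁ - e₂)) e₂| ≤ H * ‖e₁ - e₂‖ * 1 :=
      (abs_real_inner_le_norm _ _).trans
        (mul_le_mul (S₂.le_of_opNorm_le hS₂ _) he₂1 (norm_nonneg _) (by positivity))
    have h7 : |inner ℝ (S₂ e₁) (e₁ - e₂)| ≤ H * 1 * ‖e₁ - e₂‖ :=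
      (abs_real_inner_le_norm _ _).trans (mul_le_mul_of_nonneg_right
        ((S₂.le_of_opNorm_le hS₂ _).trans (by gcongr)) (norm_nonneg _))
    rw [h4]
    calc _ ≤ 2 * H * ‖e₁ - e₂‖ := by
          linarith [neg_abs_le (inner ℝ (S₂ (e₁ - e₂)) e₂), neg_abs_le (inner ℝ (S₂ e₁) (e₁ - e₂))]
      _ ≤ 2 * H * (2 / η * ‖p₁ - p₂‖) := by gcongr
      _ = _ := by ring
  have h4 : a₁ * areaElem η p₁ - a₂ * areaElem η p₂ ≤ Cc * ‖p₁ - p₂‖ := by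
    have h5 : a₁ * areaElem η p₁ ≤ a₂ * areaElem η p₁ := by gcongr
    have h6 : |a₂ * (areaElem η p₁ - areaElem η p₂)| ≤ Cc * ‖p₁ - p₂‖ := by
      rw [abs_mul]
      exact mul_le_mul ha₂ (abs_areaElem_sub_le hη _ _) (abs_nonneg _) ((abs_nonneg _).trans ha₂)
    have := le_abs_self (a₂ * (areaElem η p₁ - areaElem η p₂))
    linarith
  rw [flowOperator, flowOperator, inner_map_self_div_sq hη, inner_map_self_div_sq hη, ← he₁, ← he₂]
  simp only [_root_.sub_apply, PiLp.sub_apply, Finset.sum_sub_distrib, inner_sub_left] at h2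
  linarith

/-- First and second order conditions at a local maximum of `(A - B |x - x_c|²) W`. -/
theorem gradient_hessian_of_isLocalMax_mul {E : Type*} [NormedAddCommGroup E]
    [InnerProductSpace ℝ E] {W : E → ℝ} {p : E → E} {S : E →L[ℝ] E} {x xc G : E} {A B b : ℝ}
    (hW : ∀ᶠ z in 𝓝 x, HasFDerivAt W (innerSL ℝ (p z)) z) (hp : HasFDerivAt p S x)
    (hmax : IsLocalMax (fun z => (A - B * ‖z - xc‖ ^ 2) * W z) x)
    (hρ : 0 < A - B * ‖x - xc‖ ^ 2) (hb : b = 2 * B / (A - B * ‖x - xc‖ ^ 2))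
    (hG : G = b • (x - xc)) :
    p x = W x • G ∧ ∀ d, inner ℝ (S d) d ≤ W x * (b * ‖d‖ ^ 2 + 2 * inner ℝ G d ^ 2) := by
  set ρ : ℝ := A - B * ‖x - xc‖ ^ 2 with hρdef
  have hbρ : b * ρ = 2 * B := by rw [hb]; field_simp
  have key : ∀ d, inner ℝ (p x) d = W x * inner ℝ G d ∧
      inner ℝ (S d) d ≤ W x * (b * ‖d‖ ^ 2 + 2 * inner ℝ G d ^ 2) := by
    intro d
    have hd2 : ∀ s : ℝ, HasDerivAt (fun s : ℝ => A - B * ‖x + s • d - xc‖ ^ 2)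
        (-(2 * B * inner ℝ (x + s • d - xc) d)) s := by
      intro s
      have h1 := ((((hasDerivAt_line x d s).sub_const xc).norm_sq).const_mul B).const_sub A
      refine h1.congr_deriv ?_
      ring
    have hd3 : HasDerivAt (fun s : ℝ => -(2 * B * inner ℝ (x + s • d - xc) d))
        (-(2 * B * ‖d‖ ^ 2)) 0 := by
      have h1 := ((((hasDerivAt_line x d 0).sub_const xc).inner ℝ
        (hasDerivAt_const (0:ℝ) d)).const_mul (2 * B)).neg
      refine h1.congr_deriv ?_
      simp
    have hw1 : ∀ᶠ s in 𝓝 (0:ℝ), HasDerivAt (fun s : ℝ => W (x + s • d))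
        (inner ℝ (p (x + s • d)) d) s := by
      filter_upwards [(tendsto_line x d).eventually hW] with s hs
      exact hs.comp_hasDerivAt s (hasDerivAt_line x d s)
    have hw2 : HasDerivAt (fun s : ℝ => inner ℝ (p (x + s • d)) d) (inner ℝ (S d) d) 0 := by
      simpa using (hp.hasDerivAt_line_zero d).inner ℝ (hasDerivAt_const (0:ℝ) d)
    have hF1 := hw1.mono fun s hs => (hd2 s).mul hs
    have hF2 := (hd3.mul hw1.self_of_nhds).add ((hd2 0).mul hw2)
    have hmax' : IsLocalMax (fun s : ℝ => (A - B * ‖x + s • d - xc‖ ^ 2) * W (x + s • d)) 0 := by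
      filter_upwards [(tendsto_line x d).eventually hmax] with s hs
      simpa using hs
    have c1 := hmax'.hasDerivAt_eq_zero hF1.self_of_nhds
    have c2 := second_deriv_nonpos_of_isLocalMax hF1 hF2 hmax'
    simp only [zero_smul, add_zero, ← hρdef] at c1 c2
    have hGd : inner ℝ G d = b * inner ℝ (x - xc) d := by rw [hG, inner_smul_left]; simp
    have c3 : inner ℝ (p x) d = W x * inner ℝ G d := by
      rw [hGd]
      have : ρ * inner ℝ (p x) d = ρ * (W x * (b * inner ℝ (x - xc) d)) := by
        linear_combination c1 - (W x * inner ℝ (x - xc) d) * hbρ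
      exact mul_left_cancel₀ hρ.ne' this
    refine ⟨c3, ?_⟩
    rw [c3] at c2
    have h5 : ρ * inner ℝ (S d) d ≤ ρ * (W x * (b * ‖d‖ ^ 2 + 2 * inner ℝ G d ^ 2)) := by
      have e1 : ρ * (W x * (b * ‖d‖ ^ 2 + 2 * inner ℝ G d ^ 2)) =
          2 * B * W x * ‖d‖ ^ 2 + 4 * B * inner ℝ (x - xc) d * (W x * inner ℝ G d) := by
        rw [hGd]
        linear_combination (W x * ‖d‖ ^ 2 + 2 * W x * (b * inner ℝ (x - xc) d ^ 2)) * hbρ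
      rw [e1]
      linarith
    exact le_of_mul_le_mul_left h5 hρ
  refine ⟨?_, fun d => (key d).2⟩
  refine ext_inner_right ℝ fun d => ?_
  rw [(key d).1, inner_smul_left]
  simp

end Comparison

/-! ### The comparison principle -/

section ComparisonPrinciple

variable {n : ℕ} {Ω : Set (EuclideanSpace ℝ (Fin n))}

/-- The derivative is v^{q-3}(k² + qs²) > 0. With k² = η² plus the squared tangential gradient, the
boundary condition determines the normal derivative from the tangential gradient. -/
theorem strictMono_areaElem_rpow_mul {k q : ℝ} (hk : 0 < k) (hq : 0 < q) :
    StrictMono fun s : ℝ => areaElem k s ^ (q - 1) * s := by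
  have h : ∀ s : ℝ, HasDerivAt (fun s : ℝ => areaElem k s ^ (q - 1) * s)
      (areaElem k s ^ (q - 1 - 2) * (k ^ 2 + q * s ^ 2)) s := by
    intro s
    have hv := areaElem_pos hk s
    have h1 := (hasDerivAt_areaElem_rpow hk (q - 1) (hasDerivAt_id s)).mul (hasDerivAt_id s)
    refine h1.congr_deriv ?_
    have h2 : areaElem k s ^ (q - 1) = areaElem k s ^ (q - 1 - 2) * (k ^ 2 + s ^ 2) := by
      have := sq_areaElem k s
      rw [Real.norm_eq_abs, sq_abs] at this
      rw [← this, ← Real.rpow_natCast (areaElem k s) 2, ← Real.rpow_add hv]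
      norm_num
    simp only [id, h2]
    simp
    ring
  refine strictMono_of_deriv_pos fun s => ?_
  rw [(h s).deriv]
  have := Real.rpow_pos_of_pos (areaElem_pos hk s) (q - 1 - 2)
  positivity

/-- Two gradients that satisfy the same boundary condition agree at a boundary maximum of the
difference of the functions. -/
theorem gradient_eq_of_boundary_max (hΩ : IsOpen Ω) {x ν p₁ p₂ : EuclideanSpace ℝ (Fin n)}
    (hν : IsOutwardNormal Ω x ν) {W : EuclideanSpace ℝ (Fin n) → ℝ} {η q φ : ℝ} (hη : 0 < η)
    (hq : 0 < q) (hW : HasFDerivWithinAt W (innerSL ℝ (p₁ - p₂)) (closure Ω) x)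
    (hmax : ∀ y ∈ closure Ω, W y ≤ W x)
    (h₁ : inner ℝ p₁ ν = φ * areaElem η p₁ ^ (1 - q))
    (h₂ : inner ℝ p₂ ν = φ * areaElem η p₂ ^ (1 - q)) : p₁ = p₂ := by
  have hν1 := hν.norm_eq_one
  have htan : ∀ τ, inner ℝ ν τ = 0 → inner ℝ (p₁ - p₂) τ = 0 := by
    intro τ hτ
    obtain ⟨γ, hγ0, hγ, hγmem⟩ := hν.exists_curve hΩ hτ
    have hγcl : ∀ᶠ r in 𝓝 0, γ r ∈ closure Ω := hγmem.mono fun r hr => frontier_subset_closure hr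
    refine IsLocalMax.hasDerivAt_eq_zero ?_ (hW.comp_hasDerivAt_of_eventually_mem hγ hγ0 hγcl)
    filter_upwards [hγcl] with r hr
    rw [hγ0]
    exact hmax _ hr
  obtain ⟨s₁, hs₁⟩ : ∃ s, s = inner ℝ p₁ ν := ⟨_, rfl⟩
  obtain ⟨s₂, hs₂⟩ : ∃ s, s = inner ℝ p₂ ν := ⟨_, rfl⟩
  obtain ⟨m, hm⟩ : ∃ m, m = p₁ - s₁ • ν := ⟨_, rfl⟩
  have hmν : inner ℝ m ν = 0 := by
    rw [hm, inner_sub_left, inner_smul_left, real_inner_self_eq_norm_sq, hν1, hs₁]; simp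
  have hm2 : m = p₂ - s₂ • ν := by
    obtain ⟨τ, hτ⟩ : ∃ τ, τ = p₁ - p₂ - (s₁ - s₂) • ν := ⟨_, rfl⟩
    have h1 : inner ℝ ν τ = 0 := by
      rw [real_inner_comm, hτ, inner_sub_left, inner_sub_left, inner_smul_left,
        real_inner_self_eq_norm_sq, hν1, hs₁, hs₂]
      simp
    have h2 : inner ℝ τ τ = 0 := by
      nth_rewrite 1 [hτ]
      rw [inner_sub_left, htan τ h1, inner_smul_left, h1]; simp
    rw [inner_self_eq_zero] at h2
    rw [h2, sub_smul] at hτ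
    rw [hm, ← sub_eq_zero, hτ]
    abel
  -- The tangential parts agree, so both normal components solve the same strictly monotone
  -- equation.
  have key : ∀ s p, p = m + s • ν → inner ℝ p ν = φ * areaElem η p ^ (1 - q) → s = inner ℝ p ν →
      areaElem (areaElem η m) s ^ (q - 1) * s = φ := by
    intro s p hp hφ hs
    have h1 : areaElem (areaElem η m) s = areaElem η p := by
      rw [show areaElem (areaElem η m) s = √(areaElem η m ^ 2 + ‖s‖ ^ 2) from rfl, sq_areaElem,
        areaElem, hp, norm_add_sq_real, inner_smul_right, hmν, norm_smul,
        hν1, mul_one, mul_zero]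
      congr 1
      ring
    rw [h1, hs, hφ, mul_left_comm, ← Real.rpow_add (areaElem_pos hη p)]
    simp
  have e₁ := key s₁ p₁ (by rw [hm]; abel) h₁ hs₁
  have e₂ := key s₂ p₂ (by rw [hm2]; abel) h₂ hs₂
  have := (strictMono_areaElem_rpow_mul (areaElem_pos hη m) hq).injective (e₁.trans e₂.symm)
  rw [hm, this] at hm2
  exact sub_left_injective hm2

/-- A classical solution of the equation on the cylinder `Ω × [0, S]`, with bounded Hessian. -/
structure IsCylinderSolution (Ω : Set (EuclideanSpace ℝ (Fin n))) (S η q H : ℝ)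
    (c f : EuclideanSpace ℝ (Fin n) → ℝ → ℝ) (φ : EuclideanSpace ℝ (Fin n) → ℝ)
    (U : EuclideanSpace ℝ (Fin n) → ℝ → ℝ) : Prop where
  continuousOn : ContinuousOn (fun p : EuclideanSpace ℝ (Fin n) × ℝ => U p.1 p.2)
    (closure Ω ×ˢ Icc 0 S)
  contDiffOn : ∀ t ∈ Icc 0 S, ContDiffOn ℝ 2 (fun y => U y t) (closure Ω)
  hessian_le : ∀ x ∈ Ω, ∀ t ∈ Icc 0 S, ‖fderiv ℝ (fun y => spaceGrad Ω U y t) x‖ ≤ H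
  equation : ∀ x ∈ Ω, ∀ t ∈ Ioc 0 S, HasDerivAt (U x) (flowOperator η (spaceGrad Ω U x t)
    (fderiv ℝ (fun y => spaceGrad Ω U y t) x) (c x (U x t)) (f x (U x t))) t
  boundary : ∀ x ∈ frontier Ω, ∀ ν, IsOutwardNormal Ω x ν → ∀ t ∈ Icc 0 S,
    inner ℝ (spaceGrad Ω U x t) ν = φ x * areaElem η (spaceGrad Ω U x t) ^ (1 - q)

variable {S η q H Cc m : ℝ} {c f : EuclideanSpace ℝ (Fin n) → ℝ → ℝ}
  {φ : EuclideanSpace ℝ (Fin n) → ℝ} {U₁ U₂ : EuclideanSpace ℝ (Fin n) → ℝ → ℝ}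

/-- Because of the factor e^{-t}, maximality in time gives ∂_t(U₁ - U₂) ≥ W for the excess W = U₁ -
U₂ - m. The spatial conditions bound the same quantity by W times the right side, and W > 0 cancels.
Small b and G then give a contradiction. -/
theorem IsCylinderSolution.one_le_of_local_max (hΩ : IsOpen Ω) (hη : 0 < η)
    (h₁ : IsCylinderSolution Ω S η q H c f φ U₁) (h₂ : IsCylinderSolution Ω S η q H c f φ U₂)
    (hc : ∀ x ∈ Ω, ∀ z, |c x z| ≤ Cc) (hc' : ∀ x ∈ Ω, Antitone (c x))
    (hf' : ∀ x ∈ Ω, Monotone (f x)) (hm : 0 ≤ m) {x xc G : EuclideanSpace ℝ (Fin n)} {t A B b : ℝ}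
    (hx : x ∈ Ω) (ht : t ∈ Ioc 0 S)
    (hmax : IsLocalMax (fun z => (A - B * ‖z - xc‖ ^ 2) * (U₁ z t - U₂ z t - m)) x)
    (hρ : 0 < A - B * ‖x - xc‖ ^ 2) (hb : b = 2 * B / (A - B * ‖x - xc‖ ^ 2))
    (hb0 : 0 ≤ b) (hG : G = b • (x - xc)) (hpos : 0 < U₁ x t - U₂ x t - m)
    (htime : ∀ s ∈ Icc 0 t, (U₁ x s - U₂ x s - m) * Real.exp (-s) ≤
      (U₁ x t - U₂ x t - m) * Real.exp (-t)) :
    1 ≤ n * (b + 2 * ‖G‖ ^ 2) + (4 * H / η + Cc) * ‖G‖ := by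
  have htI : t ∈ Icc 0 S := ⟨ht.1.le, ht.2⟩
  obtain ⟨W, hW⟩ : ∃ W, W = U₁ x t - U₂ x t - m := ⟨_, rfl⟩
  have hd : ∀ U, IsCylinderSolution Ω S η q H c f φ U → ∀ z ∈ Ω,
      HasFDerivAt (fun y => U y t) (innerSL ℝ (spaceGrad Ω U z t)) z := fun U hU z hz =>
    hasFDerivAt_spaceGrad hΩ hz (((hU.contDiffOn t htI).differentiableOn (by simp)).differentiableAt
      (closure_mem_nhds hΩ hz))
  have hd2 : ∀ U, IsCylinderSolution Ω S η q H c f φ U →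
      HasFDerivAt (fun y => spaceGrad Ω U y t) (fderiv ℝ (fun y => spaceGrad Ω U y t) x) x :=
    fun U hU => ((contDiffAt_spaceGrad (m := 1) hΩ hx ((hU.contDiffOn t htI).contDiffAt
      (closure_mem_nhds hΩ hx)) (by norm_num)).differentiableAt (by simp)).hasFDerivAt
  have hWd : ∀ᶠ z in 𝓝 x, HasFDerivAt (fun y => U₁ y t - U₂ y t - m)
      (innerSL ℝ (spaceGrad Ω U₁ z t - spaceGrad Ω U₂ z t)) z := by
    filter_upwards [hΩ.mem_nhds hx] with z hz
    rw [map_sub]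
    exact ((hd U₁ h₁ z hz).sub (hd U₂ h₂ z hz)).sub_const m
  obtain ⟨hp, hS⟩ := gradient_hessian_of_isLocalMax_mul hWd ((hd2 U₁ h₁).sub (hd2 U₂ h₂)) hmax hρ hb hG
  rw [← hW] at hp hS
  rw [← hW] at hpos
  have hU : U₂ x t ≤ U₁ x t := by linarith
  have hle := flowOperator_sub_le (η := η) (κ := W * (b + 2 * ‖G‖ ^ 2)) (H := H) (Cc := Cc)
    (a₁ := c x (U₁ x t)) (a₂ := c x (U₂ x t)) (b₁ := f x (U₁ x t)) (b₂ := f x (U₂ x t))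
    (p₁ := spaceGrad Ω U₁ x t) (p₂ := spaceGrad Ω U₂ x t) hη (by positivity)
    (fun d => (hS d).trans ?_) (h₂.hessian_le x hx t htI) (hc' x hx hU) (hf' x hx hU) (hc x hx _)
  · have hder : HasDerivAt (fun s => (U₁ x s - U₂ x s - m) * Real.exp (-s)) _ t :=
      (((h₁.equation x hx t ht).sub (h₂.equation x hx t ht)).sub_const m).mul
        ((hasDerivAt_id t).neg.exp)
    have h3 := hder.nonneg_of_forall_le ht.1 htime
    rw [hp, norm_smul, Real.norm_eq_abs, abs_of_pos hpos] at hle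
    have h4 := Real.exp_pos (-t)
    simp only [Pi.neg_apply, Pi.sub_apply, id, ← hW] at h3
    have h5 : W ≤ flowOperator η (spaceGrad Ω U₁ x t) (fderiv ℝ (fun y => spaceGrad Ω U₁ y t) x)
        (c x (U₁ x t)) (f x (U₁ x t)) - flowOperator η (spaceGrad Ω U₂ x t)
        (fderiv ℝ (fun y => spaceGrad Ω U₂ y t) x) (c x (U₂ x t)) (f x (U₂ x t)) := by
      have : 0 ≤ Real.exp (-t) * (flowOperator η (spaceGrad Ω U₁ x t)
        (fderiv ℝ (fun y => spaceGrad Ω U₁ y t) x)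
        (c x (U₁ x t)) (f x (U₁ x t)) - flowOperator η (spaceGrad Ω U₂ x t)
        (fderiv ℝ (fun y => spaceGrad Ω U₂ y t) x) (c x (U₂ x t)) (f x (U₂ x t)) - W) := by
        linarith
      have := nonneg_of_mul_nonneg_right this h4
      linarith
    have h6 : W * 1 ≤ W * (n * (b + 2 * ‖G‖ ^ 2) + (4 * H / η + Cc) * ‖G‖) := by linarith
    exact le_of_mul_le_mul_left h6 hpos
  · rw [mul_assoc]
    refine mul_le_mul_of_nonneg_left ?_ hpos.le
    have h3 : inner ℝ G d ^ 2 ≤ (‖G‖ * ‖d‖) ^ 2 := by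
      rw [← sq_abs]
      gcongr
      exact abs_real_inner_le_norm G d
    linarith [show (‖G‖ * ‖d‖) ^ 2 = ‖G‖ ^ 2 * ‖d‖ ^ 2 by ring]

/-- The comparison principle. -/
theorem IsCylinderSolution.le_add (hΩ : IsBoundedC3Domain Ω) (hη : 0 < η) (hq : 0 < q)
    (h₁ : IsCylinderSolution Ω S η q H c f φ U₁) (h₂ : IsCylinderSolution Ω S η q H c f φ U₂)
    (hc : ∀ x ∈ Ω, ∀ z, |c x z| ≤ Cc) (hc' : ∀ x ∈ Ω, Antitone (c x))
    (hf' : ∀ x ∈ Ω, Monotone (f x)) (hm : 0 ≤ m)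
    (h0 : ∀ x ∈ closure Ω, U₁ x 0 ≤ U₂ x 0 + m) :
    ∀ x ∈ closure Ω, ∀ t ∈ Icc 0 S, U₁ x t ≤ U₂ x t + m := by
  intro x hx t ht
  by_contra! hcon
  obtain ⟨Ψ, hΨ⟩ : ∃ Ψ : EuclideanSpace ℝ (Fin n) → ℝ → ℝ,
    Ψ = fun x t => (U₁ x t - U₂ x t - m) * Real.exp (-t) := ⟨_, rfl⟩
  have hΨcont : ContinuousOn (fun p : EuclideanSpace ℝ (Fin n) × ℝ => Ψ p.1 p.2)
      (closure Ω ×ˢ Icc 0 S) := by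
    rw [hΨ]
    exact ((h₁.continuousOn.sub h₂.continuousOn).sub continuousOn_const).mul
      (Continuous.continuousOn (by fun_prop))
  obtain ⟨⟨x₀, t₀⟩, ⟨hx₀, ht₀⟩, hmax⟩ := (hΩ.isCompact_cylinder S).exists_isMaxOn
    ⟨(x, t), hx, ht⟩ hΨcont
  have hmax : ∀ x ∈ closure Ω, ∀ t ∈ Icc 0 S, Ψ x t ≤ Ψ x₀ t₀ :=
    fun x hx t ht => hmax (mk_mem_prod hx ht)
  have hpos : 0 < Ψ x₀ t₀ := by
    refine lt_of_lt_of_le ?_ (hmax x hx t ht)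
    rw [hΨ]
    exact mul_pos (by linarith) (Real.exp_pos _)
  have hzero : ∀ x ∈ closure Ω, Ψ x 0 ≤ 0 := by
    intro x hx
    have := h0 x hx
    rw [hΨ]
    simp only [neg_zero, Real.exp_zero, mul_one]
    linarith
  have hΨW : ∀ x t, 0 < Ψ x t → 0 < U₁ x t - U₂ x t - m := by
    intro x t h
    rw [hΨ] at h
    exact (pos_iff_pos_of_mul_pos h).2 (Real.exp_pos _)
  -- At an interior maximum no cut-off is needed: b = 0 and G = 0 give 1 ≤ 0.
  by_cases hx₀Ω : x₀ ∈ Ω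
  · have ht₀' : 0 < t₀ := by
      refine lt_of_le_of_ne ht₀.1 fun h => ?_
      have := hzero x₀ hx₀
      rw [h] at this
      linarith
    have := IsCylinderSolution.one_le_of_local_max (A := 1) (B := 0) (b := 0) (xc := x₀) (G := 0)
      hΩ.isOpen hη h₁ h₂ hc hc' hf' hm hx₀Ω ⟨ht₀', ht₀.2⟩ ?_ (by simp) (by simp) le_rfl (by simp)
      (hΨW _ _ hpos) ?_
    · simp at this
      linarith
    · filter_upwards [hΩ.isOpen.mem_nhds hx₀Ω] with z hz
      have := hmax z (subset_closure hz) t₀ ht₀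
      rw [hΨ] at this
      simpa using le_of_mul_le_mul_right this (Real.exp_pos _)
    · intro s hs
      have := hmax x₀ hx₀ s ⟨hs.1, hs.2.trans ht₀.2⟩
      rwa [hΨ] at this
  · have hx₀f : x₀ ∈ frontier Ω := ⟨hx₀, by rwa [hΩ.isOpen.interior_eq]⟩
    obtain ⟨ν, hν⟩ := hΩ.boundary x₀ hx₀f
    have hν1 := hν.norm_eq_one
    obtain ⟨r, hr, hballs⟩ := hΩ.exists_uniform_balls
    have hball := (hballs x₀ hx₀f ν hν).1
    have hd : ∀ U, IsCylinderSolution Ω S η q H c f φ U →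
        HasFDerivWithinAt (fun y => U y t₀) (innerSL ℝ (spaceGrad Ω U x₀ t₀)) (closure Ω) x₀ := by
      intro U hU
      rw [spaceGrad, innerSL_gradientWithin]
      exact ((hU.contDiffOn t₀ ht₀).differentiableOn (by simp) x₀ hx₀).hasFDerivWithinAt
    have hWd : HasFDerivWithinAt (fun y => U₁ y t₀ - U₂ y t₀ - m)
        (innerSL ℝ (spaceGrad Ω U₁ x₀ t₀ - spaceGrad Ω U₂ x₀ t₀)) (closure Ω) x₀ := by
      rw [map_sub]
      exact ((hd U₁ h₁).sub (hd U₂ h₂)).sub_const m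
    -- The gradients agree, so the difference has zero normal derivative, and an arbitrarily weak
    -- cut-off already moves the maximum into the ball.
    have hpeq := gradient_eq_of_boundary_max hΩ.isOpen hν hη hq hWd (fun y hy => by
      have := hmax y hy t₀ ht₀
      rw [hΨ] at this
      exact le_of_mul_le_mul_right this (Real.exp_pos _)) (h₁.boundary x₀ hx₀f ν hν t₀ ht₀)
      (h₂.boundary x₀ hx₀f ν hν t₀ ht₀)
    rw [hpeq, sub_self, map_zero] at hWd
    have hline := eventually_add_smul_neg_mem_closure hr hν1 hball
    have hΨd : HasDerivWithinAt (fun s : ℝ => Ψ (x₀ + s • -ν) t₀) 0 (Ici 0) 0 := by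
      have := (hWd.hasDerivWithinAt_line hline).mul_const (Real.exp (-t₀))
      rw [hΨ]
      simpa using this
    obtain ⟨M, hM⟩ : ∃ M, M = n * (2 + 2 * (2 * r) ^ 2) + |4 * H / η + Cc| * (2 * r) := ⟨_, rfl⟩
    have hM0 : 0 ≤ M := by rw [hM]; positivity
    -- With b ≤ 2ε and ‖G‖ ≤ 2εr the necessary condition becomes 1 ≤ εM, which this choice violates.
    obtain ⟨ε, hε⟩ : ∃ ε, ε = (M + 1)⁻¹ := ⟨_, rfl⟩
    have hε0 : 0 < ε := by rw [hε]; positivity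
    have hε1 : ε ≤ 1 := by rw [hε]; exact inv_le_one_of_one_le₀ (by linarith)
    have hεM : ε * M < 1 := by
      rw [hε, inv_mul_lt_iff₀ (by linarith)]
      linarith
    obtain ⟨x₁, hx₁, t₁, ht₁, hgt, hmax₁⟩ := exists_interior_max_of_boundary_max (B := ε) hΨcont ht₀
      hmax hr hν1 hball hΨd (by positivity)
    have hx₁Ω := hball hx₁
    have hρ1 : 1 ≤ 1 + ε * r ^ 2 - ε * ‖x₁ - (x₀ - r • ν)‖ ^ 2 := by
      rw [mem_ball_iff_norm] at hx₁
      have : ε * ‖x₁ - (x₀ - r • ν)‖ ^ 2 ≤ ε * r ^ 2 := by gcongr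
      linarith
    have hΨ1 : 0 < Ψ x₁ t₁ := by
      have h3 := hpos.trans hgt
      exact (pos_iff_pos_of_mul_pos h3).1 (by linarith)
    have ht₁' : 0 < t₁ := by
      refine lt_of_le_of_ne ht₁.1 fun h => ?_
      have := hzero x₁ (subset_closure hx₁Ω)
      rw [h] at this
      linarith
    obtain ⟨ρ, hρ⟩ : ∃ ρ, ρ = 1 + ε * r ^ 2 - ε * ‖x₁ - (x₀ - r • ν)‖ ^ 2 := ⟨_, rfl⟩
    have hone := IsCylinderSolution.one_le_of_local_max (A := 1 + ε * r ^ 2) (B := ε)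
      (b := 2 * ε / ρ) (xc := x₀ - r • ν) (G := (2 * ε / ρ) • (x₁ - (x₀ - r • ν))) (x := x₁)
      hΩ.isOpen hη h₁ h₂ hc hc' hf' hm hx₁Ω ⟨ht₁', ht₁.2⟩ ?_ (by linarith) (by rw [hρ])
      (by rw [hρ]; positivity) rfl (hΨW _ _ hΨ1) ?_
    · rw [← hρ] at hρ1
      have hb : 2 * ε / ρ ≤ 2 * ε := div_le_self (by positivity) hρ1
      have hb0 : 0 ≤ 2 * ε / ρ := by positivity
      have hG : ‖(2 * ε / ρ) • (x₁ - (x₀ - r • ν))‖ ≤ ε * (2 * r) := by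
        rw [norm_smul, Real.norm_eq_abs, abs_of_nonneg hb0]
        rw [mem_ball_iff_norm] at hx₁
        calc _ ≤ 2 * ε * r := by gcongr
          _ = _ := by ring
      have hG2 : ‖(2 * ε / ρ) • (x₁ - (x₀ - r • ν))‖ ^ 2 ≤ ε * (2 * r) ^ 2 := by
        calc _ ≤ (ε * (2 * r)) ^ 2 := by gcongr
          _ = ε * ε * (2 * r) ^ 2 := by ring
          _ ≤ ε * 1 * (2 * r) ^ 2 := by gcongr
          _ = _ := by ring
      have : (1:ℝ) ≤ ε * M := by
        calc (1:ℝ) ≤ _ := hone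
          _ ≤ n * (2 * ε + 2 * (ε * (2 * r) ^ 2)) + |4 * H / η + Cc| * (ε * (2 * r)) := by
            gcongr
            exact le_abs_self _
          _ = _ := by rw [hM]; ring
      linarith
    · filter_upwards [Metric.isOpen_ball.mem_nhds hx₁] with z hz
      have := hmax₁ z (Metric.ball_subset_closedBall hz) t₁ ht₁
      rw [hΨ] at this
      refine le_of_mul_le_mul_right ?_ (Real.exp_pos (-t₁))
      linarith
    · intro s hs
      have := hmax₁ x₁ (Metric.ball_subset_closedBall hx₁) s ⟨hs.1, hs.2.trans ht₁.2⟩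
      rw [hΨ] at this
      exact le_of_mul_le_mul_left this (by linarith)

end ComparisonPrinciple

/-! ### Bound for the time derivative -/

section TimeDerivativeBound

variable {n : ℕ} {Ω : Set (EuclideanSpace ℝ (Fin n))} {σ T η q Cc : ℝ}
  {c f : EuclideanSpace ℝ (Fin n) → ℝ → ℝ} {φ u₀ : EuclideanSpace ℝ (Fin n) → ℝ}
  {u : EuclideanSpace ℝ (Fin n) → ℝ → ℝ}

theorem norm_fderivWithin_gradientWithin_le {E : Type*} [NormedAddCommGroup E]
    [InnerProductSpace ℝ E] [CompleteSpace E] {f : E → ℝ} {s : Set E} (h : ContDiffOn ℝ 2 f s)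
    (hs : UniqueDiffOn ℝ s) {x : E} (hx : x ∈ s) :
    ‖fderivWithin ℝ (fun y => gradientWithin f s y) s x‖ ≤ ‖iteratedFDerivWithin ℝ 2 f s x‖ := by
  refine ContinuousLinearMap.opNorm_le_bound _ (norm_nonneg _) fun a => ?_
  obtain ⟨b, hb⟩ : ∃ b, b = fderivWithin ℝ (fun y => gradientWithin f s y) s x a := ⟨_, rfl⟩
  have h1 := inner_fderivWithin_gradientWithin h hs hx a b
  have h2 := (iteratedFDerivWithin ℝ 2 f s x).le_opNorm ![a, b]
  rw [← h1, ← hb, real_inner_self_eq_norm_sq, Real.norm_eq_abs, abs_of_nonneg (sq_nonneg _),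
    Fin.prod_univ_two] at h2
  simp only [Matrix.cons_val_zero, Matrix.cons_val_one] at h2
  rw [← hb]
  rcases (norm_nonneg b).eq_or_lt with h3 | h3
  · rw [← h3]; positivity
  · refine le_of_mul_le_mul_right ?_ h3
    linarith [sq ‖b‖]

theorem IsParabolicCkHolder.norm_fderiv_spaceGrad_le (hΩ : IsBoundedC3Domain Ω)
    (hu : IsParabolicCkHolder 2 σ (closure Ω) (Icc 0 T) u) {x : EuclideanSpace ℝ (Fin n)}
    (hx : x ∈ Ω) {t : ℝ} (ht : t ∈ Icc 0 T) : ‖fderiv ℝ (fun y => spaceGrad Ω u y t) x‖ ≤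
      ‖iteratedFDerivWithin ℝ 2 (fun y => u y t) (closure Ω) x‖ := by
  rw [fderiv_spaceGrad_eq_fderivWithin hΩ.isOpen hx]
  exact norm_fderivWithin_gradientWithin_le (hu.contDiffOn_space t ht) hΩ.uniqueDiffOn_closure
    (subset_closure hx)

theorem IsParabolicCkHolder.hasDerivAt_time
    (hu : IsParabolicCkHolder 2 σ (closure Ω) (Icc 0 T) u) {x : EuclideanSpace ℝ (Fin n)}
    (hx : x ∈ closure Ω) {t : ℝ} (ht : t ∈ Ioo 0 T) : HasDerivAt (u x) (deriv (u x) t) t :=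
  ((hu.differentiableOn_time x hx).differentiableAt (Icc_mem_nhds ht.1 ht.2)).hasDerivAt

theorem IsRegularizedSolution.deriv_eq_flowOperator (hΩ : IsBoundedC3Domain Ω) (hη : 0 < η)
    (hu : IsParabolicCkHolder 2 σ (closure Ω) (Icc 0 T) u)
    (hs : IsRegularizedSolution Ω T η q c f φ u₀ u) {x : EuclideanSpace ℝ (Fin n)}
    (hx : x ∈ Ω) {t : ℝ} (ht : t ∈ Ioo 0 T) :
    deriv (u x) t = flowOperator η (spaceGrad Ω u x t)
      (fderiv ℝ (fun y => spaceGrad Ω u y t) x) (c x (u x t)) (f x (u x t)) := by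
  rw [hs.equation x hx t ht]
  refine areaFactor_mul_divergence hη ?_ _ _
  exact (contDiffAt_spaceGrad (m := 1) hΩ.isOpen hx ((hu.contDiffOn_space t ⟨ht.1.le, ht.2.le⟩).contDiffAt
    (closure_mem_nhds hΩ.isOpen hx)) (by norm_num)).differentiableAt (by simp)

/-- Time translates solve the same problem because c, f and φ do not depend on t. The strict
inequality S + h < T keeps the equation and the boundary condition available up to time S. -/
theorem IsRegularizedSolution.isCylinderSolution (hΩ : IsBoundedC3Domain Ω) (hσ : 0 < σ)
    (hη : 0 < η) (hu : IsParabolicCkHolder 2 σ (closure Ω) (Icc 0 T) u)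
    (hs : IsRegularizedSolution Ω T η q c f φ u₀ u) {h S H : ℝ} (hh : 0 ≤ h) (hS : S + h < T)
    (hH : ∀ x ∈ closure Ω, ∀ t ∈ Icc 0 T,
      ‖iteratedFDerivWithin ℝ 2 (fun y => u y t) (closure Ω) x‖ ≤ H) :
    IsCylinderSolution Ω S η q H c f φ (fun x t => u x (t + h)) := by
  have hI : ∀ t ∈ Icc 0 S, t + h ∈ Icc 0 T := fun t ht => ⟨by linarith [ht.1], by linarith [ht.2]⟩
  refine ⟨?_, fun t ht => hu.contDiffOn_space (t + h) (hI t ht), fun x hx t ht =>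
    (hu.norm_fderiv_spaceGrad_le hΩ hx (hI t ht)).trans (hH x (subset_closure hx) _ (hI t ht)),
    fun x hx t ht => ?_, fun x hx ν hν t ht => hs.boundary x hx ν hν (t + h)
      ⟨(hI t ht).1, by linarith [ht.2]⟩⟩
  · exact (hu.continuousOn hΩ hσ).comp (f := fun p : EuclideanSpace ℝ (Fin n) × ℝ =>
      (p.1, p.2 + h)) (Continuous.continuousOn (by fun_prop)) fun p hp => ⟨hp.1, hI _ hp.2⟩
  · have ht' : t + h ∈ Ioo 0 T := ⟨by linarith [ht.1], by linarith [ht.2]⟩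
    have h1 := (hu.hasDerivAt_time (subset_closure hx) ht').comp_add_const t h
    rwa [hs.deriv_eq_flowOperator hΩ hη hu hx ht'] at h1

theorem abs_flowOperator_le (hη : η ∈ Ioc (0:ℝ) 1) (p : EuclideanSpace ℝ (Fin n))
    (S : EuclideanSpace ℝ (Fin n) →L[ℝ] EuclideanSpace ℝ (Fin n)) {a b : ℝ} (ha : |a| ≤ Cc)
    (hb : |b| ≤ Cc) : |flowOperator η p S a b| ≤ (n + 1) * ‖S‖ + Cc * (2 + ‖p‖) := by
  have h1 : |∑ i, (S (EuclideanSpace.single i 1)) i| ≤ n * ‖S‖ := by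
    refine (Finset.abs_sum_le_sum_abs _ _).trans ?_
    calc _ ≤ ∑ _i : Fin n, ‖S‖ := Finset.sum_le_sum fun i _ => by
          refine (PiLp.norm_apply_le _ i).trans ((S.le_opNorm _).trans ?_)
          simp
      _ = _ := by simp
  have h2 : |inner ℝ (S p) p / areaElem η p ^ 2| ≤ ‖S‖ := by
    rw [inner_map_self_div_sq hη.1]
    have h3 := norm_inv_areaElem_smul_le hη.1 p
    calc _ ≤ _ := abs_real_inner_le_norm _ _
      _ ≤ ‖S‖ * 1 * 1 := by
        gcongr
        exact (S.le_opNorm _).trans (by gcongr)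
      _ = _ := by ring
  have h3 : |a * areaElem η p| ≤ Cc * (1 + ‖p‖) := by
    rw [abs_mul, abs_of_pos (areaElem_pos hη.1 p)]
    exact mul_le_mul ha (areaElem_le hη p) (areaElem_pos hη.1 p).le ((abs_nonneg _).trans ha)
  rw [flowOperator]
  rw [abs_le] at *
  constructor <;> linarith [h1.1, h1.2, h2.1, h2.2, h3.1, h3.2]

/-- The equation is given on the open cylinder only. The resulting inequality extends by continuity
to the closure, in particular to t = 0. -/
theorem IsRegularizedSolution.abs_timeDeriv_le (hΩ : IsBoundedC3Domain Ω) (hσ : 0 < σ)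
    (hη : η ∈ Ioc (0:ℝ) 1) (hT : 0 < T) (hu : IsParabolicCkHolder 2 σ (closure Ω) (Icc 0 T) u)
    (hs : IsRegularizedSolution Ω T η q c f φ u₀ u)
    (hc : ∀ x ∈ closure Ω, ∀ z, |c x z| ≤ Cc) (hf : ∀ x ∈ closure Ω, ∀ z, |f x z| ≤ Cc)
    {x : EuclideanSpace ℝ (Fin n)} (hx : x ∈ closure Ω) {t : ℝ} (ht : t ∈ Icc 0 T) :
    |derivWithin (u x) (Icc 0 T) t| ≤
      (n + 1) * ‖iteratedFDerivWithin ℝ 2 (fun y => u y t) (closure Ω) x‖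
        + Cc * (2 + ‖spaceGrad Ω u x t‖) := by
  have hcl : closure (Ω ×ˢ Ioo 0 T) = closure Ω ×ˢ Icc 0 T := by
    rw [closure_prod_eq, closure_Ioo hT.ne]
  refine le_on_closure (s := Ω ×ˢ Ioo 0 T) (x := (x, t))
    (f := fun p : EuclideanSpace ℝ (Fin n) × ℝ => |derivWithin (u p.1) (Icc 0 T) p.2|)
    (g := fun p : EuclideanSpace ℝ (Fin n) × ℝ =>
      (n + 1) * ‖iteratedFDerivWithin ℝ 2 (fun y => u y p.2) (closure Ω) p.1‖
        + Cc * (2 + ‖spaceGrad Ω u p.1 p.2‖)) ?_ ?_ ?_ ?_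
  · rintro ⟨y, s⟩ ⟨hy, hs'⟩
    have hy : y ∈ Ω := hy
    have hs' : s ∈ Ioo 0 T := hs'
    simp only
    rw [derivWithin_of_mem_nhds (Icc_mem_nhds hs'.1 hs'.2),
      hs.deriv_eq_flowOperator hΩ hη.1 hu hy hs']
    refine (abs_flowOperator_le hη _ _ (hc y (subset_closure hy) _)
      (hf y (subset_closure hy) _)).trans ?_
    gcongr
    exact hu.norm_fderiv_spaceGrad_le hΩ hy ⟨hs'.1.le, hs'.2.le⟩
  · rw [hcl]
    exact (hu.continuousOn_timeDeriv hΩ hσ).abs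
  · rw [hcl]
    exact ((hu.continuousOn_hessian hΩ hσ).norm.const_mul _).add
      ((continuousOn_const.add (hu.continuousOn_spaceGrad hΩ hσ).norm).const_mul _)
  · rw [hcl]
    exact ⟨hx, ht⟩

/-- The time derivative is bounded by the data. -/
theorem IsRegularizedSolution.abs_deriv_le (hΩ : IsBoundedC3Domain Ω) (hσ : 0 < σ)
    (hη : η ∈ Ioc (0:ℝ) 1) (hq : 0 < q) (hu : IsParabolicCkHolder 2 σ (closure Ω) (Icc 0 T) u)
    (hs : IsRegularizedSolution Ω T η q c f φ u₀ u)
    (hc : ∀ x ∈ closure Ω, ∀ z, |c x z| ≤ Cc) (hf : ∀ x ∈ closure Ω, ∀ z, |f x z| ≤ Cc)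
    (hc' : ∀ x ∈ Ω, Antitone (c x)) (hf' : ∀ x ∈ Ω, Monotone (f x)) {H₀ P₀ : ℝ}
    (hH₀ : ∀ x ∈ closure Ω, ‖iteratedFDerivWithin ℝ 2 u₀ (closure Ω) x‖ ≤ H₀)
    (hP₀ : ∀ x ∈ closure Ω, ‖gradientWithin u₀ (closure Ω) x‖ ≤ P₀)
    {x : EuclideanSpace ℝ (Fin n)} (hx : x ∈ Ω) {t : ℝ} (ht : t ∈ Ioo 0 T) :
    |deriv (u x) t| ≤ (n + 1) * H₀ + Cc * (2 + P₀) := by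
  have hT : 0 < T := ht.1.trans ht.2
  have h0T : (0:ℝ) ∈ Icc 0 T := ⟨le_rfl, hT.le⟩
  obtain ⟨M, hM⟩ : ∃ M, M = (n + 1) * H₀ + Cc * (2 + P₀) := ⟨_, rfl⟩
  have hCc : 0 ≤ Cc := (abs_nonneg _).trans (hc x (subset_closure hx) 0)
  have hinit : EqOn (fun y => u y 0) u₀ (closure Ω) := fun y hy => hs.initial y hy
  have hM0 : ∀ y ∈ closure Ω, |derivWithin (u y) (Icc 0 T) 0| ≤ M := by
    intro y hy
    refine (hs.abs_timeDeriv_le hΩ hσ hη hT hu hc hf hy h0T).trans ?_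
    rw [iteratedFDerivWithin_congr hinit hy, hM]
    have h1 : spaceGrad Ω u y 0 = gradientWithin u₀ (closure Ω) y := by
      rw [spaceGrad, gradientWithin, gradientWithin, fderivWithin_congr hinit (hinit hy)]
    rw [h1]
    gcongr
    · exact hH₀ y hy
    · exact hP₀ y hy
  have hMnn : 0 ≤ M := (abs_nonneg _).trans (hM0 x (subset_closure hx))
  rw [← hM]
  refine le_of_forall_pos_le_add fun ε hε => ?_
  -- This Hessian bound depends on u, but it only serves the comparison principle and does not enter
  -- M.
  obtain ⟨H, hH⟩ := ((hΩ.isCompact_cylinder T).image_of_continuousOn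
    (hu.continuousOn_hessian hΩ hσ)).isBounded.exists_norm_le
  have hH : ∀ x ∈ closure Ω, ∀ t ∈ Icc 0 T,
      ‖iteratedFDerivWithin ℝ 2 (fun y => u y t) (closure Ω) x‖ ≤ H :=
    fun x hx t ht => hH _ ⟨(x, t), ⟨hx, ht⟩, rfl⟩
  have huc := (hΩ.isCompact_cylinder T).uniformContinuousOn_of_continuous
    (hu.continuousOn_timeDeriv hΩ hσ)
  rw [Metric.uniformContinuousOn_iff] at huc
  obtain ⟨ρ, hρ, hρε⟩ := huc ε hε
  have hder : ∀ y ∈ closure Ω, ∀ s ∈ Icc 0 T, s < ρ →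
      |derivWithin (u y) (Icc 0 T) s| ≤ M + ε := by
    intro y hy s hs hsρ
    have h1 := hρε (y, s) ⟨hy, hs⟩ (y, 0) ⟨hy, h0T⟩ (by
      rw [Prod.dist_eq]
      simpa [abs_of_nonneg hs.1] using ⟨hρ, hsρ⟩)
    rw [Real.dist_eq] at h1
    have h2 := hM0 y hy
    simp only at h1
    have h3 := abs_sub_abs_le_abs_sub (derivWithin (u y) (Icc 0 T) s)
      (derivWithin (u y) (Icc 0 T) 0)
    linarith
  have hsmall : ∀ h, 0 < h → h < ρ → h < T → ∀ y ∈ closure Ω,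
      |u y h - u y 0| ≤ (M + ε) * h := by
    intro h hh hhρ hhT y hy
    have h1 := Convex.norm_image_sub_le_of_norm_hasDerivWithin_le (s := Icc 0 h) (f := u y)
      (f' := fun s => derivWithin (u y) (Icc 0 T) s) (C := M + ε) (x := 0) (y := h)
      (fun s hs => ((hu.differentiableOn_time y hy s ⟨hs.1, by linarith [hs.2]⟩).hasDerivWithinAt).mono
        (Icc_subset_Icc le_rfl hhT.le))
      (fun s hs => hder y hy s ⟨hs.1, by linarith [hs.2]⟩ (by linarith [hs.2]))
      (convex_Icc 0 h) ⟨le_rfl, hh.le⟩ ⟨hh.le, le_rfl⟩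
    rwa [sub_zero, Real.norm_eq_abs, Real.norm_eq_abs, abs_of_pos hh] at h1
  -- Comparison of u with its translate by h, in both directions, carries the bound from time 0 to
  -- time t.
  have hlip : ∀ h, 0 < h → h < ρ → h < T - t → |u x (t + h) - u x t| ≤ (M + ε) * h := by
    intro h hh hhρ hht
    have e1 := hs.isCylinderSolution hΩ hσ hη.1 hu hh.le (S := t) (by linarith) hH
    have e2 := hs.isCylinderSolution hΩ hσ hη.1 hu le_rfl (S := t) (by linarith [ht.2]) hH
    have hc1 : ∀ x ∈ Ω, ∀ z, |c x z| ≤ Cc := fun x hx => hc x (subset_closure hx)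
    have hm : 0 ≤ (M + ε) * h := by positivity
    have h0 : ∀ y ∈ closure Ω, |u y h - u y 0| ≤ (M + ε) * h :=
      hsmall h hh hhρ (by linarith [ht.1])
    have i1 := IsCylinderSolution.le_add hΩ hη.1 hq e1 e2 hc1 hc' hf' hm (fun y hy => by
      have := (abs_le.1 (h0 y hy)).2
      simp only [zero_add, add_zero]
      linarith) x (subset_closure hx) t ⟨ht.1.le, le_rfl⟩
    have i2 := IsCylinderSolution.le_add hΩ hη.1 hq e2 e1 hc1 hc' hf' hm (fun y hy => by
      have := (abs_le.1 (h0 y hy)).1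
      simp only [zero_add, add_zero]
      linarith) x (subset_closure hx) t ⟨ht.1.le, le_rfl⟩
    simp only [add_zero] at i1 i2
    exact abs_le.2 ⟨by linarith, by linarith⟩
  have hd := hu.hasDerivAt_time (subset_closure hx) ht
  have hslope : Tendsto (slope (u x) t) (𝓝[>] t) (𝓝 (deriv (u x) t)) :=
    (hasDerivWithinAt_iff_tendsto_slope' (s := Ioi t) (by simp)).1 hd.hasDerivWithinAt
  refine le_of_tendsto hslope.abs ?_
  have hmin : t < t + min ρ (T - t) := by
    have : 0 < min ρ (T - t) := lt_min hρ (by linarith [ht.2])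
    linarith
  filter_upwards [Ioo_mem_nhdsGT hmin] with s hs'
  have h1 := hlip (s - t) (by linarith [hs'.1])
    (by linarith [hs'.2, min_le_left ρ (T - t)]) (by linarith [hs'.2, min_le_right ρ (T - t)])
  rw [add_sub_cancel] at h1
  rw [slope_def_field, abs_div, abs_of_pos (sub_pos.2 hs'.1), div_le_iff₀ (sub_pos.2 hs'.1)]
  exact h1

end TimeDerivativeBound

/-! ### The maximum principle for w -/

section GradientBound

variable {n : ℕ} {Ω : Set (EuclideanSpace ℝ (Fin n))} {σ T η q : ℝ}
  {c f : EuclideanSpace ℝ (Fin n) → ℝ → ℝ} {φ u₀ : EuclideanSpace ℝ (Fin n) → ℝ}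
  {u : EuclideanSpace ℝ (Fin n) → ℝ → ℝ}

theorem hasFDerivAt_comp_graph (hΩ : IsOpen Ω) {F : EuclideanSpace ℝ (Fin n) → ℝ → ℝ}
    (hF : ContDiffOn ℝ 1 (Function.uncurry F) (closure Ω ×ˢ univ)) {x p : EuclideanSpace ℝ (Fin n)}
    (hx : x ∈ Ω) {g : EuclideanSpace ℝ (Fin n) → ℝ} (hg : HasFDerivAt g (innerSL ℝ p) x) :
    HasFDerivAt (fun z => F z (g z))
      (innerSL ℝ (spaceGrad Ω F x (g x) + deriv (F x) (g x) • p)) x := by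
  have h0 : HasFDerivAt (Function.uncurry F) (fderiv ℝ (Function.uncurry F) (x, g x)) (x, g x) :=
    ((hF.contDiffAt (prod_mem_nhds (closure_mem_nhds hΩ hx) univ_mem)).differentiableAt
      (by simp)).hasFDerivAt
  have h1 := h0.comp x ((hasFDerivAt_id x).prodMk hg)
  have h2 : HasFDerivAt (fun z => F z (g x)) _ x :=
    HasFDerivAt.comp (f := fun z => (z, g x)) (g := Function.uncurry F) x h0
      ((hasFDerivAt_id x).prodMk (hasFDerivAt_const (g x) x))
  have h3 : HasDerivAt (F x) (fderiv ℝ (Function.uncurry F) (x, g x) (0, 1)) (g x) :=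
    h0.comp_hasDerivAt (g x) ((hasDerivAt_const (g x) x).prodMk (hasDerivAt_id (g x)))
  have h4 := (hasFDerivAt_spaceGrad hΩ hx (F := F) (t := g x) h2.differentiableAt).unique h2
  refine h1.congr_fderiv ?_
  ext d
  have h5 := congrArg (fun L => L d) h4
  simp only [innerSL_apply_apply, ContinuousLinearMap.comp_apply, ContinuousLinearMap.prod_apply,
    ContinuousLinearMap.id_apply, _root_.zero_apply] at h5
  simp only [innerSL_apply_apply, ContinuousLinearMap.comp_apply, ContinuousLinearMap.prod_apply,
    ContinuousLinearMap.id_apply, inner_add_left, inner_smul_left, conj_trivial, h3.deriv, h5]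
  rw [show (d, inner ℝ p d) = (d, (0:ℝ)) + inner ℝ p d • ((0 : EuclideanSpace ℝ (Fin n)), (1:ℝ)) by
    simp, map_add, map_smul, smul_eq_mul]
  ring

/-- The constants in the gradient estimate. -/
structure IsGradientBoundData (Ω : Set (EuclideanSpace ℝ (Fin n))) (q : ℝ)
    (c f : EuclideanSpace ℝ (Fin n) → ℝ → ℝ) (φ u₀ : EuclideanSpace ℝ (Fin n) → ℝ)
    (N : EuclideanSpace ℝ (Fin n) → EuclideanSpace ℝ (Fin n)) (K C₀ C r δ ϑ V : ℝ) : Prop where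
  one_le : 1 ≤ K
  exponent_le : q ≤ K
  dim_le : (n : ℝ) ≤ K
  contDiff_normal : ContDiff ℝ 2 N
  normal_eq : ∀ y ∈ frontier Ω, ∀ ν, IsOutwardNormal Ω y ν → N y = ν
  contDiffOn_phi : ContDiffOn ℝ 2 φ (closure Ω)
  contDiffOn_c : ContDiffOn ℝ 1 (Function.uncurry c) (closure Ω ×ˢ univ)
  contDiffOn_f : ContDiffOn ℝ 1 (Function.uncurry f) (closure Ω ×ˢ univ)
  phi_le : ∀ x ∈ closure Ω, |φ x| ≤ K
  fderiv_phi_le : ∀ x ∈ closure Ω, ‖fderivWithin ℝ φ (closure Ω) x‖ ≤ K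
  fderiv_normal_le : ∀ x ∈ closure Ω, ‖fderiv ℝ N x‖ ≤ K
  field_le : ∀ x ∈ closure Ω, ‖φ x • N x‖ ≤ K
  fderiv_field_le : ∀ x ∈ closure Ω, 2 * ‖fderivWithin ℝ (fun y => φ y • N y) (closure Ω) x‖ ≤ K
  snd_fderiv_field_le : ∀ x ∈ Ω, ‖fderiv ℝ (fderiv ℝ (fun y => φ y • N y)) x‖ ≤ K
  c_le : ∀ x ∈ closure Ω, ∀ z, |c x z| ≤ K
  spaceGrad_c_le : ∀ x ∈ closure Ω, ∀ z, ‖spaceGrad Ω c x z‖ ≤ K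
  deriv_c_nonpos : ∀ x ∈ closure Ω, ∀ z, deriv (c x) z ≤ 0
  spaceGrad_f_le : ∀ x ∈ closure Ω, ∀ z, 2 * ‖spaceGrad Ω f x z‖ ≤ K
  deriv_f_nonneg : ∀ x ∈ closure Ω, ∀ z, 0 ≤ deriv (f x) z
  curvature_nonneg : 0 ≤ C₀
  curvature_le : curvatureConst Ω ≤ C₀
  curvature_lt : C₀ < C
  slope_le : C ≤ K
  radius_pos : 0 < r
  radius_lt : r < interiorRadiusConst Ω
  slope_div_le : C / r ≤ K
  coercive : ∀ x ∈ closure Ω, ∀ z, δ + ‖spaceGrad Ω c x z‖ + C * |c x z| + (n - 1) * (C / r)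
    + (1 + q) * C ^ 2 ≤ c x z ^ 2 / (n - 1)
  small_interior : ϑ * interiorErrorConst K ≤ 1 / 4
  small_coercive : ϑ * (16 * interiorErrorConst K ^ 2) < δ
  small_boundary : ϑ * (14 * K ^ 5) ≤ 1 / 2
  small_curvature : C₀ + ϑ * (14 * K ^ 5) < C
  large_pos : 0 < V
  large : ∀ v, V < v → v⁻¹ ≤ ϑ ∧ v ^ (-q) ≤ ϑ
  initial_le : ∀ x ∈ closure Ω, 1 + ‖gradientWithin u₀ (closure Ω) x‖ ≤ V

variable {N : EuclideanSpace ℝ (Fin n) → EuclideanSpace ℝ (Fin n)} {K C₀ C r δ ϑ V : ℝ}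

theorem IsGradientBoundData.contDiffOn_field (hd : IsGradientBoundData Ω q c f φ u₀ N K C₀ C r δ ϑ V) :
    ContDiffOn ℝ 2 (fun y => φ y • N y) (closure Ω) :=
  hd.contDiffOn_phi.smul hd.contDiff_normal.contDiffOn

/-- There is no interior space-time maximum of `(A - B |x - x_c|²) w` with large area element. -/
theorem IsGradientBoundData.not_isLocalMax
    (hd : IsGradientBoundData Ω q c f φ u₀ N K C₀ C r δ ϑ V) (hn : 2 ≤ n)
    (hΩ : IsBoundedC3Domain Ω) (hσ : 0 < σ) (hη : η ∈ Ioc (0:ℝ) 1) (hq : 0 < q)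
    (hu : IsParabolicCkHolder 2 σ (closure Ω) (Icc 0 T) u)
    (hu' : IsParabolicCkHolder 3 σ Ω (Ioc 0 T) u)
    (hs : IsRegularizedSolution Ω T η q c f φ u₀ u)
    (hut : ∀ x ∈ Ω, ∀ t ∈ Ioo 0 T, |deriv (u x) t + f x (u x t)| ≤ K)
    {x xc : EuclideanSpace ℝ (Fin n)} {t A B b : ℝ} (hx : x ∈ Ω) (ht : t ∈ Ioo 0 T)
    (hmax : IsLocalMax (fun z => (A - B * ‖z - xc‖ ^ 2) *
      gradQuantity η q (φ z • N z) (spaceGrad Ω u z t)) x)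
    (hρ : 0 < A - B * ‖x - xc‖ ^ 2) (hb : b = 2 * B / (A - B * ‖x - xc‖ ^ 2)) (hb0 : 0 ≤ b)
    (hbC : b ≤ (1 + q) * (C / r)) (hG : ‖b • (x - xc)‖ ≤ (1 + q) * C)
    (htime : ∀ s ∈ Icc 0 t, gradQuantity η q (φ x • N x) (spaceGrad Ω u x s) ≤
      gradQuantity η q (φ x • N x) (spaceGrad Ω u x t)) :
    areaElem η (spaceGrad Ω u x t) ≤ V := by
  by_contra! hV
  have hxc : x ∈ closure Ω := subset_closure hx
  have htI : t ∈ Icc 0 T := ⟨ht.1.le, ht.2.le⟩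
  obtain ⟨g, hg1, hg2⟩ := hu'.exists_hasDerivAt_spaceGrad hΩ.isOpen hσ hx ht
  have hp : ContDiffAt ℝ 2 (fun y => spaceGrad Ω u y t) x :=
    contDiffAt_spaceGrad hΩ.isOpen hx ((hu'.contDiffOn_space t ⟨ht.1, ht.2.le⟩).contDiffAt
      (hΩ.isOpen.mem_nhds hx)) (by norm_num)
  have hX : ContDiffAt ℝ 2 (fun y => φ y • N y) x :=
    hd.contDiffOn_field.contDiffAt (closure_mem_nhds hΩ.isOpen hx)
  have hsym := eventually_inner_fderiv_spaceGrad_symm hΩ.isOpen (F := u) (t := t)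
    (((hu.contDiffOn_space t htI)).mono subset_closure) hx
  have hux : HasFDerivAt (fun y => u y t) (innerSL ℝ (spaceGrad Ω u x t)) x :=
    hasFDerivAt_spaceGrad hΩ.isOpen hx (((hu.contDiffOn_space t htI).differentiableOn
      (by simp)).differentiableAt (closure_mem_nhds hΩ.isOpen hx))
  -- The time derivative of w is ⟨Du_t, ξ⟩, as X does not depend on t. It is nonnegative because
  -- w(x, ·) is maximal at the end of [0, t].
  have hgξ : 0 ≤ inner ℝ g (areaElem η (spaceGrad Ω u x t) ^ (q - 1) • spaceGrad Ω u x t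
      - φ x • N x) := by
    have h1 := (hasDerivAt_gradQuantity hη.1 hq hg1
      (hasDerivAt_const t (φ x • N x))).nonneg_of_forall_le ht.1 htime
    rw [inner_zero_left, sub_zero, real_inner_comm] at h1
    exact h1
  have heq : ∀ᶠ z in 𝓝 x, deriv (u z) t = flowOperator η (spaceGrad Ω u z t)
      (fderiv ℝ (fun y => spaceGrad Ω u y t) z) (c z (u z t)) (f z (u z t)) := by
    filter_upwards [hΩ.isOpen.mem_nhds hx] with z hz
    exact hs.deriv_eq_flowOperator hΩ hη.1 hu hz ht
  have hDX : fderiv ℝ (fun y => φ y • N y) x = fderivWithin ℝ (fun y => φ y • N y) (closure Ω) x :=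
    (fderivWithin_of_mem_nhds (closure_mem_nhds hΩ.isOpen hx)).symm
  have hC : 0 ≤ C := hd.curvature_nonneg.trans hd.curvature_lt.le
  exact interior_max_false hn hη hq hd.one_le hd.exponent_le hd.dim_le hd.small_interior
    hd.small_coercive hp hX hsym hmax hρ hb rfl rfl rfl rfl hg2 hgξ heq
    (hasFDerivAt_comp_graph hΩ.isOpen hd.contDiffOn_c hx hux)
    (hasFDerivAt_comp_graph hΩ.isOpen hd.contDiffOn_f hx hux) rfl (hd.deriv_c_nonpos x hxc _)
    (hd.deriv_f_nonneg x hxc _) (hd.field_le x hxc) (hDX ▸ hd.fderiv_field_le x hxc)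
    (hd.snd_fderiv_field_le x hx) (hd.spaceGrad_f_le x hxc _) (hut x hx t ht) le_rfl
    (hd.spaceGrad_c_le x hxc _) (hd.c_le x hxc _) hd.slope_le hG
    (div_nonneg hC hd.radius_pos.le) hd.slope_div_le hb0 hbC (hd.coercive x hxc _)
    (hd.large _ hV).1 (hd.large _ hV).2

theorem gradQuantity_le_of_areaElem_le {E : Type*} [NormedAddCommGroup E] [InnerProductSpace ℝ E]
    (hη : 0 < η) (hq : 0 < q) {X p : E} (hX : ‖X‖ ≤ K) (hp : areaElem η p ≤ V) :
    gradQuantity η q X p ≤ V ^ (q + 1) / (q + 1) + K * V := by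
  have h1 := areaElem_pos hη p
  have h2 : -inner ℝ X p ≤ K * V := by
    have h3 := neg_abs_le (inner ℝ X p)
    have h4 := abs_real_inner_le_norm X p
    have h5 : ‖X‖ * ‖p‖ ≤ K * V :=
      mul_le_mul hX ((norm_le_areaElem η p).trans hp) (norm_nonneg p) ((norm_nonneg X).trans hX)
    linarith
  have h3 : areaElem η p ^ (q + 1) / (q + 1) ≤ V ^ (q + 1) / (q + 1) := by gcongr
  rw [gradQuantity]
  linarith

/-- The maximum is taken over [0, t] with t < T, so that the equation and the boundary condition
hold even if it occurs at the last time. The second factor bounds w where v ≤ V, and the first is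
the largest value of the cut-off. -/
theorem IsGradientBoundData.gradQuantity_le
    (hd : IsGradientBoundData Ω q c f φ u₀ N K C₀ C r δ ϑ V) (hn : 2 ≤ n)
    (hΩ : IsBoundedC3Domain Ω) (hσ : 0 < σ) (hη : η ∈ Ioc (0:ℝ) 1) (hq : 0 < q)
    (hu : IsParabolicCkHolder 2 σ (closure Ω) (Icc 0 T) u)
    (hu' : IsParabolicCkHolder 3 σ Ω (Ioc 0 T) u)
    (hs : IsRegularizedSolution Ω T η q c f φ u₀ u)
    (hut : ∀ x ∈ Ω, ∀ t ∈ Ioo 0 T, |deriv (u x) t + f x (u x t)| ≤ K)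
    {x : EuclideanSpace ℝ (Fin n)} (hx : x ∈ closure Ω) {t : ℝ} (ht : t ∈ Ico 0 T) :
    gradQuantity η q (φ x • N x) (spaceGrad Ω u x t) ≤
      (1 + (1 + q) * C / (2 * r) * r ^ 2) * (V ^ (q + 1) / (q + 1) + K * V) := by
  have hr := hd.radius_pos
  have hC0 : 0 ≤ C := hd.curvature_nonneg.trans hd.curvature_lt.le
  have hK0 : 0 ≤ K := by linarith [hd.one_le]
  -- The slope 2Br of the cut-off at the boundary then equals (1+q)C, the bound for the normal
  -- derivative of w relative to w.
  obtain ⟨B, hB⟩ : ∃ B, B = (1 + q) * C / (2 * r) := ⟨_, rfl⟩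
  have hB0 : 0 ≤ B := by rw [hB]; positivity
  have hBr : 2 * B * r = (1 + q) * C := by rw [hB]; field_simp
  obtain ⟨L, hL⟩ : ∃ L, L = V ^ (q + 1) / (q + 1) + K * V := ⟨_, rfl⟩
  have hL0 : 0 < L := by
    have := Real.rpow_pos_of_pos hd.large_pos (q + 1)
    have := hd.large_pos
    rw [hL]
    positivity
  rw [← hB, ← hL]
  by_contra! hcon
  obtain ⟨Ψ, hΨ⟩ : ∃ Ψ : EuclideanSpace ℝ (Fin n) → ℝ → ℝ,
    Ψ = fun x t => gradQuantity η q (φ x • N x) (spaceGrad Ω u x t) := ⟨_, rfl⟩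
  have htT : Icc 0 t ⊆ Icc 0 T := Icc_subset_Icc le_rfl ht.2.le
  have hΨcont : ContinuousOn (fun p : EuclideanSpace ℝ (Fin n) × ℝ => Ψ p.1 p.2)
      (closure Ω ×ˢ Icc 0 t) := by
    rw [hΨ]
    have h1 : ContinuousOn (fun p : EuclideanSpace ℝ (Fin n) × ℝ => φ p.1 • N p.1)
        (closure Ω ×ˢ Icc 0 t) :=
      hd.contDiffOn_field.continuousOn.comp (f := Prod.fst) continuousOn_fst fun p hp => hp.1
    have h2 : ContinuousOn (fun p : EuclideanSpace ℝ (Fin n) × ℝ => spaceGrad Ω u p.1 p.2)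
        (closure Ω ×ˢ Icc 0 t) :=
      (hu.continuousOn_spaceGrad hΩ hσ).mono (prod_mono Subset.rfl htT)
    have h3 : Continuous fun z : EuclideanSpace ℝ (Fin n) × EuclideanSpace ℝ (Fin n) =>
        gradQuantity η q z.1 z.2 := continuous_gradQuantity hη.1
    have h4 := h3.comp_continuousOn (h1.prodMk h2)
    exact h4
  obtain ⟨⟨x₀, t₀⟩, ⟨hx₀, ht₀⟩, hmax⟩ := (hΩ.isCompact_cylinder t).exists_isMaxOn
    ⟨(x, t), hx, ht.1, le_rfl⟩ hΨcont
  have hmax : ∀ x ∈ closure Ω, ∀ s ∈ Icc 0 t, Ψ x s ≤ Ψ x₀ t₀ :=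
    fun x hx s hs => hmax (mk_mem_prod hx hs)
  have hbig : (1 + B * r ^ 2) * L < Ψ x₀ t₀ := by
    refine lt_of_lt_of_le hcon ?_
    have := hmax x hx t ⟨ht.1, le_rfl⟩
    rw [hΨ] at this ⊢
    exact this
  have hlarge : ∀ y ∈ closure Ω, ∀ s, L < Ψ y s → V < areaElem η (spaceGrad Ω u y s) := by
    intro y hy s h
    by_contra! h2
    have := gradQuantity_le_of_areaElem_le hη.1 hq (hd.field_le y hy) h2
    rw [hΨ] at h
    linarith
  -- Initially v ≤ 1 + ‖Du₀‖ ≤ V, so large values of w occur only at positive times.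
  have hzero : ∀ y ∈ closure Ω, ∀ s, 0 ≤ s → L < Ψ y s → 0 < s := by
    intro y hy s hs0 h
    refine lt_of_le_of_ne hs0 fun h0 => ?_
    have h1 := hlarge y hy s h
    have h2 : spaceGrad Ω u y s = gradientWithin u₀ (closure Ω) y := by
      rw [← h0, spaceGrad, gradientWithin, gradientWithin,
        fderivWithin_congr (fun z hz => hs.initial z hz) (hs.initial y hy)]
    rw [h2] at h1
    linarith [areaElem_le hη (gradientWithin u₀ (closure Ω) y), hd.initial_le y hy]
  have hbig' : L < Ψ x₀ t₀ := by
    refine lt_of_le_of_lt ?_ hbig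
    have : 0 ≤ B * r ^ 2 * L := by positivity
    linarith
  by_cases hx₀Ω : x₀ ∈ Ω
  · have ht₀' := hzero x₀ hx₀ t₀ ht₀.1 hbig'
    refine (hlarge x₀ hx₀ t₀ hbig').not_ge (hd.not_isLocalMax (A := 1) (B := 0) (b := 0) (xc := x₀)
      hn hΩ hσ hη hq hu hu' hs hut hx₀Ω ⟨ht₀', ht₀.2.trans_lt ht.2⟩ ?_ (by simp) (by simp) le_rfl
      (by positivity) (by rw [zero_smul, norm_zero]; positivity) ?_)
    · filter_upwards [hΩ.isOpen.mem_nhds hx₀Ω] with z hz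
      have := hmax z (subset_closure hz) t₀ ht₀
      rw [hΨ] at this
      simpa using this
    · intro s hs
      have := hmax x₀ hx₀ s ⟨hs.1, hs.2.trans ht₀.2⟩
      rwa [hΨ] at this
  · have hx₀f : x₀ ∈ frontier Ω := ⟨hx₀, by rwa [hΩ.isOpen.interior_eq]⟩
    obtain ⟨ν, hν⟩ := hΩ.boundary x₀ hx₀f
    have hν1 := hν.norm_eq_one
    have hball := hΩ.ball_subset_of_lt hd.radius_lt hx₀f hν
    have ht₀T : t₀ ∈ Icc 0 T := htT ht₀
    have hv := hd.large _ (hlarge x₀ hx₀ t₀ hbig')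
    have hK5 : 0 ≤ 14 * K ^ 5 := by positivity
    have hp : HasFDerivWithinAt (fun y => spaceGrad Ω u y t₀)
        (fderivWithin ℝ (fun y => spaceGrad Ω u y t₀) (closure Ω) x₀) (closure Ω) x₀ :=
      (((hu.contDiffOn_space t₀ ht₀T).gradientWithin_right (m := 1) hΩ.uniqueDiffOn_closure
        (by norm_num)).differentiableOn (by simp) x₀ hx₀).hasFDerivWithinAt
    have hX : HasFDerivWithinAt (fun y => φ y • N y)
        (fderivWithin ℝ (fun y => φ y • N y) (closure Ω) x₀) (closure Ω) x₀ :=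
      (hd.contDiffOn_field.differentiableOn (by simp) x₀ hx₀).hasFDerivWithinAt
    have hφ : HasFDerivWithinAt φ (fderivWithin ℝ φ (closure Ω) x₀) (closure Ω) x₀ :=
      (hd.contDiffOn_phi.differentiableOn (by simp) x₀ hx₀).hasFDerivWithinAt
    have hDX : ‖fderivWithin ℝ (fun y => φ y • N y) (closure Ω) x₀‖ ≤ K := by
      have h1 := hd.fderiv_field_le x₀ hx₀
      have h2 := norm_nonneg (fderivWithin ℝ (fun y => φ y • N y) (closure Ω) x₀)
      linarith
    have hlt := boundary_max_normal_derivative_lt hn hΩ hd.contDiff_normal hd.normal_eq hx₀f hν hη.1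
      hq hp hX hφ rfl
      (fun a b => inner_fderivWithin_gradientWithin_symm (hu.contDiffOn_space t₀ ht₀T)
        hΩ.uniqueDiffOn_closure hΩ.closure_subset_closure_interior hx₀ a b)
      (fun y hy => by
        obtain ⟨ν', hν'⟩ := hΩ.boundary y hy
        rw [hd.normal_eq y hy ν' hν']
        exact hs.boundary y hy ν' hν' t₀ ⟨ht₀.1, ht₀.2.trans_lt ht.2⟩)
      (fun y hy => by
        have := hmax y hy t₀ ht₀
        rwa [hΨ] at this) rfl rfl rfl hd.one_le hd.exponent_le hd.curvature_nonneg hd.curvature_le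
      (hd.curvature_lt.le.trans hd.slope_le) hd.slope_le (hd.phi_le x₀ hx₀)
      (hd.fderiv_phi_le x₀ hx₀) (hd.fderiv_normal_le x₀ hx₀)
      hDX
      ((mul_le_mul_of_nonneg_right hv.2 hK5).trans hd.small_boundary)
      (lt_of_le_of_lt (by linarith [mul_le_mul_of_nonneg_right hv.2 hK5]) hd.small_curvature)
    have hline := eventually_add_smul_neg_mem_closure hr hν1 hball
    have hx₀0 : x₀ + (0:ℝ) • -ν = x₀ := by simp
    have hΨd := hasDerivWithinAt_gradQuantity hη.1 hq (hp.hasDerivWithinAt_line hline)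
      (hX.hasDerivWithinAt_line hline)
    rw [hx₀0, map_neg, map_neg, inner_neg_right, inner_neg_left] at hΨd
    obtain ⟨x₁, hx₁, t₁, ht₁, hgt, hmax₁⟩ := exists_interior_max_of_boundary_max (B := B) hΨcont ht₀
      hmax hr hν1 hball (by rw [hΨ]; exact hΨd) (by
        rw [hBr, hΨ]
        linarith)
    have hx₁Ω := hball hx₁
    have hx₁c : x₁ ∈ closure Ω := subset_closure hx₁Ω
    rw [mem_ball_iff_norm] at hx₁
    obtain ⟨ρ, hρ⟩ : ∃ ρ, ρ = 1 + B * r ^ 2 - B * ‖x₁ - (x₀ - r • ν)‖ ^ 2 := ⟨_, rfl⟩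
    have hρ1 : 1 ≤ ρ := by
      have : B * ‖x₁ - (x₀ - r • ν)‖ ^ 2 ≤ B * r ^ 2 := by gcongr
      linarith
    have hρA : ρ ≤ 1 + B * r ^ 2 := by
      have : 0 ≤ B * ‖x₁ - (x₀ - r • ν)‖ ^ 2 := by positivity
      linarith
    -- Passing from ρw back to w costs at most the factor 1 + Br², which was included in the
    -- threshold.
    have hΨ1 : L < Ψ x₁ t₁ := by
      by_contra! h
      rw [← hρ] at hgt
      have h2 : ρ * Ψ x₁ t₁ ≤ ρ * L := by gcongr
      have h3 : ρ * L ≤ (1 + B * r ^ 2) * L := by gcongr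
      linarith
    have ht₁' := hzero x₁ hx₁c t₁ ht₁.1 hΨ1
    have hb : 2 * B / ρ ≤ 2 * B := div_le_self (by positivity) hρ1
    have hb0 : 0 ≤ 2 * B / ρ := by positivity
    refine (hlarge x₁ hx₁c t₁ hΨ1).not_ge (hd.not_isLocalMax (A := 1 + B * r ^ 2) (B := B)
      (b := 2 * B / ρ) (xc := x₀ - r • ν)
      hn hΩ hσ hη hq hu hu' hs hut hx₁Ω ⟨ht₁', ht₁.2.trans_lt ht.2⟩ ?_ (by linarith) (by rw [hρ])
      hb0 (hb.trans_eq (by rw [hB]; field_simp)) ?_ ?_)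
    · filter_upwards [Metric.isOpen_ball.mem_nhds (mem_ball_iff_norm.2 hx₁)] with z hz
      have := hmax₁ z (Metric.ball_subset_closedBall hz) t₁ ht₁
      rwa [hΨ] at this
    · rw [norm_smul, Real.norm_eq_abs, abs_of_nonneg hb0, ← hBr]
      gcongr
    · intro s hs
      have := hmax₁ x₁ (Metric.ball_subset_closedBall (mem_ball_iff_norm.2 hx₁)) s
        ⟨hs.1, hs.2.trans ht₁.2⟩
      rw [hΨ] at this
      exact le_of_mul_le_mul_left this (by linarith)

end GradientBound

/-! ### Choice of the constants -/

section Constants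

variable {n : ℕ} {Ω : Set (EuclideanSpace ℝ (Fin n))} {σ T η q : ℝ}
  {c f : EuclideanSpace ℝ (Fin n) → ℝ → ℝ} {φ u₀ : EuclideanSpace ℝ (Fin n) → ℝ}
  {u : EuclideanSpace ℝ (Fin n) → ℝ → ℝ}

theorem IsBoundedC3Domain.frontier_nonempty (hn : 2 ≤ n) (hΩ : IsBoundedC3Domain Ω) :
    (frontier Ω).Nonempty := by
  by_contra! h
  have h1 : IsClopen Ω := isClopen_iff_frontier_eq_empty.2 h
  have h2 := h1.eq_univ hΩ.isConnected.nonempty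
  have : Nonempty (Fin n) := ⟨⟨0, by omega⟩⟩
  have h3 := hΩ.isBounded
  rw [h2] at h3
  exact NormedSpace.unbounded_univ ℝ (EuclideanSpace ℝ (Fin n)) h3

/-- Taking the positive part of C₀ merges the two entries of the `max`: for C₀ ≤ 0 the entry 0
suffices and the curvature terms vanish, while for C₀ > 0 the sign is 1. -/
theorem IsCoerciveForce.exists_lt (h : IsCoerciveForce Ω q c) {C₀ : ℝ}
    (hC₀ : C₀ = max (curvatureConst Ω) 0) :
    ∃ δ > 0, ∀ x ∈ closure Ω, ∀ z, δ + ‖spaceGrad Ω c x z‖ + C₀ * |c x z|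
      + (n - 1) * (C₀ / interiorRadiusConst Ω) + (1 + q) * C₀ ^ 2 < c x z ^ 2 / (n - 1) := by
  obtain ⟨δ, hδ, hc⟩ := h
  refine ⟨δ, hδ, fun x hx z => ?_⟩
  have h1 := hc x hx z
  have h2 : 1 / ((n:ℝ) - 1) * c x z ^ 2 = c x z ^ 2 / (n - 1) := by ring
  rw [h2] at h1
  rcases le_or_gt (curvatureConst Ω) 0 with h0 | h0
  · rw [max_eq_right h0] at hC₀
    have := (le_max_left _ _).trans_lt h1
    rw [hC₀]
    simp only [zero_mul, zero_div, mul_zero, add_zero, ne_eq, OfNat.ofNat_ne_zero,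
      not_false_eq_true, zero_pow]
    linarith
  · rw [max_eq_left h0.le] at hC₀
    have h3 := (le_max_right _ _).trans_lt h1
    rw [Real.sign_of_pos h0, ← hC₀] at h3
    linarith [show (n - 1) * C₀ / interiorRadiusConst Ω =
      ((n:ℝ) - 1) * (C₀ / interiorRadiusConst Ω) by ring]

/-- The coercivity survives if the curvature bound is slightly increased and the radius of the
interior balls is slightly decreased. -/
theorem exists_slope_radius {C₀ K₀ Cc δ : ℝ} (hK₀ : 0 < K₀) (hδ : 0 < δ) :
    ∃ C r, C₀ < C ∧ 0 < r ∧ r < K₀ ∧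
      C * Cc + (n - 1) * (C / r) + (1 + q) * C ^ 2 ≤
        δ / 2 + (C₀ * Cc + (n - 1) * (C₀ / K₀) + (1 + q) * C₀ ^ 2) := by
  have hcont : ContinuousAt (fun ε : ℝ => (C₀ + ε) * Cc + (n - 1) * ((C₀ + ε) / (K₀ - ε))
      + (1 + q) * (C₀ + ε) ^ 2) 0 := by
    refine ContinuousAt.add (ContinuousAt.add (by fun_prop) (ContinuousAt.mul (by fun_prop)
      (ContinuousAt.div (by fun_prop) (by fun_prop) ?_))) (by fun_prop)
    simpa using hK₀.ne'
  have hev := hcont.eventually_lt_const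
    (u := δ / 2 + (C₀ * Cc + (n - 1) * (C₀ / K₀) + (1 + q) * C₀ ^ 2)) (by simp; linarith)
  obtain ⟨ε, h1, h2⟩ := ((hev.filter_mono (nhdsWithin_le_nhds (s := Ioi 0))).and
    (Ioo_mem_nhdsGT hK₀)).exists
  exact ⟨C₀ + ε, K₀ - ε, by linarith [h2.1], by linarith [h2.2], by linarith [h2.1], h1.le⟩

theorem exists_bounds_of_contDiffOn_two {F : Type*} [NormedAddCommGroup F] [NormedSpace ℝ F]
    (hΩ : IsBoundedC3Domain Ω) {X : EuclideanSpace ℝ (Fin n) → F}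
    (hX : ContDiffOn ℝ 2 X (closure Ω)) :
    ∃ K, (∀ x ∈ closure Ω, ‖X x‖ ≤ K) ∧
      (∀ x ∈ closure Ω, ‖fderivWithin ℝ X (closure Ω) x‖ ≤ K) ∧
      ∀ x ∈ Ω, ‖fderiv ℝ (fderiv ℝ X) x‖ ≤ K := by
  have hcl := hΩ.isCompact_closure
  have hu := hΩ.uniqueDiffOn_closure
  have hX1 : ContDiffOn ℝ 1 (fderivWithin ℝ X (closure Ω)) (closure Ω) :=
    hX.fderivWithin hu (by norm_num)
  obtain ⟨K₁, h₁⟩ := hcl.exists_bound_of_continuousOn hX.continuousOn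
  obtain ⟨K₂, h₂⟩ := hcl.exists_bound_of_continuousOn hX1.continuousOn
  obtain ⟨K₃, h₃⟩ := hcl.exists_bound_of_continuousOn
    (hX1.continuousOn_fderivWithin hu (by simp))
  refine ⟨max K₁ (max K₂ K₃), fun x hx => (h₁ x hx).trans (by simp),
    fun x hx => (h₂ x hx).trans (by simp), fun x hx => ?_⟩
  have h4 : fderiv ℝ (fderiv ℝ X) x =
      fderivWithin ℝ (fderivWithin ℝ X (closure Ω)) (closure Ω) x := by
    rw [fderivWithin_of_mem_nhds (closure_mem_nhds hΩ.isOpen hx)]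
    refine Filter.EventuallyEq.fderiv_eq ?_
    filter_upwards [hΩ.isOpen.mem_nhds hx] with y hy
    exact (fderivWithin_of_mem_nhds (closure_mem_nhds hΩ.isOpen hy)).symm
  rw [h4]
  exact (h₃ x (subset_closure hx)).trans (by simp)

theorem exists_small {a₁ b₁ a₂ b₂ a₃ b₃ a₄ b₄ : ℝ} (h₁ : 0 < b₁) (h₂ : 0 < b₂) (h₃ : 0 < b₃)
    (h₄ : 0 < b₄) : ∃ ϑ > 0, ϑ * a₁ < b₁ ∧ ϑ * a₂ < b₂ ∧ ϑ * a₃ < b₃ ∧ ϑ * a₄ < b₄ := by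
  have key : ∀ a b : ℝ, 0 < b → ∀ᶠ ϑ in 𝓝[>] (0:ℝ), ϑ * a < b := by
    intro a b hb
    have : Tendsto (fun ϑ : ℝ => ϑ * a) (𝓝 0) (𝓝 0) :=
      (continuous_id.mul continuous_const).tendsto' 0 0 (by simp)
    exact nhdsWithin_le_nhds (this.eventually (gt_mem_nhds hb))
  obtain ⟨ϑ, hϑ, h⟩ := (eventually_mem_nhdsWithin.and ((key a₁ b₁ h₁).and ((key a₂ b₂ h₂).and
    ((key a₃ b₃ h₃).and (key a₄ b₄ h₄))))).exists
  exact ⟨ϑ, hϑ, h⟩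

theorem differentiable_of_contDiffOn_uncurry {F : EuclideanSpace ℝ (Fin n) → ℝ → ℝ}
    (hF : ContDiffOn ℝ 1 (Function.uncurry F) (closure Ω ×ˢ univ)) {x : EuclideanSpace ℝ (Fin n)}
    (hx : x ∈ closure Ω) : Differentiable ℝ (F x) := by
  have h : ContDiffOn ℝ 1 (fun z => Function.uncurry F (x, z)) univ :=
    hF.comp (f := fun z => (x, z)) (contDiff_const.prodMk contDiff_id).contDiffOn
      fun z _ => ⟨hx, mem_univ z⟩
  exact (contDiffOn_univ.1 h).differentiable (by simp)

/-- Once v^q ≥ (q+1)(K+1), the power term exceeds (K+1)v, and the linear term takes away at most Kv,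
so w ≥ v. -/
theorem areaElem_le_of_gradQuantity_le {E : Type*} [NormedAddCommGroup E] [InnerProductSpace ℝ E]
    {K V W : ℝ} {X p : E} (hη : 0 < η) (hq : 0 < q) (hX : ‖X‖ ≤ K)
    (hV : ∀ v, V ≤ v → (q + 1) * (K + 1) ≤ v ^ q) (h : gradQuantity η q X p ≤ W) :
    areaElem η p ≤ max V W := by
  rcases le_or_gt (areaElem η p) V with h1 | h1
  · exact h1.trans (le_max_left _ _)
  · refine le_trans ?_ (h.trans (le_max_right _ _))
    have h2 := areaElem_pos hη p
    have h3 := (abs_le.1 (abs_real_inner_le_norm X p)).2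
    have h4 : ‖X‖ * ‖p‖ ≤ K * areaElem η p :=
      mul_le_mul hX (norm_le_areaElem η p) (norm_nonneg p) ((norm_nonneg X).trans hX)
    have h5 : (K + 1) * areaElem η p ≤ areaElem η p ^ (q + 1) / (q + 1) := by
      rw [Real.rpow_add_one h2.ne', le_div_iff₀ (by linarith)]
      have := mul_le_mul_of_nonneg_right (hV _ h1.le) h2.le
      linarith
    rw [gradQuantity]
    linarith

/-- The order of choice avoids circularity: C and r spend half of the coercivity gap δ, K dominates
all data bounds and the prescribed L, ϑ is small depending on K, and V is large depending on ϑ. T, η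
and u play no part. The number L is reserved for the bound of u_t + f. -/
theorem exists_isGradientBoundData (hn : 2 ≤ n) (hΩ : IsBoundedC3Domain Ω) (hq : 0 < q)
    (hc : ContDiffOn ℝ 1 (Function.uncurry c) (closure Ω ×ˢ univ))
    (hf : ContDiffOn ℝ 1 (Function.uncurry f) (closure Ω ×ˢ univ))
    (hφ : ContDiffOn ℝ 2 φ (closure Ω)) {Cc P₀ : ℝ}
    (hcb : ∀ x ∈ closure Ω, ∀ z : ℝ,
      |c x z| ≤ Cc ∧ ‖spaceGrad Ω c x z‖ ≤ Cc ∧ deriv (c x) z ≤ 0)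
    (hfb : ∀ x ∈ closure Ω, ∀ z : ℝ,
      |f x z| ≤ Cc ∧ ‖spaceGrad Ω f x z‖ ≤ Cc ∧ 0 ≤ deriv (f x) z)
    (hP₀ : ∀ x ∈ closure Ω, ‖gradientWithin u₀ (closure Ω) x‖ ≤ P₀)
    (hcoercive : IsCoerciveForce Ω q c) (L : ℝ) :
    ∃ N K C₀ C r δ ϑ V, IsGradientBoundData Ω q c f φ u₀ N K C₀ C r δ ϑ V ∧ L ≤ K := by
  obtain ⟨N, hN, hN'⟩ := hΩ.exists_normal_field
  obtain ⟨C₀, hC₀⟩ : ∃ C₀, C₀ = max (curvatureConst Ω) 0 := ⟨_, rfl⟩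
  obtain ⟨δ, hδ, hcδ⟩ := hcoercive.exists_lt hC₀
  have hK₀ := hΩ.interiorRadiusConst_pos (hΩ.frontier_nonempty hn)
  obtain ⟨C, r, hC, hr, hrK₀, hCr⟩ := exists_slope_radius (n := n) (q := q) (C₀ := C₀) (Cc := Cc)
    hK₀ hδ
  obtain ⟨B₁, hB₁, hB₁', -⟩ := exists_bounds_of_contDiffOn_two hΩ hφ
  have hX : ContDiffOn ℝ 2 (fun y => φ y • N y) (closure Ω) := hφ.smul hN.contDiffOn
  obtain ⟨B₂, hB₂, hB₂', hB₂''⟩ := exists_bounds_of_contDiffOn_two hΩ hX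
  obtain ⟨B₃, hB₃⟩ := hΩ.isCompact_closure.exists_bound_of_continuousOn
    (hN.continuous_fderiv (by simp)).continuousOn
  obtain ⟨K, hK⟩ := ({1, q, (n:ℝ), B₁, B₂, 2 * B₂, B₃, Cc, 2 * Cc, C, C / r, L} :
    Finset ℝ).exists_le
  simp only [Finset.mem_insert, Finset.mem_singleton, forall_eq_or_imp, forall_eq] at hK
  obtain ⟨k1, k2, k3, k4, k5, k6, k7, k8, k9, k10, k11, k12⟩ := hK
  obtain ⟨ϑ, hϑ, s1, s2, s3, s4⟩ := exists_small (a₁ := interiorErrorConst K) (b₁ := 1 / 4)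
    (a₂ := 16 * interiorErrorConst K ^ 2) (b₂ := δ / 2) (a₃ := 14 * K ^ 5) (b₃ := 1 / 2)
    (a₄ := 14 * K ^ 5) (b₄ := C - C₀) (by norm_num) (by linarith) (by norm_num) (by linarith)
  obtain ⟨V, hV⟩ := eventually_atTop.1
    ((tendsto_inv_atTop_zero.eventually (ge_mem_nhds hϑ)).and
      ((tendsto_rpow_neg_atTop hq).eventually (ge_mem_nhds hϑ)))
  refine ⟨N, K, C₀, C, r, δ / 2, ϑ, max V (max 1 (1 + P₀)), ?_, k12⟩
  exact
  { one_le := k1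
    exponent_le := k2
    dim_le := k3
    contDiff_normal := hN
    normal_eq := hN'
    contDiffOn_phi := hφ
    contDiffOn_c := hc
    contDiffOn_f := hf
    phi_le := fun x hx => (hB₁ x hx).trans k4
    fderiv_phi_le := fun x hx => (hB₁' x hx).trans k4
    fderiv_normal_le := fun x hx => (hB₃ x hx).trans k7
    field_le := fun x hx => (hB₂ x hx).trans k5
    fderiv_field_le := fun x hx => by linarith [hB₂' x hx]
    snd_fderiv_field_le := fun x hx => (hB₂'' x hx).trans k5
    c_le := fun x hx z => (hcb x hx z).1.trans k8
    spaceGrad_c_le := fun x hx z => (hcb x hx z).2.1.trans k8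
    deriv_c_nonpos := fun x hx z => (hcb x hx z).2.2
    spaceGrad_f_le := fun x hx z => by linarith [(hfb x hx z).2.1]
    deriv_f_nonneg := fun x hx z => (hfb x hx z).2.2
    curvature_nonneg := hC₀ ▸ le_max_right _ _
    curvature_le := hC₀ ▸ le_max_left _ _
    curvature_lt := hC
    slope_le := k10
    radius_pos := hr
    radius_lt := hrK₀
    slope_div_le := k11
    coercive := fun x hx z => by
      have h1 := hcδ x hx z
      have h2 : (C - C₀) * |c x z| ≤ (C - C₀) * Cc :=
        mul_le_mul_of_nonneg_left (hcb x hx z).1 (by linarith)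
      linarith
    small_interior := s1.le
    small_coercive := s2
    small_boundary := s3.le
    small_curvature := by linarith
    large_pos := by
      have := (le_max_left 1 (1 + P₀)).trans (le_max_right V _)
      linarith
    large := fun v hv => hV v ((le_max_left _ _).trans hv.le)
    initial_le := fun x hx => by
      have := (le_max_right 1 (1 + P₀)).trans (le_max_right V _)
      linarith [hP₀ x hx] }

end Constants

end

/-! ### The gradient estimate -/

theorem proposition2p2 (n : ℕ) (hn : 2 ≤ n)
    (Ω : Set (EuclideanSpace ℝ (Fin n))) (hΩ : IsBoundedC3Domain Ω)
    (α : ℝ) (hα : α ∈ Ioo (0 : ℝ) 1) (q : ℝ) (hq : 0 < q)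
    (c f : EuclideanSpace ℝ (Fin n) → ℝ → ℝ) (φ u₀ : EuclideanSpace ℝ (Fin n) → ℝ)
    (hc : IsCkHolder 1 α (Function.uncurry c) (closure Ω ×ˢ univ))
    (hf : IsCkHolder 1 α (Function.uncurry f) (closure Ω ×ˢ univ))
    (hφ : ContDiffOn ℝ 3 φ (closure Ω))
    (hu₀ : IsCkHolder 2 α u₀ (closure Ω))
    (hcb : ∃ C : ℝ, ∀ x ∈ closure Ω, ∀ z : ℝ,
      |c x z| ≤ C ∧ ‖spaceGrad Ω c x z‖ ≤ C ∧ deriv (c x) z ≤ 0)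
    (hfb : ∃ C : ℝ, ∀ x ∈ closure Ω, ∀ z : ℝ,
      |f x z| ≤ C ∧ ‖spaceGrad Ω f x z‖ ≤ C ∧ 0 ≤ deriv (f x) z)
    (hcoercive : IsCoerciveForce Ω q c) :
    ∃ R : ℝ, 1 < R ∧
      ∀ T : ℝ, 0 < T → ∀ η ∈ Ioc (0 : ℝ) 1, ∀ σ ∈ Ioo (0 : ℝ) 1,
        ∀ u : EuclideanSpace ℝ (Fin n) → ℝ → ℝ,
          IsParabolicCkHolder 2 σ (closure Ω) (Icc 0 T) u →
          IsParabolicCkHolder 3 σ Ω (Ioc 0 T) u →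
          IsRegularizedSolution Ω T η q c f φ u₀ u →
          ∀ x ∈ closure Ω, ∀ t ∈ Icc 0 T, ‖spaceGrad Ω u x t‖ ≤ R := by
  obtain ⟨C₁, hC₁⟩ := hcb
  obtain ⟨C₂, hC₂⟩ := hfb
  obtain ⟨Cc, hCc⟩ : ∃ Cc, Cc = max C₁ C₂ := ⟨_, rfl⟩
  have h₁ : C₁ ≤ Cc := hCc ▸ le_max_left _ _
  have h₂ : C₂ ≤ Cc := hCc ▸ le_max_right _ _
  have hcl := hΩ.isCompact_closure
  have hun := hΩ.uniqueDiffOn_closure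
  have hu₀2 : ContDiffOn ℝ 2 u₀ (closure Ω) := hu₀.1
  obtain ⟨H₀, hH₀⟩ := hcl.exists_bound_of_continuousOn
    (hu₀2.continuousOn_iteratedFDerivWithin (m := 2) le_rfl hun)
  obtain ⟨P₀, hP₀⟩ := hcl.exists_bound_of_continuousOn
    (hu₀2.gradientWithin_right (m := 1) hun (by norm_num)).continuousOn
  have hcb : ∀ x ∈ closure Ω, ∀ z : ℝ,
      |c x z| ≤ Cc ∧ ‖spaceGrad Ω c x z‖ ≤ Cc ∧ deriv (c x) z ≤ 0 := fun x hx z =>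
    ⟨(hC₁ x hx z).1.trans h₁, (hC₁ x hx z).2.1.trans h₁, (hC₁ x hx z).2.2⟩
  have hfb : ∀ x ∈ closure Ω, ∀ z : ℝ,
      |f x z| ≤ Cc ∧ ‖spaceGrad Ω f x z‖ ≤ Cc ∧ 0 ≤ deriv (f x) z := fun x hx z =>
    ⟨(hC₂ x hx z).1.trans h₂, (hC₂ x hx z).2.1.trans h₂, (hC₂ x hx z).2.2⟩
  have hc1 : ContDiffOn ℝ 1 (Function.uncurry c) (closure Ω ×ˢ univ) := by exact_mod_cast hc.1
  have hf1 : ContDiffOn ℝ 1 (Function.uncurry f) (closure Ω ×ˢ univ) := by exact_mod_cast hf.1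
  -- The prescribed lower bound for K is the bound of u_t in terms of u₀, increased by Cc to account
  -- for f.
  obtain ⟨N, K, C₀, C, r, δ, ϑ, V, hd, hLK⟩ := exists_isGradientBoundData hn hΩ hq hc1 hf1
    (hφ.of_le (by norm_num)) hcb hfb hP₀ hcoercive ((n + 1) * H₀ + Cc * (2 + P₀) + Cc)
  obtain ⟨V', hV'⟩ := eventually_atTop.1
    ((tendsto_rpow_atTop hq).eventually_ge_atTop ((q + 1) * (K + 1)))
  obtain ⟨W, hW⟩ : ∃ W, W =
    (1 + (1 + q) * C / (2 * r) * r ^ 2) * (V ^ (q + 1) / (q + 1) + K * V) := ⟨_, rfl⟩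
  refine ⟨max 2 (max V' W), lt_max_of_lt_left (by norm_num), ?_⟩
  intro T hT η hη σ hσ u hu hu' hs x hx
  have hut : ∀ x ∈ Ω, ∀ t ∈ Ioo 0 T, |deriv (u x) t + f x (u x t)| ≤ K := by
    intro x hx t ht
    have h3 := hs.abs_deriv_le hΩ hσ.1 hη hq hu (fun x hx z => (hcb x hx z).1)
      (fun x hx z => (hfb x hx z).1)
      (fun x hx => antitone_of_deriv_nonpos
        (differentiable_of_contDiffOn_uncurry hc1 (subset_closure hx))
        fun z => (hcb x (subset_closure hx) z).2.2)
      (fun x hx => monotone_of_deriv_nonneg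
        (differentiable_of_contDiffOn_uncurry hf1 (subset_closure hx))
        fun z => (hfb x (subset_closure hx) z).2.2) hH₀ hP₀ hx ht
    have h4 := (hfb x (subset_closure hx) (u x t)).1
    exact (abs_add_le _ _).trans (by linarith)
  have hmain : ∀ t ∈ Ico 0 T, ‖spaceGrad Ω u x t‖ ≤ max 2 (max V' W) := by
    intro t ht
    have h3 := hd.gradQuantity_le hn hΩ hσ.1 hη hq hu hu' hs hut hx ht
    rw [← hW] at h3
    exact (norm_le_areaElem η _).trans ((areaElem_le_of_gradQuantity_le hη.1 hq (hd.field_le x hx)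
      hV' h3).trans (le_max_right _ _))
  intro t ht
  -- The maximum principle covers t < T only, and the final time follows by continuity of Du.
  have hcl' : closure (Ico 0 T) = Icc 0 T := closure_Ico hT.ne
  have hcont : ContinuousOn (fun t => ‖spaceGrad Ω u x t‖) (closure (Ico 0 T)) := by
    rw [hcl']
    exact ((hu.continuousOn_spaceGrad hΩ hσ.1).comp (f := fun t => (x, t))
      (Continuous.continuousOn (by fun_prop)) fun t ht => ⟨hx, ht⟩).norm
  exact le_on_closure hmain hcont continuousOn_const (by rwa [hcl'])
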